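/- **Setting.** Let $\mathbf\Sigma\in\mathbb R^{m\times n}$ have rank $d\ge1$, with singular value decomposition $\mathbf\Sigma=\Phi\mathbf\Sigma'\Psi^\top$, where $\Phi\in\mathbb R^{m\times m}$, $\Psi\in\mathbb R^{n\times n}$ are orthogonal and the only nonzero entries of $\mathbf\Sigma'$ are $\mathbf\Sigma'_{ii}=\sigma_i$ $(i\le d)$, $\sigma_1\ge\dots\ge\sigma_d>0$. Put $\Sigma=\mathrm{diag}(\sigma_1,\dots,\sigma_d)$, $\kappa=\sigma_1/\sigma_d$, $m'=m-d$, $n'=n-d$. Given $\mathbf U_0\in\mathbb R^{m\times d}$, $\mathbf V_0\in\mathbb R^{n\times d}$ and $\eta>0$, gradient descent for $\frac12\|\mathbf U\mathbf V^\top-\mathbf\Sigma\|_F^2$ is $$\mathbf U_{t+1}=\mathbf U_t+\eta(\mathbf\Sigma-\mathbf U_t\mathbf V_t^\top)\mathbf V_t,\qquad \mathbf V_{t+1}=\mathbf V_t+\eta(\mathbf\Sigma-\mathbf U_t\mathbf V_t^\top)^\top\mathbf U_t .$$ Let $U_t$ and $J_t$ be the upper $d\times d$ and the lower $m'\times d$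 block of $\Phi^{-1}\mathbf U_t$, let $V_t$ and $K_t$ be the upper $d\times d$ and the lower $n'\times d$ block of $\Psi^{-1}\mathbf V_t$, and set $$A_t=\tfrac{U_t+V_t}2,\qquad B_t=\tfrac{U_t-V_t}2,\qquad P_t=\Sigma-A_tA_t^\top+B_tB_t^\top .$$ Here $\sigma_i(\cdot)$ is the $i$-th largest singular value and $\preceq$ the Loewner order. For $c,\varepsilon>0$ say that the initialization is *$(c,\varepsilon)$-bounded* if $\sigma_d(A_0)\ge\frac{\varepsilon}{c\sqrt d}$, $\sigma_1(A_0)\le c\sqrt d\,\varepsilon$, $\|B_0\|_F\le cd\varepsilon$, $\|J_0\|_{op}\le c\varepsilon\sqrt{\max\{m',d\}}$ and $\|K_0\|_{op}\le c\varepsilon\sqrt{\max\{n',d\}}$. **Theorem (warm-up stage).** (a) There is an integer $p\ge0$ such that for every $c>0$ there are $k_1,k_2,C>0$, depending only on $c$, with the following property. For all $m,n,d,\mathbf\Sigma,\Phi,\Psi$ as above and all $\varepsilon,\eta$ with $$0<\varepsilon\le\frac{k_1}{(1+\ln((m+n)\kappa))^p}\cdot\frac{\sigma_d}{\sqrt{d^3\sigma_1}\,(m+n)},\qquad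 0<\eta\le k_2\frac{\sigma_d\varepsilon^2}{d\sigma_1^3},$$ there is $T_0\in\mathbb N$ with $T_0\le\frac{C}{\eta\sigma_d}\ln\frac{d\sigma_d}{\varepsilon^2}$ such that, for every $(c,\varepsilon)$-bounded initialization and all $t\le T_0$, - $\frac{\varepsilon^2}{c^2d}I\preceq A_tA_t^\top\preceq2\Sigma$; - $\|B_t\|_F\le2cd\varepsilon$; - $\|J_t\|_{op}\le c\varepsilon\sqrt{\max\{m',d\}}$ and $\|K_t\|_{op}\le c\varepsilon\sqrt{\max\{n',d\}}$, and moreover $\sigma_d(A_{T_0})\ge\sqrt{\sigma_d/2}$ and $\sigma_1(P_{T_0})\le\sigma_d/4$. (b) For every $\delta>0$ there is $c>0$, depending only on $\delta$, such that for all $m,n\ge d\ge1$, all orthogonal $\Phi,\Psi$ and all $\varepsilon>0$, if the entries of $\mathbf U_0$ and $\mathbf V_0$ are independent Gaussians with mean $0$ and variance $\varepsilon^2$, then the initialization is $(c,\varepsilon)$-bounded with probability at least $1-\delta$. Hence the conclusions of (a) hold with probability at least $1-\delta$ for this $c$. -/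

import Mathlib

open MeasureTheory ProbabilityTheory

noncomputable section

namespace LowRankGD

/-- The operator norm of a real matrix (for the Euclidean norms). -/
def opNorm {a b : ℕ} (M : Matrix (Fin a) (Fin b) ℝ) : ℝ :=
  ‖LinearMap.toContinuousLinearMap (Matrix.toEuclideanLin M)‖

/-- The Frobenius norm of a real matrix. -/
def frobNorm {a b : ℕ} (M : Matrix (Fin a) (Fin b) ℝ) : ℝ :=
  Real.sqrt (∑ i, ∑ j, M i j ^ 2)

/-- The `i`-th largest singular value of a real matrix, counted from `i = 1`. -/
def singVal {a b : ℕ} (i : ℕ) (M : Matrix (Fin a) (Fin b) ℝ) : ℝ :=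
  (Matrix.toEuclideanLin M).singularValues (i - 1)

/-- The Loewner order `M ≼ N`: the matrix `N - M` is (symmetric) positive semidefinite. -/
def Loewner {d : ℕ} (M N : Matrix (Fin d) (Fin d) ℝ) : Prop :=
  (N - M).PosSemidef

/-- The `(d + m') × (d + n')` matrix with upper left block `diag σ` and zeros elsewhere. -/
def rectDiag {d : ℕ} (m' n' : ℕ) (σ : Fin d → ℝ) :
    Matrix (Fin (d + m')) (Fin (d + n')) ℝ :=
  Matrix.reindex finSumFinEquiv finSumFinEquiv
    (Matrix.fromBlocks (Matrix.diagonal σ) 0 0 0)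

/-- `S = Φ Σ' Ψᵀ` is a singular value decomposition of the matrix `S` of rank `d`, with
positive singular values `σ 0 ≥ ⋯ ≥ σ (d - 1)`. -/
structure IsSVD {d m' n' : ℕ} (S : Matrix (Fin (d + m')) (Fin (d + n')) ℝ) (σ : Fin d → ℝ)
    (Φ : Matrix (Fin (d + m')) (Fin (d + m')) ℝ)
    (Ψ : Matrix (Fin (d + n')) (Fin (d + n')) ℝ) : Prop where
  antitone : Antitone σ
  pos : ∀ i, 0 < σ i
  left_mem : Φ ∈ Matrix.orthogonalGroup (Fin (d + m')) ℝ
  right_mem : Ψ ∈ Matrix.orthogonalGroup (Fin (d + n')) ℝ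
  eq : S = Φ * rectDiag m' n' σ * Ψ.transpose

/-- Gradient descent with step size `η` for `(U, V) ↦ ‖U Vᵀ - S‖_F² / 2`, started at
`(U₀, V₀)`. -/
def gd {m n d : ℕ} (S : Matrix (Fin m) (Fin n) ℝ) (η : ℝ)
    (U₀ : Matrix (Fin m) (Fin d) ℝ) (V₀ : Matrix (Fin n) (Fin d) ℝ) :
    ℕ → Matrix (Fin m) (Fin d) ℝ × Matrix (Fin n) (Fin d) ℝ
  | 0 => (U₀, V₀)
  | t + 1 =>
    let U := (gd S η U₀ V₀ t).1
    let V := (gd S η U₀ V₀ t).2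
    (U + η • ((S - U * V.transpose) * V),
     V + η • ((S - U * V.transpose).transpose * U))

/-- The upper `d × d` block. -/
def upper {d k : ℕ} (M : Matrix (Fin (d + k)) (Fin d) ℝ) : Matrix (Fin d) (Fin d) ℝ :=
  M.submatrix (Fin.castAdd k) id

/-- The lower `k × d` block. -/
def lower {d k : ℕ} (M : Matrix (Fin (d + k)) (Fin d) ℝ) : Matrix (Fin k) (Fin d) ℝ :=
  M.submatrix (Fin.natAdd d) id

/-- `A = (U + V) / 2`, where `U`, `V` are the upper blocks of the two factors. -/
def symA {d m' n' : ℕ} (X : Matrix (Fin (d + m')) (Fin d) ℝ)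
    (Y : Matrix (Fin (d + n')) (Fin d) ℝ) : Matrix (Fin d) (Fin d) ℝ :=
  (1 / 2 : ℝ) • (upper X + upper Y)

/-- `B = (U - V) / 2`, where `U`, `V` are the upper blocks of the two factors. -/
def asymB {d m' n' : ℕ} (X : Matrix (Fin (d + m')) (Fin d) ℝ)
    (Y : Matrix (Fin (d + n')) (Fin d) ℝ) : Matrix (Fin d) (Fin d) ℝ :=
  (1 / 2 : ℝ) • (upper X - upper Y)

/-- `P = Σ - A Aᵀ + B Bᵀ` with `Σ = diag σ`. -/
def errP {d m' n' : ℕ} (σ : Fin d → ℝ) (X : Matrix (Fin (d + m')) (Fin d) ℝ)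
    (Y : Matrix (Fin (d + n')) (Fin d) ℝ) : Matrix (Fin d) (Fin d) ℝ :=
  Matrix.diagonal σ - symA X Y * (symA X Y).transpose + asymB X Y * (asymB X Y).transpose

/-- The bounds with constant `c` on an initialization at scale `ε`; here `X` and `Y` are the
two factors in the coordinates of the singular vectors. -/
structure InitBound {d m' n' : ℕ} (c ε : ℝ) (X : Matrix (Fin (d + m')) (Fin d) ℝ)
    (Y : Matrix (Fin (d + n')) (Fin d) ℝ) : Prop where
  le_A : ε / (c * √(d : ℝ)) ≤ singVal d (symA X Y)
  A_le : singVal 1 (symA X Y) ≤ c * √(d : ℝ) * ε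
  B_le : frobNorm (asymB X Y) ≤ c * d * ε
  J_le : opNorm (lower X) ≤ c * ε * √(max (m' : ℝ) d)
  K_le : opNorm (lower Y) ≤ c * ε * √(max (n' : ℝ) d)

/-- The law of a pair of matrices, of sizes `m × d` and `n × d`, all of whose entries are
independent centred Gaussians of variance `ε ^ 2`. -/
def gaussianInit (m n d : ℕ) (ε : ℝ) :
    Measure ((Fin m → Fin d → ℝ) × (Fin n → Fin d → ℝ)) :=
  (Measure.pi fun _ => Measure.pi fun _ => gaussianReal 0 (Real.toNNReal (ε ^ 2))).prod
    (Measure.pi fun _ => Measure.pi fun _ => gaussianReal 0 (Real.toNNReal (ε ^ 2)))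

end LowRankGD

end

/-
Work in the coordinates of the singular vectors and write `D = diag σ`. As long as `B`, `J`, `K`
stay at the scale of the initialization, the iteration is a small perturbation of
`A ↦ A + η (D - A Aᵀ) A`. The blocks `J` and `K` never grow, because a step multiplies them by
`1 - η H` with `0 ≼ η H ≼ 1`. The growth of `B` is governed by the negative part of the residual
`D - A Aᵀ`, which accumulates only the perturbation terms and so stays negligible over the time
horizon. Meanwhile `σ_d(A)` grows by a constant factor `1 + η σd / 4` per step until
`σ_d(A)² ≥ σd / 4`, which takes about `log (d σd / ε²) / (η σd)` steps, and from then on the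
residual contracts by a factor `1 - η σd / 4` per step.

For a Gaussian initialization, the operator norms are bounded by exponential moments and a net of
the sphere. For the least singular value of a square Gaussian matrix, a singular direction is
tested against an independent Gaussian one; rotating the latter to a coordinate axis shows that a
row would have to be close to the span of the others, which the boundedness of the Gaussian density
makes unlikely.
-/

noncomputable section

namespace LowRankGD

open Matrix
open scoped Matrix.Norms.L2Operator MatrixOrder ENNReal

local notation "‖" v "‖₂" => ‖WithLp.toLp 2 v‖

section OperatorNorm

variable {l m n : Type*} [Fintype l] [Fintype m] [Fintype n]

theorem norm_toLp_sq (v : n → ℝ) : ‖v‖₂ ^ 2 = v ⬝ᵥ v := by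
  rw [EuclideanSpace.real_norm_sq_eq]
  simp [dotProduct, sq]

theorem abs_dotProduct_le (v w : n → ℝ) : |v ⬝ᵥ w| ≤ ‖v‖₂ * ‖w‖₂ := by
  have := abs_real_inner_le_norm (WithLp.toLp 2 v) (WithLp.toLp 2 w)
  rw [EuclideanSpace.inner_toLp_toLp] at this
  simpa [dotProduct_comm] using this

variable [DecidableEq n]

theorem norm_mulVec_le (M : Matrix m n ℝ) (v : n → ℝ) : ‖M *ᵥ v‖₂ ≤ ‖M‖ * ‖v‖₂ :=
  l2_opNorm_mulVec M (WithLp.toLp 2 v)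

theorem norm_le_of_norm_mulVec_le {M : Matrix m n ℝ} {r : ℝ} (hr : 0 ≤ r)
    (h : ∀ v, ‖M *ᵥ v‖₂ ≤ r * ‖v‖₂) : ‖M‖ ≤ r :=
  ContinuousLinearMap.opNorm_le_bound _ hr fun x => h x.ofLp

theorem norm_transpose [DecidableEq m] (M : Matrix m n ℝ) : ‖Mᵀ‖ = ‖M‖ := by
  rw [← conjTranspose_eq_transpose_of_trivial, l2_opNorm_conjTranspose]

theorem norm_mul_le_of_norm_le [DecidableEq m] {M : Matrix l m ℝ} {N : Matrix m n ℝ} {r s : ℝ}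
    (hM : ‖M‖ ≤ r) (hN : ‖N‖ ≤ s) : ‖M * N‖ ≤ r * s :=
  (l2_opNorm_mul M N).trans (mul_le_mul hM hN (norm_nonneg _) ((norm_nonneg _).trans hM))

theorem norm_transpose_mul_self (M : Matrix m n ℝ) : ‖Mᵀ * M‖ = ‖M‖ ^ 2 := by
  rw [sq, ← l2_opNorm_conjTranspose_mul_self, conjTranspose_eq_transpose_of_trivial]

theorem norm_mul_transpose_self [DecidableEq m] (M : Matrix m n ℝ) : ‖M * Mᵀ‖ = ‖M‖ ^ 2 := by
  simpa [norm_transpose] using norm_transpose_mul_self Mᵀ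

theorem norm_one_le : ‖(1 : Matrix n n ℝ)‖ ≤ 1 :=
  norm_le_of_norm_mulVec_le zero_le_one fun v => by simp

theorem norm_smul_le_of_norm_le {M : Matrix m n ℝ} {c r : ℝ} (hc : 0 ≤ c) (hM : ‖M‖ ≤ r) :
    ‖c • M‖ ≤ c * r := by
  rw [norm_smul, Real.norm_of_nonneg hc]
  gcongr

end OperatorNorm

section Loewner

variable {m n : Type*}

theorem transpose_eq_of_nonneg {M : Matrix n n ℝ} (hM : 0 ≤ M) : Mᵀ = M := by
  simpa [IsHermitian] using (nonneg_iff_posSemidef.1 hM).isHermitian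

theorem transpose_mul_self_nonneg [Fintype m] [Finite n] (B : Matrix m n ℝ) : 0 ≤ Bᵀ * B := by
  simpa using (posSemidef_conjTranspose_mul_self B).nonneg

theorem mul_transpose_self_nonneg [Fintype m] [Finite n] (B : Matrix n m ℝ) : 0 ≤ B * Bᵀ := by
  simpa using transpose_mul_self_nonneg Bᵀ

variable [Fintype n] {M S : Matrix n n ℝ} {r : ℝ}

theorem nonneg_iff_dotProduct_mulVec : 0 ≤ M ↔ Mᵀ = M ∧ ∀ v, 0 ≤ v ⬝ᵥ (M *ᵥ v) := by
  rw [nonneg_iff_posSemidef, posSemidef_iff_dotProduct_mulVec]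
  simp [IsHermitian]

theorem dotProduct_mulVec_nonneg (hM : 0 ≤ M) (v : n → ℝ) : 0 ≤ v ⬝ᵥ (M *ᵥ v) :=
  (nonneg_iff_dotProduct_mulVec.1 hM).2 v

variable [DecidableEq n]

theorem dotProduct_smul_one_sub_mulVec (M : Matrix n n ℝ) (r : ℝ) (v : n → ℝ) :
    v ⬝ᵥ ((r • (1 : Matrix n n ℝ) - M) *ᵥ v) = r * ‖v‖₂ ^ 2 - v ⬝ᵥ (M *ᵥ v) := by
  rw [sub_mulVec, dotProduct_sub, smul_mulVec, one_mulVec, dotProduct_smul, norm_toLp_sq,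
    smul_eq_mul]

theorem abs_dotProduct_mulVec_le (M : Matrix n n ℝ) (v : n → ℝ) :
    |v ⬝ᵥ (M *ᵥ v)| ≤ ‖M‖ * ‖v‖₂ ^ 2 := by
  calc |v ⬝ᵥ (M *ᵥ v)| ≤ ‖v‖₂ * ‖M *ᵥ v‖₂ := abs_dotProduct_le _ _
    _ ≤ ‖v‖₂ * (‖M‖ * ‖v‖₂) := by gcongr; exact norm_mulVec_le M v
    _ = _ := by ring

theorem le_smul_one_of_norm_le (hs : Mᵀ = M) (h : ‖M‖ ≤ r) : M ≤ r • 1 := by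
  rw [← sub_nonneg, nonneg_iff_dotProduct_mulVec]
  refine ⟨by simp [hs], fun v => ?_⟩
  rw [dotProduct_smul_one_sub_mulVec]
  have h1 := (abs_le.1 (abs_dotProduct_mulVec_le M v)).2
  have h2 : ‖M‖ * ‖v‖₂ ^ 2 ≤ r * ‖v‖₂ ^ 2 := by gcongr
  linarith

theorem norm_le_of_neg_le_of_le (hr : 0 ≤ r) (h1 : -(r • 1) ≤ M) (h2 : M ≤ r • 1) :
    ‖M‖ ≤ r := by
  have hs : Mᵀ = M := by simpa using transpose_eq_of_nonneg (sub_nonneg.2 h2)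
  have hsym : ((toEuclideanCLM (n := n) (𝕜 := ℝ) M : EuclideanSpace ℝ n →L[ℝ] EuclideanSpace ℝ n) :
      EuclideanSpace ℝ n →ₗ[ℝ] EuclideanSpace ℝ n).IsSymmetric := by
    rw [coe_toEuclideanCLM_eq_toEuclideanLin]
    exact isSymmetric_toEuclideanLin_iff.2 (by simpa [IsHermitian] using hs)
  rw [← l2_opNorm_toEuclideanCLM, ContinuousLinearMap.norm_eq_iSup_rayleighQuotient _ hsym]
  refine ciSup_le fun x => ?_
  have q1 := dotProduct_mulVec_nonneg (sub_nonneg.2 (neg_le.1 h1)) x.ofLp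
  have q2 := dotProduct_mulVec_nonneg (sub_nonneg.2 h2) x.ofLp
  rw [dotProduct_smul_one_sub_mulVec, WithLp.toLp_ofLp] at q1 q2
  rw [neg_mulVec, dotProduct_neg] at q1
  rw [ContinuousLinearMap.rayleighQuotient, abs_div, abs_sq]
  refine div_le_of_le_mul₀ (sq_nonneg _) hr (abs_le.2 ?_)
  rw [ContinuousLinearMap.reApplyInnerSelf_apply, real_inner_comm, RCLike.re_to_real,
    inner_toEuclideanCLM]
  constructor <;> linarith

theorem mul_self_le_smul (hr : 0 < r) (h0 : 0 ≤ M) (h1 : M ≤ r • 1) : M * M ≤ r • M := by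
  have hM := IsSelfAdjoint.of_nonneg h0
  have hrM : IsSelfAdjoint (r • 1 - M) := IsSelfAdjoint.of_nonneg (sub_nonneg.2 h1)
  have key := add_nonneg (hM.conjugate_nonneg (sub_nonneg.2 h1)) (hrM.conjugate_nonneg h0)
  rw [← sub_nonneg]
  convert smul_nonneg (inv_nonneg.2 hr.le) key using 1
  rw [eq_inv_smul_iff₀ hr.ne']
  simp only [mul_sub, sub_mul, mul_smul_comm, smul_mul_assoc, mul_one, one_mul, smul_sub,
    smul_smul]
  abel_nf

theorem norm_one_sub_smul_le {η y : ℝ} (hη : 0 ≤ η) (hy : η * y ≤ 1) (hS : y • 1 ≤ S)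
    (hS1 : η • S ≤ 1) : ‖1 - η • S‖ ≤ 1 - η * y := by
  have h0 : 0 ≤ 1 - η * y := sub_nonneg.2 hy
  refine norm_le_of_neg_le_of_le h0 ?_ ?_
  · exact (neg_nonpos.2 (smul_nonneg h0 zero_le_one)).trans (sub_nonneg.2 hS1)
  · rw [sub_smul, one_smul, mul_smul]
    gcongr

end Loewner

section BoundedBelow

variable {l m n : Type*} [Fintype l] [Fintype m] [Fintype n]

/-- The inequality `s ‖v‖ ≤ ‖M v‖` for all vectors `v`; for `s > 0` and tall `M` it says that the
least singular value of `M` is at least `s`. -/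
def BoundedBelow (s : ℝ) (M : Matrix m n ℝ) : Prop := ∀ v, s * ‖v‖₂ ≤ ‖M *ᵥ v‖₂

theorem BoundedBelow.mul {s r : ℝ} {M : Matrix l m ℝ} {N : Matrix m n ℝ} (hs : 0 ≤ s)
    (hM : BoundedBelow s M) (hN : BoundedBelow r N) : BoundedBelow (s * r) (M * N) := by
  intro v
  rw [← mulVec_mulVec, mul_assoc]
  exact (mul_le_mul_of_nonneg_left (hN v) hs).trans (hM _)

theorem BoundedBelow.mono {s r : ℝ} {M : Matrix m n ℝ} (hM : BoundedBelow s M) (h : r ≤ s) :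
    BoundedBelow r M :=
  fun v => (mul_le_mul_of_nonneg_right h (norm_nonneg _)).trans (hM v)

theorem BoundedBelow.smul {s c : ℝ} {M : Matrix m n ℝ} (hc : 0 ≤ c) (hM : BoundedBelow s M) :
    BoundedBelow (c * s) (c • M) := by
  intro v
  rw [smul_mulVec, WithLp.toLp_smul, norm_smul, Real.norm_of_nonneg hc, mul_assoc]
  exact mul_le_mul_of_nonneg_left (hM v) hc

theorem BoundedBelow.add_of_norm_le [DecidableEq n] {s e : ℝ} {M E : Matrix m n ℝ}
    (hM : BoundedBelow s M) (hE : ‖E‖ ≤ e) : BoundedBelow (s - e) (M + E) := by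
  intro v
  have h1 : ‖E *ᵥ v‖₂ ≤ e * ‖v‖₂ := (norm_mulVec_le E v).trans (by gcongr)
  have h2 := norm_sub_le_norm_add (WithLp.toLp 2 (M *ᵥ v)) (WithLp.toLp 2 (E *ᵥ v))
  rw [add_mulVec, WithLp.toLp_add]
  linarith [hM v]

theorem BoundedBelow.transpose {s : ℝ} {A : Matrix n n ℝ} (h : BoundedBelow s A) :
    BoundedBelow s Aᵀ := by
  classical
  intro v
  rcases le_or_gt s 0 with hs | hs
  · exact (mul_nonpos_of_nonpos_of_nonneg hs (norm_nonneg _)).trans (norm_nonneg _)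
  have hinj : Function.Injective A.mulVecLin := by
    rw [← LinearMap.ker_eq_bot, LinearMap.ker_eq_bot']
    intro x hx
    have hx0 := h x
    rw [show A *ᵥ x = 0 from hx, WithLp.toLp_zero, norm_zero] at hx0
    simpa using le_antisymm (nonpos_of_mul_nonpos_right hx0 hs) (norm_nonneg (WithLp.toLp 2 x))
  obtain ⟨w, hw : A *ᵥ w = v⟩ := LinearMap.surjective_of_injective hinj v
  have hvw : ‖v‖₂ ^ 2 ≤ ‖Aᵀ *ᵥ v‖₂ * ‖w‖₂ := by
    rw [norm_toLp_sq]
    nth_rewrite 2 [← hw]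
    rw [dotProduct_mulVec, ← mulVec_transpose]
    exact (le_abs_self _).trans (abs_dotProduct_le _ _)
  have hsw : s * ‖w‖₂ ≤ ‖v‖₂ := hw ▸ h w
  rcases (norm_nonneg (WithLp.toLp 2 v)).eq_or_lt with h0 | h0
  · rw [← h0, mul_zero]
    exact norm_nonneg _
  refine le_of_mul_le_mul_right ?_ h0
  calc s * ‖v‖₂ * ‖v‖₂ = s * ‖v‖₂ ^ 2 := by ring
    _ ≤ s * (‖Aᵀ *ᵥ v‖₂ * ‖w‖₂) := by gcongr
    _ = ‖Aᵀ *ᵥ v‖₂ * (s * ‖w‖₂) := by ring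
    _ ≤ _ := by gcongr

variable [DecidableEq n] {s : ℝ}

theorem boundedBelow_iff_le {M : Matrix m n ℝ} (hs : 0 ≤ s) :
    BoundedBelow s M ↔ s ^ 2 • 1 ≤ Mᵀ * M := by
  have quadratic_form : ∀ v, v ⬝ᵥ ((Mᵀ * M - s ^ 2 • (1 : Matrix n n ℝ)) *ᵥ v) =
      ‖M *ᵥ v‖₂ ^ 2 - (s * ‖v‖₂) ^ 2 := fun v => by
    rw [mul_pow, norm_toLp_sq, norm_toLp_sq, sub_mulVec, dotProduct_sub, smul_mulVec, one_mulVec,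
      dotProduct_smul, ← mulVec_mulVec, mulVec_transpose, dotProduct_comm v, ← dotProduct_mulVec,
      smul_eq_mul]
  rw [← sub_nonneg, nonneg_iff_dotProduct_mulVec, and_iff_right (by simp)]
  refine forall_congr' fun v => ?_
  rw [quadratic_form, sub_nonneg, sq_le_sq₀ (by positivity) (by positivity)]

theorem boundedBelow_of_smul_one_le {M : Matrix n n ℝ} (h : s • 1 ≤ M) : BoundedBelow s M := by
  intro v
  have h1 : s * ‖v‖₂ ^ 2 ≤ v ⬝ᵥ (M *ᵥ v) := by
    have h1 := dotProduct_mulVec_nonneg (sub_nonneg.2 h) v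
    rw [sub_mulVec, dotProduct_sub, smul_mulVec, one_mulVec, dotProduct_smul, ← norm_toLp_sq,
      smul_eq_mul] at h1
    linarith
  have h2 := (le_abs_self _).trans (abs_dotProduct_le v (M *ᵥ v))
  rcases (norm_nonneg (WithLp.toLp 2 v)).eq_or_lt with h0 | h0
  · rw [← h0, mul_zero]
    exact norm_nonneg _
  · refine le_of_mul_le_mul_left ?_ h0
    linarith

end BoundedBelow

section SingularValues

open Module

variable {𝕜 E F : Type*} [RCLike 𝕜] [NormedAddCommGroup E] [InnerProductSpace 𝕜 E]
  [FiniteDimensional 𝕜 E] [NormedAddCommGroup F] [InnerProductSpace 𝕜 F] [FiniteDimensional 𝕜 F]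

theorem exists_orthonormalBasis_norm_sq_eq_sum (T : E →ₗ[𝕜] F) :
    ∃ b : OrthonormalBasis (Fin (finrank 𝕜 E)) 𝕜 E,
      ∀ v, ‖T v‖ ^ 2 = ∑ i : Fin (finrank 𝕜 E), T.singularValues i ^ 2 * ‖b.repr v i‖ ^ 2 := by
  have hT := T.isSymmetric_adjoint_comp_self
  refine ⟨hT.eigenvectorBasis rfl, fun v => ?_⟩
  set b := hT.eigenvectorBasis rfl
  have hsq : ((‖T v‖ ^ 2 : ℝ) : 𝕜) = inner 𝕜 ((LinearMap.adjoint T ∘ₗ T) v) v := by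
    rw [LinearMap.comp_apply, LinearMap.adjoint_inner_left, inner_self_eq_norm_sq_to_K]
    norm_cast
  apply RCLike.ofReal_injective (K := 𝕜)
  rw [hsq, ← b.repr.inner_map_map, PiLp.inner_apply, RCLike.ofReal_sum]
  refine Finset.sum_congr rfl fun i _ => ?_
  rw [hT.eigenvectorBasis_apply_self_apply rfl, T.sq_singularValues_fin rfl, ← smul_eq_mul,
    inner_smul_left, RCLike.conj_ofReal, inner_self_eq_norm_sq_to_K]
  push_cast
  rfl

theorem exists_orthonormalBasis_norm_apply_eq (T : E →ₗ[𝕜] F) :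
    ∃ b : OrthonormalBasis (Fin (finrank 𝕜 E)) 𝕜 E,
      (∀ v, ‖T v‖ ^ 2 = ∑ i : Fin (finrank 𝕜 E), T.singularValues i ^ 2 * ‖b.repr v i‖ ^ 2) ∧
      ∀ i, ‖T (b i)‖ = T.singularValues i := by
  obtain ⟨b, hb⟩ := exists_orthonormalBasis_norm_sq_eq_sum T
  refine ⟨b, hb, fun i => ?_⟩
  have h := hb (b i)
  rw [Finset.sum_eq_single i (fun j _ hj => by simp [b.repr_self, hj]) (by simp)] at h
  simp only [b.repr_self, PiLp.single_apply, if_true, norm_one, one_pow, mul_one] at h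
  exact (pow_left_inj₀ (norm_nonneg _) (T.singularValues_nonneg _) two_ne_zero).1 h

theorem norm_toContinuousLinearMap_eq_singularValues_zero (T : E →ₗ[𝕜] F) :
    ‖T.toContinuousLinearMap‖ = T.singularValues 0 := by
  obtain ⟨b, hb, hbi⟩ := exists_orthonormalBasis_norm_apply_eq T
  refine le_antisymm (ContinuousLinearMap.opNorm_le_bound _ (T.singularValues_nonneg _)
    fun v => ?_) ?_
  · rw [LinearMap.coe_toContinuousLinearMap', ← sq_le_sq₀ (norm_nonneg _)
      (mul_nonneg (T.singularValues_nonneg _) (norm_nonneg _)), hb, mul_pow,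
      ← b.repr.norm_map, EuclideanSpace.norm_sq_eq, Finset.mul_sum]
    gcongr with i
    exacts [T.singularValues_nonneg _, T.singularValues_antitone (Nat.zero_le _)]
  · rcases (finrank 𝕜 E).eq_zero_or_pos with h | h
    · rw [T.singularValues_of_finrank_le h.le]
      exact norm_nonneg _
    · have := T.toContinuousLinearMap.le_opNorm (b ⟨0, h⟩)
      rwa [LinearMap.coe_toContinuousLinearMap', hbi, b.norm_eq_one, mul_one] at this

theorem le_singularValues_last_iff (T : E →ₗ[𝕜] F) (h0 : 0 < finrank 𝕜 E) {s : ℝ} :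
    s ≤ T.singularValues (finrank 𝕜 E - 1) ↔ ∀ v, s * ‖v‖ ≤ ‖T v‖ := by
  obtain ⟨b, hb, hbi⟩ := exists_orthonormalBasis_norm_apply_eq T
  refine ⟨fun h v => (mul_le_mul_of_nonneg_right h (norm_nonneg v)).trans ?_, fun h => ?_⟩
  · rw [← sq_le_sq₀ (mul_nonneg (T.singularValues_nonneg _) (norm_nonneg _)) (norm_nonneg _), hb,
      mul_pow, ← b.repr.norm_map, EuclideanSpace.norm_sq_eq, Finset.mul_sum]
    gcongr with i
    exacts [T.singularValues_nonneg _, T.singularValues_antitone (Nat.le_sub_one_of_lt i.isLt)]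
  · simpa [hbi] using h (b ⟨_, Nat.sub_lt h0 one_pos⟩)

variable {a b d : ℕ}

theorem singVal_one_eq_norm (M : Matrix (Fin a) (Fin b) ℝ) : singVal 1 M = ‖M‖ :=
  (norm_toContinuousLinearMap_eq_singularValues_zero (toEuclideanLin M)).symm

theorem singVal_le_norm (i : ℕ) (M : Matrix (Fin a) (Fin b) ℝ) : singVal i M ≤ ‖M‖ := by
  rw [← singVal_one_eq_norm]
  exact (toEuclideanLin M).singularValues_antitone (Nat.zero_le _)

theorem le_singVal_iff (hd : 0 < d) {M : Matrix (Fin a) (Fin d) ℝ} {s : ℝ} :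
    s ≤ singVal d M ↔ BoundedBelow s M := by
  have h := le_singularValues_last_iff (toEuclideanLin M) (s := s) (by simpa using hd)
  rw [finrank_euclideanSpace_fin] at h
  exact h.trans ⟨fun h v => h (WithLp.toLp 2 v), fun h v => h v.ofLp⟩

end SingularValues

section Frobenius

variable {m n : Type*} [Fintype m] [Fintype n] {a b c : ℕ}

/-- The Frobenius inner product `∑ i j, M i j * N i j` of two real matrices. -/
def frobInner (M N : Matrix m n ℝ) : ℝ := (Mᵀ * N).trace

theorem frobInner_eq_sum (M N : Matrix m n ℝ) : frobInner M N = ∑ i, ∑ j, M i j * N i j := by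
  simp only [frobInner, trace, diag_apply, mul_apply, transpose_apply]
  exact Finset.sum_comm

theorem frobInner_conj_nonneg {P : Matrix m m ℝ} (hP : 0 ≤ P) (B : Matrix m n ℝ) :
    0 ≤ frobInner B (P * B) := by
  have := ((nonneg_iff_posSemidef.1 hP).conjTranspose_mul_mul_same B).trace_nonneg
  rwa [conjTranspose_eq_transpose_of_trivial, Matrix.mul_assoc] at this

theorem frobNorm_nonneg (M : Matrix (Fin a) (Fin b) ℝ) : 0 ≤ frobNorm M := Real.sqrt_nonneg _

theorem frobNorm_sq (M : Matrix (Fin a) (Fin b) ℝ) : frobNorm M ^ 2 = frobInner M M := by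
  rw [frobNorm, Real.sq_sqrt (by positivity), frobInner_eq_sum]
  simp only [sq]

theorem frobNorm_eq_norm (M : Matrix (Fin a) (Fin b) ℝ) :
    frobNorm M = ‖fun p : Fin a × Fin b => M p.1 p.2‖₂ := by
  rw [EuclideanSpace.norm_eq, frobNorm, Fintype.sum_prod_type]
  simp

theorem frobNorm_add_le (M N : Matrix (Fin a) (Fin b) ℝ) :
    frobNorm (M + N) ≤ frobNorm M + frobNorm N := by
  simp only [frobNorm_eq_norm]
  exact norm_add_le (WithLp.toLp 2 fun p : Fin a × Fin b => M p.1 p.2)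
    (WithLp.toLp 2 fun p : Fin a × Fin b => N p.1 p.2)

theorem frobNorm_smul (r : ℝ) (M : Matrix (Fin a) (Fin b) ℝ) :
    frobNorm (r • M) = |r| * frobNorm M := by
  simp only [frobNorm_eq_norm]
  exact norm_smul r (WithLp.toLp 2 fun p : Fin a × Fin b => M p.1 p.2)

theorem frobNorm_neg (M : Matrix (Fin a) (Fin b) ℝ) : frobNorm (-M) = frobNorm M := by
  simp [frobNorm]

theorem frobNorm_transpose (M : Matrix (Fin a) (Fin b) ℝ) : frobNorm Mᵀ = frobNorm M := by
  rw [frobNorm, frobNorm, Finset.sum_comm]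
  simp

theorem frobNorm_sq_eq_sum_rows (M : Matrix (Fin a) (Fin b) ℝ) :
    frobNorm M ^ 2 = ∑ i, ‖M i‖₂ ^ 2 := by
  rw [frobNorm_sq, frobInner_eq_sum]
  simp only [norm_toLp_sq, dotProduct]

theorem frobNorm_mul_le (M : Matrix (Fin a) (Fin b) ℝ) (N : Matrix (Fin b) (Fin c) ℝ) :
    frobNorm (M * N) ≤ frobNorm M * ‖N‖ := by
  have row_le : ∀ i, ‖(M * N) i‖₂ ≤ ‖M i‖₂ * ‖N‖ := fun i => by
    have h := norm_mulVec_le Nᵀ (M i)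
    rwa [mulVec_transpose, norm_transpose, mul_comm] at h
  rw [← sq_le_sq₀ (frobNorm_nonneg _) (mul_nonneg (frobNorm_nonneg _) (norm_nonneg _)), mul_pow,
    frobNorm_sq_eq_sum_rows, frobNorm_sq_eq_sum_rows, Finset.sum_mul]
  gcongr with i
  rw [← mul_pow]
  gcongr
  exact row_le i

theorem frobNorm_mul_le' (M : Matrix (Fin a) (Fin b) ℝ) (N : Matrix (Fin b) (Fin c) ℝ) :
    frobNorm (M * N) ≤ ‖M‖ * frobNorm N := by
  rw [← frobNorm_transpose, transpose_mul, mul_comm, ← frobNorm_transpose N, ← norm_transpose M]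
  exact frobNorm_mul_le _ _

theorem norm_le_frobNorm (M : Matrix (Fin a) (Fin b) ℝ) : ‖M‖ ≤ frobNorm M := by
  refine norm_le_of_norm_mulVec_le (frobNorm_nonneg _) fun v => ?_
  rw [← sq_le_sq₀ (norm_nonneg _) (mul_nonneg (frobNorm_nonneg _) (norm_nonneg _)), mul_pow,
    frobNorm_sq_eq_sum_rows, Finset.sum_mul, norm_toLp_sq, dotProduct]
  refine Finset.sum_le_sum fun i _ => ?_
  rw [← mul_pow, ← sq, ← sq_abs]
  gcongr
  exact abs_dotProduct_le (M i) v

theorem frobNorm_le_sqrt_mul_norm (M : Matrix (Fin a) (Fin b) ℝ) :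
    frobNorm M ≤ √b * ‖M‖ := by
  have frobNorm_one : frobNorm (1 : Matrix (Fin b) (Fin b) ℝ) = √b := by
    simp [frobNorm, one_apply]
  simpa [frobNorm_one, mul_comm] using frobNorm_mul_le' M (1 : Matrix (Fin b) (Fin b) ℝ)

theorem frobNorm_add_smul_sq (M N : Matrix (Fin a) (Fin b) ℝ) (r : ℝ) :
    frobNorm (M + r • N) ^ 2 =
      frobNorm M ^ 2 + 2 * r * frobInner M N + r ^ 2 * frobNorm N ^ 2 := by
  simp only [frobNorm_sq, frobInner_eq_sum, Matrix.add_apply, Matrix.smul_apply, smul_eq_mul,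
    Finset.mul_sum, ← Finset.sum_add_distrib]
  refine Finset.sum_congr rfl fun i _ => Finset.sum_congr rfl fun j _ => ?_
  ring

end Frobenius

section Step

variable {m n : Type*} [Fintype m] [Fintype n]

/-- The skew-symmetric matrix `A Bᵀ - B Aᵀ`, which is minus the skew-symmetric part of the product
`(A + B)(A - B)ᵀ` of the two factors and measures their imbalance. -/
def skewQ (A B : Matrix m n ℝ) : Matrix m m ℝ := A * Bᵀ - B * Aᵀ

/-- The perturbation of the symmetric dynamics `A ↦ (1 + η (Σ - A Aᵀ)) A` by the antisymmetric part
`B` and by the Gram matrices `F = JᵀJ` and `G = KᵀK` of the lower blocks. -/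
def pertA (A B : Matrix m n ℝ) (F G : Matrix n n ℝ) : Matrix m n ℝ :=
  B * Bᵀ * A - skewQ A B * B - (1 / 2 : ℝ) • (A * (G + F) + B * (G - F))

/-- The velocity of `B` when the lower blocks vanish and the diagonal of singular values is `D`. -/
def driftB (D : Matrix m m ℝ) (A B : Matrix m n ℝ) : Matrix m n ℝ :=
  skewQ A B * A - (D - A * Aᵀ + B * Bᵀ) * B

theorem asymB_step (D : Matrix m m ℝ) (A B : Matrix m n ℝ) (F G : Matrix n n ℝ) (η : ℝ) :
    (1 / 2 : ℝ) • ((A + B + η • (D * (A - B) - (A + B) * ((A - B)ᵀ * (A - B) + G))) -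
      (A - B + η • (D * (A + B) - (A - B) * ((A + B)ᵀ * (A + B) + F)))) =
      (B + η • driftB D A B) + (-(η / 2)) • (A * (G - F) + B * (G + F)) := by
  simp only [driftB, skewQ, transpose_add, transpose_sub, Matrix.mul_add, Matrix.add_mul,
    Matrix.mul_sub, Matrix.sub_mul, Matrix.mul_assoc]
  module

section Identities

variable [DecidableEq m]

/-- The terms by which the residual `R = Σ - A Aᵀ` after a step `A ↦ (1 + η R) A + η E` differs from
`(1 - η A Aᵀ) R (1 - η A Aᵀ)`. -/
def pertR (R : Matrix m m ℝ) (A E : Matrix m n ℝ) (η : ℝ) : Matrix m m ℝ :=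
  η ^ 2 • (A * Aᵀ * R * (A * Aᵀ) + R * (A * Aᵀ) * R) +
    (η • ((1 + η • R) * A * Eᵀ) + η • (E * Aᵀ * (1 + η • R)) + η ^ 2 • (E * Eᵀ))

theorem symA_step (D : Matrix m m ℝ) (A B : Matrix m n ℝ) (F G : Matrix n n ℝ) (η : ℝ) :
    (1 / 2 : ℝ) • ((A + B + η • (D * (A - B) - (A + B) * ((A - B)ᵀ * (A - B) + G))) +
      (A - B + η • (D * (A + B) - (A - B) * ((A + B)ᵀ * (A + B) + F)))) =
      (1 + η • (D - A * Aᵀ)) * A + η • pertA A B F G := by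
  simp only [pertA, skewQ, transpose_add, transpose_sub, Matrix.mul_add, Matrix.add_mul,
    Matrix.mul_sub, Matrix.sub_mul, Matrix.smul_mul, Matrix.one_mul, Matrix.mul_assoc]
  module

theorem residual_step {D R : Matrix m m ℝ} {A : Matrix m n ℝ} (E : Matrix m n ℝ) (η : ℝ)
    (hD : Dᵀ = D) (hR : R = D - A * Aᵀ) :
    D - ((1 + η • R) * A + η • E) * ((1 + η • R) * A + η • E)ᵀ =
      (1 - η • (A * Aᵀ)) * R * (1 - η • (A * Aᵀ)) - pertR R A E η := by
  have hRt : Rᵀ = R := by rw [hR]; simp [hD]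
  obtain rfl : D = R + A * Aᵀ := by rw [hR]; abel
  clear hR hD
  simp only [pertR, transpose_add, transpose_mul, transpose_smul, hRt, Matrix.mul_add,
    Matrix.add_mul, Matrix.mul_sub, Matrix.sub_mul, Matrix.smul_mul, Matrix.mul_smul,
    Matrix.one_mul, Matrix.mul_one, Matrix.mul_assoc]
  module

theorem pertR_transpose {R : Matrix m m ℝ} (A E : Matrix m n ℝ) (η : ℝ) (hR : Rᵀ = R) :
    (pertR R A E η)ᵀ = pertR R A E η := by
  simp only [pertR, transpose_add, transpose_mul, transpose_smul, transpose_one, hR,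
    transpose_transpose, Matrix.mul_assoc]
  abel

end Identities

section NormBounds

variable [DecidableEq n]

theorem norm_skewQ_le [DecidableEq m] {A B : Matrix m n ℝ} {α β : ℝ} (hA : ‖A‖ ≤ α) (hB : ‖B‖ ≤ β) :
    ‖skewQ A B‖ ≤ 2 * α * β := by
  have hAB := norm_mul_le_of_norm_le hA ((norm_transpose B).trans_le hB)
  have hBA := norm_mul_le_of_norm_le hB ((norm_transpose A).trans_le hA)
  exact (norm_sub_le_of_le hAB hBA).trans_eq (by ring)

theorem norm_pertA_le {A B : Matrix m n ℝ} {F G : Matrix n n ℝ} {α β ω : ℝ} (hA : ‖A‖ ≤ α)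
    (hB : ‖B‖ ≤ β) (hβ : β ≤ α) (hFG : ‖F‖ + ‖G‖ ≤ ω) :
    ‖pertA A B F G‖ ≤ α * (3 * β ^ 2 + ω) := by
  classical
  have hω : 0 ≤ ω := le_trans (by positivity) hFG
  have hGF : ‖G‖ + ‖F‖ ≤ ω := (add_comm _ _).trans_le hFG
  have cubic : ‖B * Bᵀ * A - skewQ A B * B‖ ≤ β * β * α + 2 * α * β * β :=
    norm_sub_le_of_le
      (norm_mul_le_of_norm_le (norm_mul_le_of_norm_le hB ((norm_transpose B).trans_le hB)) hA)
      (norm_mul_le_of_norm_le (norm_skewQ_le hA hB) hB)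
  have lower_blocks : ‖(1 / 2 : ℝ) • (A * (G + F) + B * (G - F))‖ ≤ 1 / 2 * (α * ω + β * ω) :=
    norm_smul_le_of_norm_le (by norm_num) <| norm_add_le_of_le
      (norm_mul_le_of_norm_le hA ((norm_add_le G F).trans hGF))
      (norm_mul_le_of_norm_le hB ((norm_sub_le G F).trans hGF))
  refine (norm_sub_le_of_le cubic lower_blocks).trans ?_
  nlinarith

theorem norm_pertR_le [DecidableEq m] {R : Matrix m m ℝ} {A E : Matrix m n ℝ} {η α r e : ℝ}
    (hη : 0 ≤ η) (hA : ‖A‖ ≤ α) (hR : ‖R‖ ≤ r) (hE : ‖E‖ ≤ e) :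
    ‖pertR R A E η‖ ≤
      η * (η * (α ^ 4 * r + α ^ 2 * r ^ 2) + 2 * (1 + η * r) * α * e + η * e ^ 2) := by
  have hAt := (norm_transpose A).trans_le hA
  have hEt := (norm_transpose E).trans_le hE
  have hS := norm_mul_le_of_norm_le hA hAt
  have hηR : ‖1 + η • R‖ ≤ 1 + η * r :=
    norm_add_le_of_le norm_one_le (norm_smul_le_of_norm_le hη hR)
  have quadratic := norm_smul_le_of_norm_le (sq_nonneg η) <| norm_add_le_of_le
    (norm_mul_le_of_norm_le (norm_mul_le_of_norm_le hS hR) hS)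
    (norm_mul_le_of_norm_le (norm_mul_le_of_norm_le hR hS) hR)
  have linear := norm_smul_le_of_norm_le hη
    (norm_mul_le_of_norm_le (norm_mul_le_of_norm_le hηR hA) hEt)
  have linear' := norm_smul_le_of_norm_le hη
    (norm_mul_le_of_norm_le (norm_mul_le_of_norm_le hE hAt) hηR)
  have square := norm_smul_le_of_norm_le (sq_nonneg η) (norm_mul_le_of_norm_le hE hEt)
  refine (norm_add_le_of_le quadratic
    (norm_add_le_of_le (norm_add_le_of_le linear linear') square)).trans_eq ?_
  ring

end NormBounds

section Residual

variable [DecidableEq n]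

theorem residual_lower_step {S R N : Matrix n n ℝ} {η r l : ℝ} (hl : 0 ≤ l) (hη : 0 ≤ η)
    (hS : 0 ≤ S) (hS1 : η • S ≤ 1) (hR : -(l • 1) ≤ R) (hN : Nᵀ = N) (hNr : ‖N‖ ≤ r) :
    -((l + r) • 1) ≤ (1 - η • S) * R * (1 - η • S) - N := by
  have hT : 0 ≤ η • S := smul_nonneg hη hS
  have hconj : 0 ≤ (1 - η • S) * (R + l • 1) * (1 - η • S) :=
    (IsSelfAdjoint.of_nonneg (sub_nonneg.2 hS1)).conjugate_nonneg (neg_le_iff_add_nonneg.1 hR)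
  have hcontr : 0 ≤ l • (η • S + (η • S - η • S * (η • S))) := by
    have := mul_self_le_smul one_pos hT (by simpa using hS1)
    rw [one_smul] at this
    exact smul_nonneg hl (add_nonneg hT (sub_nonneg.2 this))
  rw [neg_le_iff_add_nonneg]
  convert add_nonneg (add_nonneg hconj hcontr)
    (sub_nonneg.2 (le_smul_one_of_norm_le hN hNr)) using 1
  simp only [mul_add, add_mul, mul_sub, sub_mul, smul_mul_assoc, mul_smul_comm, one_mul, mul_one]
  module

theorem residual_norm_step {S R N : Matrix n n ℝ} {η y x r : ℝ} (hη : 0 ≤ η)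
    (hy0 : 0 ≤ y) (hy : η * y ≤ 1) (hS : y • 1 ≤ S) (hS1 : η • S ≤ 1) (hR : ‖R‖ ≤ x)
    (hN : ‖N‖ ≤ r) : ‖(1 - η • S) * R * (1 - η • S) - N‖ ≤ (1 - η * y) * x + r := by
  have hc := norm_one_sub_smul_le hη hy hS hS1
  have hx : 0 ≤ x := (norm_nonneg _).trans hR
  refine norm_sub_le_of_le ?_ hN
  calc ‖(1 - η • S) * R * (1 - η • S)‖ ≤ (1 - η * y) * x * (1 - η * y) :=
        norm_mul_le_of_norm_le (norm_mul_le_of_norm_le hc hR) hc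
    _ ≤ (1 - η * y) * x :=
        mul_le_of_le_one_right (mul_nonneg (by linarith) hx) (by linarith [mul_nonneg hη hy0])

end Residual

section Growth

variable [DecidableEq m]

theorem smul_one_le_conj_one_sub_smul {S : Matrix m m ℝ} {η s : ℝ} (hη : 0 ≤ η)
    (hs : 8 * η * s ^ 2 ≤ 1) (hS : s ^ 2 • 1 ≤ S) (hS1 : η • S ≤ (1 / 8 : ℝ) • 1) :
    (s ^ 2 * (1 - 2 * η * s ^ 2)) • 1 ≤ (1 - η • S) * S * (1 - η • S) := by
  have hS0 : 0 ≤ S := (smul_nonneg (sq_nonneg s) zero_le_one).trans hS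
  obtain ⟨M, rfl⟩ : ∃ M, S = M + s ^ 2 • 1 := ⟨_, (sub_add_cancel S _).symm⟩
  have hM : 0 ≤ M := by simpa using hS
  have hηM : η • M ≤ (1 / 8 : ℝ) • 1 := by
    refine le_trans ?_ hS1
    gcongr
    exact le_add_of_nonneg_right (smul_nonneg (sq_nonneg s) zero_le_one)
  have square_le : η • (M * M) ≤ (1 / 8 : ℝ) • M := by
    rcases hη.eq_or_lt with rfl | h0
    · simpa using smul_nonneg (by norm_num : (0 : ℝ) ≤ 8⁻¹) hM
    · have h := mul_self_le_smul (by norm_num : (0 : ℝ) < 1 / 8) (smul_nonneg hη hM) hηM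
      rw [smul_mul_smul_comm, mul_smul, smul_comm (1 / 8 : ℝ) η] at h
      exact le_of_smul_le_smul_left (by simpa [mul_smul] using h) h0
  have cube : 0 ≤ (M + s ^ 2 • 1) * (M + s ^ 2 • 1) * (M + s ^ 2 • 1) :=
    (IsSelfAdjoint.of_nonneg hS0).conjugate_nonneg hS0
  rw [← sub_nonneg]
  have linear : 0 ≤ (3 / 4 - 4 * η * s ^ 2) • M := smul_nonneg (by linarith) hM
  have quadratic : 0 ≤ (2 : ℝ) • ((1 / 8 : ℝ) • M - η • (M * M)) :=
    smul_nonneg zero_le_two (sub_nonneg.2 square_le)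
  convert add_nonneg (add_nonneg linear quadratic) (smul_nonneg (sq_nonneg η) cube) using 1
  simp only [mul_add, add_mul, mul_sub, sub_mul, smul_mul_assoc, mul_smul_comm, one_mul, mul_one]
  module

theorem BoundedBelow.one_sub_smul_mul {A : Matrix m n ℝ} {η s : ℝ} (hη : 0 ≤ η) (hs : 0 ≤ s)
    (hA : BoundedBelow s Aᵀ) (hs1 : 8 * η * s ^ 2 ≤ 1)
    (hS : η • (A * Aᵀ) ≤ (1 / 8 : ℝ) • 1) :
    BoundedBelow ((1 - 2 * η * s ^ 2) * s) ((1 - η • (A * Aᵀ)) * A)ᵀ := by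
  have h2 : 0 ≤ 1 - 2 * η * s ^ 2 := by linarith
  rw [boundedBelow_iff_le hs] at hA
  rw [transpose_transpose] at hA
  rw [boundedBelow_iff_le (by positivity)]
  calc ((1 - 2 * η * s ^ 2) * s) ^ 2 • (1 : Matrix m m ℝ)
      ≤ (s ^ 2 * (1 - 2 * η * s ^ 2)) • 1 := by
        refine smul_le_smul_of_nonneg_right ?_ zero_le_one
        rw [mul_pow, mul_comm]
        have : 0 ≤ η * s ^ 2 := by positivity
        gcongr
        nlinarith
    _ ≤ (1 - η • (A * Aᵀ)) * (A * Aᵀ) * (1 - η • (A * Aᵀ)) :=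
        smul_one_le_conj_one_sub_smul hη hs1 hA hS
    _ = _ := by simp [Matrix.mul_assoc]

theorem BoundedBelow.step [DecidableEq n] {D : Matrix m m ℝ} {A E : Matrix m n ℝ} {η x s e : ℝ}
    (hη : 0 ≤ η) (hs : 0 ≤ s) (hD : x • 1 ≤ D) (hS : η • (A * Aᵀ) ≤ (1 / 8 : ℝ) • 1)
    (hA : BoundedBelow s Aᵀ) (hs1 : 8 * η * s ^ 2 ≤ 1) (hE : η * ‖D * (A * Aᵀ) * A‖ + ‖E‖ ≤ e) :
    BoundedBelow ((1 - 2 * η * s ^ 2) * s * (1 + η * x) - η * e)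
      ((1 + η • (D - A * Aᵀ)) * A + η • E)ᵀ := by
  have hDt : Dᵀ = D := by simpa using transpose_eq_of_nonneg (sub_nonneg.2 hD)
  have hgrow : BoundedBelow (1 + η * x) (1 + η • D) := by
    refine boundedBelow_of_smul_one_le ?_
    rw [add_smul, one_smul, mul_smul]
    gcongr
  have herr : ‖(η • (η • (D * (A * Aᵀ) * A) + E))ᵀ‖ ≤ η * e := by
    rw [norm_transpose]
    exact norm_smul_le_of_norm_le hη
      ((norm_add_le_of_le (norm_smul_le_of_norm_le hη le_rfl) le_rfl).trans hE)
  have hmain := BoundedBelow.mul (mul_nonneg (by linarith) hs)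
    (BoundedBelow.one_sub_smul_mul hη hs hA hs1 hS) hgrow
  convert hmain.add_of_norm_le herr using 1
  simp only [transpose_add, transpose_mul, transpose_smul, transpose_sub, hDt,
    transpose_transpose, Matrix.mul_add, Matrix.sub_mul, Matrix.add_mul,
    Matrix.smul_mul, Matrix.mul_smul, Matrix.mul_one, Matrix.one_mul, smul_add, Matrix.mul_assoc]
  module

end Growth

section Antisymmetric

theorem frobInner_skewQ_mul (A B : Matrix m n ℝ) :
    frobInner B (skewQ A B * A) = -(1 / 2) * frobInner (skewQ A B) (skewQ A B) := by
  have t1 : (Bᵀ * (A * (Bᵀ * A))).trace = (A * (Bᵀ * (A * Bᵀ))).trace := by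
    rw [trace_mul_comm]; simp only [Matrix.mul_assoc]
  have t2 : (Bᵀ * (B * (Aᵀ * A))).trace = (A * (Bᵀ * (B * Aᵀ))).trace := by
    rw [← Matrix.mul_assoc, ← Matrix.mul_assoc, trace_mul_comm]; simp only [Matrix.mul_assoc]
  have t3 : (B * (Aᵀ * (A * Bᵀ))).trace = (A * (Bᵀ * (B * Aᵀ))).trace := by
    rw [← Matrix.mul_assoc, trace_mul_comm]; simp only [Matrix.mul_assoc]
  have t4 : (B * (Aᵀ * (B * Aᵀ))).trace = (A * (Bᵀ * (A * Bᵀ))).trace := by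
    rw [← trace_transpose]; simp [Matrix.mul_assoc]
  simp only [frobInner, skewQ, transpose_sub, transpose_mul, transpose_transpose, Matrix.mul_sub,
    Matrix.sub_mul, Matrix.mul_assoc, trace_sub, t1, t2, t3, t4]
  ring

theorem frobInner_driftB_le [DecidableEq m] {D : Matrix m m ℝ} {A : Matrix m n ℝ} {l : ℝ}
    (hR : -(l • 1) ≤ D - A * Aᵀ) (B : Matrix m n ℝ) :
    frobInner B (driftB D A B) ≤ l * frobInner B B := by
  have hres := frobInner_conj_nonneg (neg_le_iff_add_nonneg.1 hR) B
  have hgram := frobInner_conj_nonneg (mul_transpose_self_nonneg B) B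
  have hskew : 0 ≤ frobInner (skewQ A B) (skewQ A B) := by
    rw [frobInner_eq_sum]
    exact Finset.sum_nonneg fun i _ => Finset.sum_nonneg fun j _ => mul_self_nonneg _
  have expand : frobInner B (driftB D A B) = frobInner B (skewQ A B * A) -
      frobInner B ((D - A * Aᵀ + l • 1) * B) - frobInner B (B * Bᵀ * B) + l * frobInner B B := by
    simp only [driftB, frobInner, Matrix.mul_add, Matrix.mul_sub, Matrix.add_mul, Matrix.sub_mul,
      trace_add, trace_sub, Matrix.smul_mul, Matrix.mul_smul, trace_smul, Matrix.one_mul,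
      smul_eq_mul]
    ring
  rw [expand, frobInner_skewQ_mul]
  linarith

variable {a b : ℕ} {D : Matrix (Fin a) (Fin a) ℝ} {A B : Matrix (Fin a) (Fin b) ℝ}
  {F G : Matrix (Fin b) (Fin b) ℝ} {η α r l ω : ℝ}

theorem frobNorm_sub_le (M N : Matrix (Fin a) (Fin b) ℝ) :
    frobNorm (M - N) ≤ frobNorm M + frobNorm N := by
  rw [sub_eq_add_neg, ← frobNorm_neg N]
  exact frobNorm_add_le _ _

theorem frobNorm_skewQ_le (hA : ‖A‖ ≤ α) : frobNorm (skewQ A B) ≤ 2 * α * frobNorm B := by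
  have hAB := frobNorm_mul_le' A Bᵀ
  have hBA := frobNorm_mul_le B Aᵀ
  rw [frobNorm_transpose] at hAB
  rw [norm_transpose] at hBA
  have := mul_le_mul_of_nonneg_right hA (frobNorm_nonneg B)
  refine (frobNorm_sub_le _ _).trans ?_
  linarith

theorem frobNorm_driftB_le (hA : ‖A‖ ≤ α) (hB : ‖B‖ ≤ α) (hR : ‖D - A * Aᵀ‖ ≤ r) :
    frobNorm (driftB D A B) ≤ (3 * α ^ 2 + r) * frobNorm B := by
  have hα : 0 ≤ α := (norm_nonneg _).trans hA
  have hf := frobNorm_nonneg B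
  have hskew : frobNorm (skewQ A B * A) ≤ 2 * α * frobNorm B * α :=
    (frobNorm_mul_le _ _).trans (mul_le_mul (frobNorm_skewQ_le hA) hA (norm_nonneg _)
      (by positivity))
  have hres : frobNorm ((D - A * Aᵀ + B * Bᵀ) * B) ≤ (r + α * α) * frobNorm B :=
    (frobNorm_mul_le' _ _).trans <| mul_le_mul_of_nonneg_right (norm_add_le_of_le hR
      (norm_mul_le_of_norm_le hB ((norm_transpose B).trans_le hB))) hf
  refine (frobNorm_sub_le _ _).trans ((add_le_add hskew hres).trans_eq ?_)
  ring

theorem frobNorm_add_smul_driftB_le (hη : 0 ≤ η) (hl : 0 ≤ l) (hA : ‖A‖ ≤ α) (hB : ‖B‖ ≤ α)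
    (hr : ‖D - A * Aᵀ‖ ≤ r) (hR : -(l • 1) ≤ D - A * Aᵀ) :
    frobNorm (B + η • driftB D A B) ≤ (1 + η * (l + η * (3 * α ^ 2 + r) ^ 2)) * frobNorm B := by
  have hf := frobNorm_nonneg B
  refine (sq_le_sq₀ (frobNorm_nonneg _) (by positivity)).1 ?_
  have inner_le := frobInner_driftB_le hR B
  rw [← frobNorm_sq] at inner_le
  calc frobNorm (B + η • driftB D A B) ^ 2
      = frobNorm B ^ 2 + 2 * η * frobInner B (driftB D A B) +
          η ^ 2 * frobNorm (driftB D A B) ^ 2 := frobNorm_add_smul_sq _ _ _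
    _ ≤ frobNorm B ^ 2 + 2 * η * (l * frobNorm B ^ 2) +
          η ^ 2 * ((3 * α ^ 2 + r) * frobNorm B) ^ 2 := by
        gcongr
        exacts [frobNorm_nonneg _, frobNorm_driftB_le hA hB hr]
    _ ≤ ((1 + η * (l + η * (3 * α ^ 2 + r) ^ 2)) * frobNorm B) ^ 2 := by
        have : 0 ≤ (η * (l + η * (3 * α ^ 2 + r) ^ 2)) ^ 2 * frobNorm B ^ 2 := by positivity
        have : 0 ≤ η ^ 2 * ((3 * α ^ 2 + r) ^ 2 * frobNorm B ^ 2) := by positivity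
        nlinarith

theorem frobNorm_asymB_step (hη : 0 ≤ η) (hl : 0 ≤ l) (hA : ‖A‖ ≤ α) (hB : ‖B‖ ≤ α)
    (hr : ‖D - A * Aᵀ‖ ≤ r) (hR : -(l • 1) ≤ D - A * Aᵀ) (hFG : ‖F‖ + ‖G‖ ≤ ω) :
    frobNorm ((B + η • driftB D A B) + (-(η / 2)) • (A * (G - F) + B * (G + F))) ≤
      frobNorm B + η * ((l + η * (3 * α ^ 2 + r) ^ 2 + ω) * frobNorm B + α * √b * ω) := by
  have hα : 0 ≤ α := (norm_nonneg _).trans hA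
  have hf := frobNorm_nonneg B
  have hGF : ‖G‖ + ‖F‖ ≤ ω := (add_comm _ _).trans_le hFG
  have difference : frobNorm (A * (G - F)) ≤ α * (√b * ω) :=
    (frobNorm_mul_le' _ _).trans <| mul_le_mul hA ((frobNorm_le_sqrt_mul_norm _).trans
      (by gcongr; exact (norm_sub_le G F).trans hGF)) (frobNorm_nonneg _) hα
  have sum : frobNorm (B * (G + F)) ≤ frobNorm B * ω :=
    (frobNorm_mul_le _ _).trans (by gcongr; exact (norm_add_le G F).trans hGF)
  have lower_blocks : frobNorm ((-(η / 2)) • (A * (G - F) + B * (G + F))) ≤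
      η * (α * (√b * ω) + frobNorm B * ω) := by
    rw [frobNorm_smul, abs_neg, abs_of_nonneg (by positivity)]
    gcongr
    exacts [frobNorm_nonneg _, half_le_self hη,
      (frobNorm_add_le _ _).trans (add_le_add difference sum)]
  refine (frobNorm_add_le _ _).trans
    ((add_le_add (frobNorm_add_smul_driftB_le hη hl hA hB hr hR) lower_blocks).trans_eq ?_)
  ring

end Antisymmetric

theorem norm_lower_step [DecidableEq n] {J : Matrix m n ℝ} {H : Matrix n n ℝ} {η x : ℝ}
    (hη : 0 ≤ η) (hH : 0 ≤ H) (hH1 : η * ‖H‖ ≤ 1) (hJ : ‖J‖ ≤ x) :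
    ‖J + η • (-(J * H))‖ ≤ x := by
  have hHη : η • H ≤ 1 := by
    simpa using le_smul_one_of_norm_le (M := η • H) (r := 1)
      (by simp [transpose_eq_of_nonneg hH]) ((norm_smul_le_of_norm_le hη le_rfl).trans hH1)
  have contraction : ‖1 - η • H‖ ≤ 1 - η * 0 :=
    norm_one_sub_smul_le hη (by simp) (by simpa using hH) hHη
  have factor : J + η • (-(J * H)) = J * (1 - η • H) := by
    rw [Matrix.mul_sub, Matrix.mul_one, Matrix.mul_smul, smul_neg, sub_eq_add_neg]
  rw [factor]
  simpa using norm_mul_le_of_norm_le hJ contraction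

end Step

section Blocks

variable {d k l : ℕ}

theorem transpose_mul_self_eq_blocks (X : Matrix (Fin (d + k)) (Fin d) ℝ) :
    Xᵀ * X = (upper X)ᵀ * upper X + (lower X)ᵀ * lower X := by
  ext i j
  simp [Matrix.mul_apply, Fin.sum_univ_add, upper, lower]

theorem upper_rectDiag_mul (σ : Fin d → ℝ) (Y : Matrix (Fin (d + l)) (Fin d) ℝ) :
    upper (rectDiag k l σ * Y) = diagonal σ * upper Y := by
  ext i j
  simp [Matrix.mul_apply, Fin.sum_univ_add, upper, rectDiag]

theorem lower_rectDiag_mul (σ : Fin d → ℝ) (Y : Matrix (Fin (d + l)) (Fin d) ℝ) :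
    lower (rectDiag k l σ * Y) = 0 := by
  ext i j
  simp [Matrix.mul_apply, Fin.sum_univ_add, lower, rectDiag]

theorem rectDiag_transpose (σ : Fin d → ℝ) : (rectDiag k l σ)ᵀ = rectDiag l k σ := by
  simp [rectDiag, fromBlocks_transpose]

/-- One factor of a step of gradient descent in the coordinates of the singular vectors: the factor
`X` moves to `X'`, with `Y` the other factor. -/
structure IsHalfStep (σ : Fin d → ℝ) (η : ℝ) (X X' : Matrix (Fin (d + k)) (Fin d) ℝ)
    (Y : Matrix (Fin (d + l)) (Fin d) ℝ) : Prop where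
  upper_eq : upper X' = upper X + η • (diagonal σ * upper Y -
    upper X * ((upper Y)ᵀ * upper Y + (lower Y)ᵀ * lower Y))
  lower_eq : lower X' = lower X + η •
    (-(lower X * ((upper Y)ᵀ * upper Y + (lower Y)ᵀ * lower Y)))

theorem isHalfStep_of_eq {σ : Fin d → ℝ} {η : ℝ} {X X' : Matrix (Fin (d + k)) (Fin d) ℝ}
    {Y : Matrix (Fin (d + l)) (Fin d) ℝ}
    (h : X' = X + η • (rectDiag k l σ * Y - X * (Yᵀ * Y))) : IsHalfStep σ η X X' Y := by
  rw [transpose_mul_self_eq_blocks] at h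
  constructor
  · rw [← upper_rectDiag_mul (k := k), h]
    rfl
  · rw [← zero_sub, ← lower_rectDiag_mul (k := k) σ Y, h]
    rfl

/-- A step of gradient descent in the coordinates of the singular vectors, from the pair of factors
`(X, Y)` to `(X', Y')`. -/
structure IsStep (σ : Fin d → ℝ) (η : ℝ) (X X' : Matrix (Fin (d + k)) (Fin d) ℝ)
    (Y Y' : Matrix (Fin (d + l)) (Fin d) ℝ) : Prop where
  left : IsHalfStep σ η X X' Y
  right : IsHalfStep σ η Y Y' X

theorem orthogonal_conj_step {m n r : Type*} [Fintype m] [Fintype n] [Fintype r] [DecidableEq m]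
    [DecidableEq n] {Φ : Matrix m m ℝ} {Ψ : Matrix n n ℝ} (hΦ : Φ ∈ orthogonalGroup m ℝ)
    (hΨ : Ψ ∈ orthogonalGroup n ℝ) (M : Matrix m n ℝ) (U : Matrix m r ℝ) (V : Matrix n r ℝ)
    (η : ℝ) : Φᵀ * (U + η • ((Φ * M * Ψᵀ - U * Vᵀ) * V)) =
      Φᵀ * U + η • (M * (Ψᵀ * V) - Φᵀ * U * ((Ψᵀ * V)ᵀ * (Ψᵀ * V))) := by
  have hΦΦ : Φᵀ * Φ = 1 := (mem_orthogonalGroup_iff' _ _).1 hΦ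
  have hΨΨ : Ψ * Ψᵀ = 1 := (mem_orthogonalGroup_iff _ _).1 hΨ
  have gram : (Ψᵀ * V)ᵀ * (Ψᵀ * V) = Vᵀ * V := by
    rw [transpose_mul, transpose_transpose, Matrix.mul_assoc, ← Matrix.mul_assoc Ψ, hΨΨ,
      Matrix.one_mul]
  have target : Φᵀ * (Φ * M * Ψᵀ * V) = M * (Ψᵀ * V) := by
    rw [Matrix.mul_assoc (Φ * M), Matrix.mul_assoc Φ, ← Matrix.mul_assoc Φᵀ, hΦΦ, Matrix.one_mul]
  rw [gram, Matrix.mul_add, Matrix.mul_smul, Matrix.sub_mul, Matrix.mul_sub, target]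
  simp only [Matrix.mul_assoc]

theorem isStep_of_gd {S : Matrix (Fin (d + k)) (Fin (d + l)) ℝ} {σ : Fin d → ℝ}
    {Φ : Matrix (Fin (d + k)) (Fin (d + k)) ℝ} {Ψ : Matrix (Fin (d + l)) (Fin (d + l)) ℝ}
    (h : IsSVD S σ Φ Ψ) {η : ℝ} {U₀ : Matrix (Fin (d + k)) (Fin d) ℝ}
    {V₀ : Matrix (Fin (d + l)) (Fin d) ℝ} {X : ℕ → Matrix (Fin (d + k)) (Fin d) ℝ}
    {Y : ℕ → Matrix (Fin (d + l)) (Fin d) ℝ}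
    (hX : ∀ t, X t = Φ.transpose * (gd S η U₀ V₀ t).1)
    (hY : ∀ t, Y t = Ψ.transpose * (gd S η U₀ V₀ t).2) (t : ℕ) :
    IsStep σ η (X t) (X (t + 1)) (Y t) (Y (t + 1)) := by
  constructor <;> apply isHalfStep_of_eq
  · rw [hX (t + 1), hX t, hY t, gd, h.eq]
    exact orthogonal_conj_step h.left_mem h.right_mem _ _ _ _
  · have hSt : Sᵀ = Ψ * rectDiag l k σ * Φᵀ := by
      rw [h.eq, transpose_mul, transpose_mul, transpose_transpose, rectDiag_transpose,
        Matrix.mul_assoc]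
    rw [hY (t + 1), hX t, hY t, gd]
    simp only [transpose_sub, transpose_mul _ (_)ᵀ, transpose_transpose, hSt]
    exact orthogonal_conj_step h.right_mem h.left_mem _ _ _ _

theorem upper_left_eq (X : Matrix (Fin (d + k)) (Fin d) ℝ) (Y : Matrix (Fin (d + l)) (Fin d) ℝ) :
    upper X = symA X Y + asymB X Y := by
  rw [symA, asymB]; module

theorem upper_right_eq (X : Matrix (Fin (d + k)) (Fin d) ℝ) (Y : Matrix (Fin (d + l)) (Fin d) ℝ) :
    upper Y = symA X Y - asymB X Y := by
  rw [symA, asymB]; module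

/-- The residual `Σ - A Aᵀ` of the symmetric part; it differs from `P` by `B Bᵀ`. -/
abbrev residual (σ : Fin d → ℝ) (X : Matrix (Fin (d + k)) (Fin d) ℝ)
    (Y : Matrix (Fin (d + l)) (Fin d) ℝ) : Matrix (Fin d) (Fin d) ℝ :=
  diagonal σ - symA X Y * (symA X Y)ᵀ

/-- The velocity of `A` beyond `(Σ - A Aᵀ) A`, in terms of the two factors. -/
abbrev driftA (X : Matrix (Fin (d + k)) (Fin d) ℝ) (Y : Matrix (Fin (d + l)) (Fin d) ℝ) :
    Matrix (Fin d) (Fin d) ℝ :=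
  pertA (symA X Y) (asymB X Y) ((lower X)ᵀ * lower X) ((lower Y)ᵀ * lower Y)

theorem IsStep.symA_eq {σ : Fin d → ℝ} {η : ℝ} {X X' : Matrix (Fin (d + k)) (Fin d) ℝ}
    {Y Y' : Matrix (Fin (d + l)) (Fin d) ℝ} (h : IsStep σ η X X' Y Y') :
    symA X' Y' = (1 + η • residual σ X Y) * symA X Y + η • driftA X Y := by
  rw [symA, h.left.upper_eq, h.right.upper_eq, upper_left_eq X Y, upper_right_eq X Y]
  exact symA_step _ _ _ _ _ _

theorem IsStep.asymB_eq {σ : Fin d → ℝ} {η : ℝ} {X X' : Matrix (Fin (d + k)) (Fin d) ℝ}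
    {Y Y' : Matrix (Fin (d + l)) (Fin d) ℝ} (h : IsStep σ η X X' Y Y') :
    asymB X' Y' = (asymB X Y + η • driftB (diagonal σ) (symA X Y) (asymB X Y)) +
      (-(η / 2)) • (symA X Y * ((lower Y)ᵀ * lower Y - (lower X)ᵀ * lower X) +
        asymB X Y * ((lower Y)ᵀ * lower Y + (lower X)ᵀ * lower X)) := by
  rw [asymB, h.left.upper_eq, h.right.upper_eq, upper_left_eq X Y, upper_right_eq X Y]
  exact asymB_step _ _ _ _ _ _

theorem IsStep.residual_eq {σ : Fin d → ℝ} {η : ℝ} {X X' : Matrix (Fin (d + k)) (Fin d) ℝ}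
    {Y Y' : Matrix (Fin (d + l)) (Fin d) ℝ} (h : IsStep σ η X X' Y Y') :
    residual σ X' Y' =
      (1 - η • (symA X Y * (symA X Y)ᵀ)) * residual σ X Y * (1 - η • (symA X Y * (symA X Y)ᵀ)) -
        pertR (residual σ X Y) (symA X Y) (driftA X Y) η := by
  rw [residual, h.symA_eq]
  exact residual_step _ η (diagonal_transpose _) rfl

end Blocks

section Regime

/-- The relations between the parameters on which the analysis of the warm-up stage rests; `L`
stands for `log (d σd / ε²)`, `κ` is a small constant depending only on `c`, and `θ` is the size of
all the squared perturbations. -/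
structure Regime {d : ℕ} (m' n' : ℕ) (c ε η σ₁ σd N L κ θ : ℝ) (σ : Fin d → ℝ) : Prop where
  d_pos : 0 < d
  c_pos : 0 < c
  ε_pos : 0 < ε
  η_pos : 0 < η
  σd_pos : 0 < σd
  σd_le : ∀ i, σd ≤ σ i
  le_σ₁ : ∀ i, σ i ≤ σ₁
  N_eq : N = (d + m') + (d + n')
  θ_eq : θ = c ^ 2 * ε ^ 2 * d * N
  exp_L : Real.exp L = d * σd / ε ^ 2
  four_le_L : 4 ≤ L
  κ_pos : 0 < κ
  κ_le : κ ≤ 1 / 1000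
  κ_mul_le : 200 * κ * c ^ 2 ≤ 1
  κ_le_c : κ ≤ c
  ε_le : L * √σ₁ * c * ε * (d * √d) * N ≤ κ * σd
  η_le : η * σ₁ ^ 2 ≤ θ

namespace Regime

variable {d m' n' : ℕ} {c ε η σ₁ σd N L κ θ : ℝ} {σ : Fin d → ℝ}

theorem one_le_d (h : Regime m' n' c ε η σ₁ σd N L κ θ σ) : (1 : ℝ) ≤ d := by
  exact_mod_cast h.d_pos

theorem sqrt_d_pos (h : Regime m' n' c ε η σ₁ σd N L κ θ σ) : 0 < √(d : ℝ) :=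
  Real.sqrt_pos.2 (by linarith [h.one_le_d])

theorem σd_le_σ₁ (h : Regime m' n' c ε η σ₁ σd N L κ θ σ) : σd ≤ σ₁ :=
  (h.σd_le ⟨0, h.d_pos⟩).trans (h.le_σ₁ _)

theorem σ₁_pos (h : Regime m' n' c ε η σ₁ σd N L κ θ σ) : 0 < σ₁ := h.σd_pos.trans_le h.σd_le_σ₁

theorem sq_sqrt_σ₁ (h : Regime m' n' c ε η σ₁ σd N L κ θ σ) : √σ₁ ^ 2 = σ₁ :=
  Real.sq_sqrt h.σ₁_pos.le

theorem two_mul_d_le_N (h : Regime m' n' c ε η σ₁ σd N L κ θ σ) : 2 * (d : ℝ) ≤ N := by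
  rw [h.N_eq]
  linarith [m'.cast_nonneg (α := ℝ), n'.cast_nonneg (α := ℝ)]

theorem one_le_d_mul_N (h : Regime m' n' c ε η σ₁ σd N L κ θ σ) : 1 ≤ d * N :=
  one_le_mul_of_one_le_of_one_le h.one_le_d (by linarith [h.one_le_d, h.two_mul_d_le_N])

theorem L_pos (h : Regime m' n' c ε η σ₁ σd N L κ θ σ) : 0 < L := by linarith [h.four_le_L]

theorem κ_sq_le (h : Regime m' n' c ε η σ₁ σd N L κ θ σ) : κ ^ 2 ≤ 1 / 1000000 :=
  (pow_le_pow_left₀ h.κ_pos.le h.κ_le 2).trans_eq (by norm_num)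

theorem sq_c_mul_ε_le (h : Regime m' n' c ε η σ₁ σd N L κ θ σ) : c ^ 2 * ε ^ 2 ≤ θ := by
  rw [h.θ_eq, mul_assoc]
  exact le_mul_of_one_le_right (by positivity) h.one_le_d_mul_N

theorem θ_pos (h : Regime m' n' c ε η σ₁ σd N L κ θ σ) : 0 < θ := by
  have := h.c_pos
  have := h.ε_pos
  exact lt_of_lt_of_le (by positivity) h.sq_c_mul_ε_le

theorem sq_L_mul_σ₁_mul_θ_le (h : Regime m' n' c ε η σ₁ σd N L κ θ σ) :
    L ^ 2 * (σ₁ * θ) ≤ κ ^ 2 * σd ^ 2 := by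
  have := h.c_pos; have := h.ε_pos; have hd := h.one_le_d; have hN := h.two_mul_d_le_N
  have := h.L_pos; have := h.σ₁_pos; have := h.θ_pos
  have hdN : 1 ≤ (d : ℝ) ^ 2 * N := by
    rw [sq, mul_assoc]
    exact one_le_mul_of_one_le_of_one_le hd h.one_le_d_mul_N
  have square : (L * √σ₁ * c * ε * (d * √d) * N) ^ 2 = L ^ 2 * (σ₁ * θ) * ((d : ℝ) ^ 2 * N) := by
    have hsqrt : √(d : ℝ) ^ 2 = d := Real.sq_sqrt d.cast_nonneg
    simp only [mul_pow, h.sq_sqrt_σ₁, hsqrt, h.θ_eq]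
    ring
  calc L ^ 2 * (σ₁ * θ) ≤ L ^ 2 * (σ₁ * θ) * ((d : ℝ) ^ 2 * N) :=
        le_mul_of_one_le_right (by positivity) hdN
    _ ≤ (κ * σd) ^ 2 :=
        square.symm.trans_le (pow_le_pow_left₀ (mul_nonneg (by positivity) (by linarith)) h.ε_le 2)
    _ = κ ^ 2 * σd ^ 2 := mul_pow _ _ _

theorem L_mul_θ_le (h : Regime m' n' c ε η σ₁ σd N L κ θ σ) : L * θ ≤ κ ^ 2 * σd := by
  have := h.θ_pos; have hL := h.four_le_L; have := h.σd_pos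
  refine le_of_mul_le_mul_left ?_ h.σd_pos
  calc σd * (L * θ) = L * (σd * θ) := by ring
    _ ≤ L ^ 2 * (σ₁ * θ) := by
        gcongr
        · exact le_self_pow₀ (by linarith) two_ne_zero
        · exact h.σd_le_σ₁
    _ ≤ κ ^ 2 * σd ^ 2 := h.sq_L_mul_σ₁_mul_θ_le
    _ = σd * (κ ^ 2 * σd) := by ring

theorem θ_mul_L_le (h : Regime m' n' c ε η σ₁ σd N L κ θ σ) : θ * L ≤ σd / 1000000 := by
  linarith [h.L_mul_θ_le, mul_le_mul_of_nonneg_right h.κ_sq_le h.σd_pos.le]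

theorem θ_le (h : Regime m' n' c ε η σ₁ σd N L κ θ σ) : θ ≤ σd / 1000000 :=
  (le_mul_of_one_le_right h.θ_pos.le (by linarith [h.four_le_L])).trans h.θ_mul_L_le

theorem sq_beta_le (h : Regime m' n' c ε η σ₁ σd N L κ θ σ) : (2 * c * d * ε) ^ 2 ≤ 2 * θ := by
  rw [h.θ_eq]
  calc (2 * c * d * ε) ^ 2 = 2 * (c ^ 2 * ε ^ 2 * d) * (2 * d) := by ring
    _ ≤ 2 * (c ^ 2 * ε ^ 2 * d) * N :=
        mul_le_mul_of_nonneg_left h.two_mul_d_le_N (by positivity)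
    _ = 2 * (c ^ 2 * ε ^ 2 * d * N) := by ring

theorem beta_le (h : Regime m' n' c ε η σ₁ σd N L κ θ σ) : 2 * c * d * ε ≤ √σ₁ :=
  Real.le_sqrt_of_sq_le (by linarith [h.sq_beta_le, h.θ_le, h.σd_le_σ₁, h.σd_pos])

theorem η_mul_σ₁_le (h : Regime m' n' c ε η σ₁ σd N L κ θ σ) : η * σ₁ ≤ 1 / 1000000 := by
  refine le_of_mul_le_mul_right ?_ h.σ₁_pos
  linarith [h.η_le, h.θ_le, h.σd_le_σ₁]

theorem η_mul_σd_pos (h : Regime m' n' c ε η σ₁ σd N L κ θ σ) : 0 < η * σd :=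
  mul_pos h.η_pos h.σd_pos

theorem η_mul_σd_le (h : Regime m' n' c ε η σ₁ σd N L κ θ σ) : η * σd ≤ 1 / 1000000 :=
  (mul_le_mul_of_nonneg_left h.σd_le_σ₁ h.η_pos.le).trans h.η_mul_σ₁_le

theorem driftA_bound_le (h : Regime m' n' c ε η σ₁ σd N L κ θ σ) :
    2 * √σ₁ * (3 * (2 * c * d * ε) ^ 2 + θ) ≤ 14 * √σ₁ * θ := by
  have := mul_le_mul_of_nonneg_left h.sq_beta_le (Real.sqrt_nonneg σ₁)
  linarith

theorem pertR_bound_le (h : Regime m' n' c ε η σ₁ σd N L κ θ σ) :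
    η * ((2 * √σ₁) ^ 4 * σ₁ + (2 * √σ₁) ^ 2 * σ₁ ^ 2) +
      2 * (1 + η * σ₁) * (2 * √σ₁) * (14 * √σ₁ * θ) + η * (14 * √σ₁ * θ) ^ 2 ≤ 80 * σ₁ * θ := by
  have hσ₁ := h.σ₁_pos; have hσθ := mul_pos hσ₁ h.θ_pos
  have hηθ : η * θ ≤ 1 / 1000000 :=
    (mul_le_mul_of_nonneg_left (by linarith [h.θ_le, h.σd_pos]) h.η_pos.le).trans h.η_mul_σd_le
  have quartic : η * ((2 * √σ₁) ^ 4 * σ₁ + (2 * √σ₁) ^ 2 * σ₁ ^ 2) ≤ 20 * (σ₁ * θ) := by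
    calc _ = η * (16 * (√σ₁ ^ 2) ^ 2 * σ₁ + 4 * √σ₁ ^ 2 * σ₁ ^ 2) := by ring
      _ = 20 * (σ₁ * (η * σ₁ ^ 2)) := by rw [h.sq_sqrt_σ₁]; ring
      _ ≤ 20 * (σ₁ * θ) := by gcongr; exact h.η_le
  have linear : 2 * (1 + η * σ₁) * (2 * √σ₁) * (14 * √σ₁ * θ) ≤ 57 * (σ₁ * θ) := by
    calc _ = 56 * (1 + η * σ₁) * (√σ₁ ^ 2 * θ) := by ring
      _ ≤ 57 * (σ₁ * θ) := by
          rw [h.sq_sqrt_σ₁]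
          gcongr
          linarith [h.η_mul_σ₁_le]
  have quadratic : η * (14 * √σ₁ * θ) ^ 2 ≤ 1 * (σ₁ * θ) := by
    calc _ = 196 * (η * θ) * (√σ₁ ^ 2 * θ) := by ring
      _ ≤ 1 * (σ₁ * θ) := by
          rw [h.sq_sqrt_σ₁]
          gcongr
          linarith
  linarith

theorem perturbation_le_growth (h : Regime m' n' c ε η σ₁ σd N L κ θ σ) :
    22 * √σ₁ * θ ≤ σd * (ε / (c * √d)) / 8 := by
  have := h.c_pos; have := h.ε_pos; have := h.sqrt_d_pos; have := h.σd_pos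
  have hN : 0 < N := by linarith [h.one_le_d, h.two_mul_d_le_N]
  have hε : √σ₁ * c * ε * (d * √d) * N ≤ κ * σd / 4 := by
    have : 4 * (√σ₁ * c * ε * (d * √d) * N) ≤ L * (√σ₁ * c * ε * (d * √d) * N) :=
      mul_le_mul_of_nonneg_right h.four_le_L (by positivity)
    linarith [h.ε_le]
  have hκ : 22 * (κ * σd / 4) ≤ σd / (8 * c ^ 2) := by
    rw [le_div_iff₀ (by positivity)]
    linarith [mul_le_mul_of_nonneg_right h.κ_mul_le h.σd_pos.le]
  calc 22 * √σ₁ * θ = c * ε / √d * (22 * (√σ₁ * c * ε * (d * √d) * N)) := by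
        rw [h.θ_eq]; field_simp
    _ ≤ c * ε / √d * (22 * (κ * σd / 4)) := by gcongr
    _ ≤ c * ε / √d * (σd / (8 * c ^ 2)) := by gcongr
    _ = σd * (ε / (c * √d)) / 8 := by field_simp

theorem loss_mul_L_le (h : Regime m' n' c ε η σ₁ σd N L κ θ σ) :
    17 * L / σd * (80 * σ₁ * θ) * L ≤ σd / 500 := by
  have := h.σd_pos
  calc 17 * L / σd * (80 * σ₁ * θ) * L = 1360 * (L ^ 2 * (σ₁ * θ)) / σd := by ring
    _ ≤ 1360 * (κ ^ 2 * σd ^ 2) / σd := by gcongr ?_ / _; linarith [h.sq_L_mul_σ₁_mul_θ_le]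
    _ = 1360 * κ ^ 2 * σd := by field_simp
    _ ≤ σd / 500 := by linarith [mul_le_mul_of_nonneg_right h.κ_sq_le h.σd_pos.le]

theorem loss_le (h : Regime m' n' c ε η σ₁ σd N L κ θ σ) :
    17 * L / σd * (80 * σ₁ * θ) ≤ σd / 100 := by
  have := h.σd_pos; have := h.σ₁_pos; have := h.θ_pos; have := h.L_pos
  exact (le_mul_of_one_le_right (by positivity) (by linarith [h.four_le_L])).trans
    (h.loss_mul_L_le.trans (by linarith))

theorem coupling_mul_L_le (h : Regime m' n' c ε η σ₁ σd N L κ θ σ) :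
    2 * √σ₁ * √d * θ * L ≤ c * d * ε * σd / 500 := by
  have := h.c_pos; have := h.ε_pos; have := h.σd_pos
  calc 2 * √σ₁ * √d * θ * L = 2 * (c * ε) * (L * √σ₁ * c * ε * (d * √d) * N) := by
        rw [h.θ_eq]; ring
    _ ≤ 2 * (c * ε) * (κ * σd) := mul_le_mul_of_nonneg_left h.ε_le (by positivity)
    _ ≤ 2 * (c * ε * d) * (1 / 1000 * σd) := by
        have hcε : c * ε ≤ c * ε * d := le_mul_of_one_le_right (by positivity) h.one_le_d
        have hκ : κ * σd ≤ 1 / 1000 * σd := mul_le_mul_of_nonneg_right h.κ_le h.σd_pos.le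
        have := h.κ_pos
        gcongr
    _ = c * d * ε * σd / 500 := by ring

theorem asymB_growth_le (h : Regime m' n' c ε η σ₁ σd N L κ θ σ) {l b : ℝ}
    (hl : l ≤ 17 * L / σd * (80 * σ₁ * θ)) (hb : 0 ≤ b) (hbβ : b ≤ 2 * c * d * ε) :
    (l + η * (3 * (2 * √σ₁) ^ 2 + σ₁) ^ 2 + θ) * b + 2 * √σ₁ * √d * θ ≤
      c * d * ε * (σd / (17 * L)) := by
  have hL := h.L_pos; have := h.σd_pos
  have loss : l * L ≤ σd / 500 := (mul_le_mul_of_nonneg_right hl hL.le).trans h.loss_mul_L_le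
  have quartic : η * (3 * (2 * √σ₁) ^ 2 + σ₁) ^ 2 * L ≤ 169 * (σd / 1000000) := by
    calc _ = 169 * (η * σ₁ ^ 2 * L) := by rw [mul_pow 2, h.sq_sqrt_σ₁]; ring
      _ ≤ 169 * (θ * L) := by gcongr; exact h.η_le
      _ ≤ 169 * (σd / 1000000) := by gcongr; exact h.θ_mul_L_le
  have rate : (l + η * (3 * (2 * √σ₁) ^ 2 + σ₁) ^ 2 + θ) * L ≤ σd / 400 := by
    linarith [h.θ_mul_L_le]
  have hcdε : 0 ≤ c * d * ε * σd := by have := h.c_pos; have := h.ε_pos; positivity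
  refine le_of_mul_le_mul_right ?_ hL
  calc ((l + η * (3 * (2 * √σ₁) ^ 2 + σ₁) ^ 2 + θ) * b + 2 * √σ₁ * √d * θ) * L
      = (l + η * (3 * (2 * √σ₁) ^ 2 + σ₁) ^ 2 + θ) * L * b + 2 * √σ₁ * √d * θ * L := by ring
    _ ≤ σd / 400 * (2 * c * d * ε) + c * d * ε * σd / 500 :=
        add_le_add (mul_le_mul rate hbβ hb (by positivity)) h.coupling_mul_L_le
    _ ≤ c * d * ε * σd / 17 := by linarith
    _ = c * d * ε * (σd / (17 * L)) * L := by field_simp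

theorem σ₁_le_exp_L_mul (h : Regime m' n' c ε η σ₁ σd N L κ θ σ) : σ₁ ≤ Real.exp L * σd := by
  have := h.ε_pos; have hσ₁ := h.σ₁_pos; have hσd := h.σd_pos; have hκ := h.κ_pos
  have hθ := h.θ_pos
  have key : c ^ 2 * (σ₁ * ε ^ 2) ≤ c ^ 2 * σd ^ 2 := by
    calc c ^ 2 * (σ₁ * ε ^ 2) = σ₁ * (c ^ 2 * ε ^ 2) := by ring
      _ ≤ σ₁ * θ := by gcongr; exact h.sq_c_mul_ε_le
      _ ≤ L ^ 2 * (σ₁ * θ) :=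
          le_mul_of_one_le_left (by positivity) (one_le_pow₀ (by linarith [h.four_le_L]))
      _ ≤ κ ^ 2 * σd ^ 2 := h.sq_L_mul_σ₁_mul_θ_le
      _ ≤ c ^ 2 * σd ^ 2 := by gcongr; exact h.κ_le_c
  rw [h.exp_L, div_mul_eq_mul_div, le_div_iff₀ (by positivity)]
  calc σ₁ * ε ^ 2 ≤ 1 * σd ^ 2 := by
        simpa using le_of_mul_le_mul_left key (pow_pos h.c_pos 2)
    _ ≤ d * σd ^ 2 := by gcongr; exact h.one_le_d
    _ = d * σd * σd := by ring

theorem init_le_half_sqrt (h : Regime m' n' c ε η σ₁ σd N L κ θ σ) : c * √d * ε ≤ √σd / 2 := by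
  have hc := h.c_pos; have hε := h.ε_pos
  refine (sq_le_sq₀ (by positivity) (by positivity)).1 ?_
  have hsq : (c * √d * ε) ^ 2 * 1 ≤ θ := by
    rw [mul_pow, mul_pow, Real.sq_sqrt d.cast_nonneg, h.θ_eq, mul_right_comm (c ^ 2)]
    gcongr
    linarith [h.one_le_d, h.two_mul_d_le_N]
  rw [div_pow, Real.sq_sqrt h.σd_pos.le]
  linarith [h.θ_le, h.σd_pos]

theorem growth_le (h : Regime m' n' c ε η σ₁ σd N L κ θ σ) {s : ℝ} (hs₀ : ε / (c * √d) ≤ s)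
    (hs : s ≤ √σd / 2) : (1 + η * σd / 4) * s ≤
      (1 - 2 * η * s ^ 2) * s * (1 + η * σd) - η * (22 * √σ₁ * θ) := by
  have := h.c_pos; have := h.ε_pos; have hη := h.η_pos; have hx := h.η_mul_σd_pos
  have hs0 : 0 ≤ s := le_trans (by positivity) hs₀
  have hs2 : η * s ^ 2 ≤ η * (σd / 4) := by
    gcongr
    calc s ^ 2 ≤ (√σd / 2) ^ 2 := by gcongr
      _ = σd / 4 := by rw [div_pow, Real.sq_sqrt h.σd_pos.le]; norm_num
  have perturbation : η * (22 * √σ₁ * θ) ≤ η * σd / 8 * s := by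
    calc η * (22 * √σ₁ * θ) ≤ η * (σd * (ε / (c * √d)) / 8) := by
          gcongr; exact h.perturbation_le_growth
      _ = η * σd / 8 * (ε / (c * √d)) := by ring
      _ ≤ η * σd / 8 * s := by gcongr
  have rate : 1 + η * σd / 4 + η * σd / 8 ≤ (1 - 2 * η * s ^ 2) * (1 + η * σd) := by
    nlinarith [h.η_mul_σd_le]
  linarith [mul_le_mul_of_nonneg_right rate hs0]

theorem exp_L_le_pow (h : Regime m' n' c ε η σ₁ σd N L κ θ σ) {t : ℕ}
    (ht : 8 * L / (η * σd) ≤ t) : Real.exp L ≤ (1 + η * σd / 4) ^ t := by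
  have hx := h.η_mul_σd_pos; have hx1 := h.η_mul_σd_le
  have base : Real.exp (η * σd / 8) ≤ 1 + η * σd / 4 := by
    refine (Real.exp_bound_div_one_sub_of_interval (by positivity) (by linarith)).trans ?_
    rw [div_le_iff₀ (by linarith)]
    nlinarith
  refine le_trans ?_ (pow_le_pow_left₀ (Real.exp_pos _).le base t)
  rw [← Real.exp_nat_mul, Real.exp_le_exp]
  rw [div_le_iff₀ hx] at ht
  linarith

theorem half_sqrt_le_growth (h : Regime m' n' c ε η σ₁ σd N L κ θ σ) {t : ℕ}
    (ht : 8 * L / (η * σd) ≤ t) : √σd / 2 ≤ ε / (c * √d) * (1 + η * σd / 4) ^ t := by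
  have hc := h.c_pos; have hε := h.ε_pos; have hd := h.sqrt_d_pos; have hσd := h.σd_pos
  have hcε : c * ε ≤ √σd :=
    Real.le_sqrt_of_sq_le (by linarith [h.sq_c_mul_ε_le, h.θ_le, mul_pow c ε 2])
  calc √σd / 2 ≤ √σd * 1 := by linarith [Real.sqrt_nonneg σd]
    _ ≤ √σd * (√d * (√σd / (c * ε))) := by
        gcongr
        exact one_le_mul_of_one_le_of_one_le (Real.one_le_sqrt.2 h.one_le_d)
          ((one_le_div (by positivity)).2 hcε)
    _ = √d * √σd ^ 2 / (c * ε) := by ring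
    _ = ε / (c * √d) * Real.exp L := by
        have hsqrt : (d : ℝ) = √(d : ℝ) ^ 2 := (Real.sq_sqrt d.cast_nonneg).symm
        rw [h.exp_L, Real.sq_sqrt hσd.le]
        nth_rewrite 3 [hsqrt]
        field_simp
    _ ≤ ε / (c * √d) * (1 + η * σd / 4) ^ t := by gcongr; exact h.exp_L_le_pow ht

theorem one_sub_pow_mul_σ₁_le (h : Regime m' n' c ε η σ₁ σd N L κ θ σ) {t : ℕ}
    (ht : 8 * L / (η * σd) ≤ t) : (1 - η * (σd / 4)) ^ t * σ₁ ≤ σd / 32 := by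
  have hσd := h.σd_pos; have hσ₁ := h.σ₁_pos
  have decay : (1 - η * (σd / 4)) ^ t ≤ Real.exp (-(2 * L)) := by
    calc (1 - η * (σd / 4)) ^ t ≤ Real.exp (-(η * (σd / 4))) ^ t :=
          pow_le_pow_left₀ (by linarith [h.η_mul_σd_le]) (Real.one_sub_le_exp_neg _) t
      _ ≤ Real.exp (-(2 * L)) := by
          rw [← Real.exp_nat_mul, Real.exp_le_exp]
          rw [div_le_iff₀ h.η_mul_σd_pos] at ht
          linarith
  have small : Real.exp (-L) ≤ 1 / 32 := by
    rw [Real.exp_neg, ← one_div]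
    refine one_div_le_one_div_of_le (by norm_num) ?_
    calc (32 : ℝ) ≤ 2.7 ^ 4 := by norm_num
      _ ≤ Real.exp 1 ^ 4 :=
          pow_le_pow_left₀ (by norm_num) (by linarith [Real.exp_one_gt_d9]) 4
      _ = Real.exp 4 := by rw [← Real.exp_nat_mul]; norm_num
      _ ≤ Real.exp L := Real.exp_le_exp.2 h.four_le_L
  calc (1 - η * (σd / 4)) ^ t * σ₁ ≤ Real.exp (-(2 * L)) * (Real.exp L * σd) := by
        gcongr; exact h.σ₁_le_exp_L_mul
    _ = Real.exp (-L) * σd := by rw [← mul_assoc, ← Real.exp_add]; ring_nf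
    _ ≤ 1 / 32 * σd := by gcongr
    _ = σd / 32 := by ring

theorem residual_floor_le (h : Regime m' n' c ε η σ₁ σd N L κ θ σ) :
    320 * σ₁ * θ / σd ≤ σd / 32 := by
  have hσd := h.σd_pos; have := h.σ₁_pos; have := h.θ_pos
  rw [div_le_iff₀ hσd]
  have hL : 1 * (σ₁ * θ) ≤ L ^ 2 * (σ₁ * θ) := by
    gcongr
    exact one_le_pow₀ (by linarith [h.four_le_L])
  linarith [h.sq_L_mul_σ₁_mul_θ_le, mul_le_mul_of_nonneg_right h.κ_sq_le (sq_nonneg σd),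
    sq_nonneg σd]

theorem two_mul_ceil_le (h : Regime m' n' c ε η σ₁ σd N L κ θ σ) :
    ((2 * ⌈8 * L / (η * σd)⌉₊ : ℕ) : ℝ) ≤ 17 * L / (η * σd) := by
  have hx := h.η_mul_σd_pos; have hL := h.L_pos
  have ceil := Nat.ceil_lt_add_one (show 0 ≤ 8 * L / (η * σd) by positivity)
  have large : 2 ≤ L / (η * σd) := by
    rw [le_div_iff₀ hx]
    linarith [h.η_mul_σd_le, h.four_le_L]
  push_cast
  rw [mul_div_assoc] at ceil ⊢
  rw [mul_div_assoc]
  linarith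

end Regime

end Regime

section Diagonal

variable {n : Type*} [DecidableEq n] {σ : n → ℝ} {x : ℝ}

theorem smul_one_le_diagonal (h : ∀ i, x ≤ σ i) : x • (1 : Matrix n n ℝ) ≤ diagonal σ := by
  rw [Matrix.le_iff, smul_one_eq_diagonal, diagonal_sub]
  exact posSemidef_diagonal_iff.2 fun i => sub_nonneg.2 (h i)

theorem diagonal_le_smul_one (h : ∀ i, σ i ≤ x) : diagonal σ ≤ x • (1 : Matrix n n ℝ) := by
  rw [Matrix.le_iff, smul_one_eq_diagonal, diagonal_sub]
  exact posSemidef_diagonal_iff.2 fun i => sub_nonneg.2 (h i)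

theorem norm_diagonal_le [Fintype n] (hx : 0 ≤ x) (h0 : ∀ i, 0 ≤ σ i) (h : ∀ i, σ i ≤ x) :
    ‖diagonal σ‖ ≤ x := by
  rw [l2_opNorm_diagonal, pi_norm_le_iff_of_nonneg hx]
  exact fun i => (Real.norm_of_nonneg (h0 i)).trans_le (h i)

end Diagonal

section WarmUp

theorem min_mul_pow_succ_le {a q r : ℝ} (hq : 1 ≤ q) (hr : 0 ≤ r) (t : ℕ) :
    min (a * q ^ (t + 1)) r ≤ q * min (a * q ^ t) r := by
  rw [mul_min_of_nonneg _ _ (zero_le_one.trans hq)]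
  exact min_le_min (by rw [pow_succ]; linarith) (le_mul_of_one_le_left hr hq)

variable {d m' n' k l : ℕ} {c ε η σ₁ σd N L κ θ : ℝ} {σ : Fin d → ℝ}

theorem IsHalfStep.norm_lower_le (h : Regime m' n' c ε η σ₁ σd N L κ θ σ)
    {X X' : Matrix (Fin (d + k)) (Fin d) ℝ} {Y : Matrix (Fin (d + l)) (Fin d) ℝ} {x : ℝ}
    (hst : IsHalfStep σ η X X' Y) (hU : ‖upper Y‖ ≤ 3 * √σ₁)
    (hJ : ‖(lower Y)ᵀ * lower Y‖ ≤ σ₁) (hX : ‖lower X‖ ≤ x) : ‖lower X'‖ ≤ x := by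
  rw [hst.lower_eq]
  refine norm_lower_step h.η_pos.le
    (add_nonneg (transpose_mul_self_nonneg _) (transpose_mul_self_nonneg _)) ?_ hX
  have hUU : ‖(upper Y)ᵀ * upper Y‖ ≤ 9 * σ₁ := by
    rw [norm_transpose_mul_self, ← h.sq_sqrt_σ₁]
    exact (pow_le_pow_left₀ (norm_nonneg _) hU 2).trans_eq (by ring)
  calc η * ‖(upper Y)ᵀ * upper Y + (lower Y)ᵀ * lower Y‖ ≤ η * (9 * σ₁ + σ₁) :=
        mul_le_mul_of_nonneg_left (norm_add_le_of_le hUU hJ) h.η_pos.le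
    _ ≤ 1 := by linarith [h.η_mul_σ₁_le]

/-- The invariant of the warm-up stage after `t` steps, where `t` is within the time horizon. -/
structure WarmState (c ε η σ₁ σd L θ : ℝ) (σ : Fin d → ℝ) (t : ℕ)
    (X : Matrix (Fin (d + m')) (Fin d) ℝ) (Y : Matrix (Fin (d + n')) (Fin d) ℝ) : Prop where
  t_le : (t : ℝ) ≤ 17 * L / (η * σd)
  J_le : ‖lower X‖ ≤ c * ε * √(max (m' : ℝ) d)
  K_le : ‖lower Y‖ ≤ c * ε * √(max (n' : ℝ) d)
  B_le : frobNorm (asymB X Y) ≤ c * d * ε * (1 + t * (η * (σd / (17 * L))))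
  R_ge : -((t * (η * (80 * σ₁ * θ))) • 1) ≤ residual σ X Y
  A_ge : BoundedBelow (min (ε / (c * √d) * (1 + η * σd / 4) ^ t) (√σd / 2)) (symA X Y)ᵀ

namespace WarmState

variable {X X' : Matrix (Fin (d + m')) (Fin d) ℝ} {Y Y' : Matrix (Fin (d + n')) (Fin d) ℝ} {t : ℕ}

theorem loss_nonneg (h : Regime m' n' c ε η σ₁ σd N L κ θ σ) :
    0 ≤ t * (η * (80 * σ₁ * θ)) := by
  have := h.η_pos; have := h.σ₁_pos; have := h.θ_pos
  positivity

theorem loss_le (h : Regime m' n' c ε η σ₁ σd N L κ θ σ)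
    (hs : WarmState c ε η σ₁ σd L θ σ t X Y) :
    t * (η * (80 * σ₁ * θ)) ≤ 17 * L / σd * (80 * σ₁ * θ) := by
  have hη := h.η_pos; have := h.σ₁_pos; have := h.θ_pos; have := h.σd_pos
  calc t * (η * (80 * σ₁ * θ)) ≤ 17 * L / (η * σd) * (η * (80 * σ₁ * θ)) :=
        mul_le_mul_of_nonneg_right hs.t_le (by positivity)
    _ = 17 * L / σd * (80 * σ₁ * θ) := by field_simp

theorem norm_residual_le (h : Regime m' n' c ε η σ₁ σd N L κ θ σ)
    (hs : WarmState c ε η σ₁ σd L θ σ t X Y) : ‖residual σ X Y‖ ≤ σ₁ := by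
  refine norm_le_of_neg_le_of_le h.σ₁_pos.le (le_trans (neg_le_neg ?_) hs.R_ge)
    (le_trans (sub_le_self _ (mul_transpose_self_nonneg _)) (diagonal_le_smul_one h.le_σ₁))
  exact smul_le_smul_of_nonneg_right
    (by linarith [hs.loss_le h, h.loss_le, h.σd_le_σ₁, h.σd_pos]) zero_le_one

theorem norm_symA_le (h : Regime m' n' c ε η σ₁ σd N L κ θ σ)
    (hs : WarmState c ε η σ₁ σd L θ σ t X Y) : ‖symA X Y‖ ≤ 2 * √σ₁ := by
  have hσ := norm_diagonal_le h.σ₁_pos.le (fun i => h.σd_pos.le.trans (h.σd_le i)) h.le_σ₁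
  refine (sq_le_sq₀ (norm_nonneg _) (by positivity)).1 ?_
  calc ‖symA X Y‖ ^ 2 = ‖diagonal σ - residual σ X Y‖ := by
        rw [residual, sub_sub_cancel, norm_mul_transpose_self]
    _ ≤ σ₁ + σ₁ := norm_sub_le_of_le hσ (hs.norm_residual_le h)
    _ ≤ (2 * √σ₁) ^ 2 := by rw [mul_pow, h.sq_sqrt_σ₁]; linarith [h.σ₁_pos]

theorem frobNorm_asymB_le (h : Regime m' n' c ε η σ₁ σd N L κ θ σ)
    (hs : WarmState c ε η σ₁ σd L θ σ t X Y) : frobNorm (asymB X Y) ≤ 2 * c * d * ε := by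
  have hc := h.c_pos; have hε := h.ε_pos; have := h.η_pos; have := h.σd_pos; have := h.L_pos
  have horizon : t * (η * (σd / (17 * L))) ≤ 1 := by
    calc t * (η * (σd / (17 * L))) ≤ 17 * L / (η * σd) * (η * (σd / (17 * L))) :=
          mul_le_mul_of_nonneg_right hs.t_le (by positivity)
      _ = 1 := by field_simp
  calc frobNorm (asymB X Y) ≤ c * d * ε * (1 + t * (η * (σd / (17 * L)))) := hs.B_le
    _ ≤ c * d * ε * (1 + 1) := by gcongr
    _ = 2 * c * d * ε := by ring

theorem norm_asymB_le (h : Regime m' n' c ε η σ₁ σd N L κ θ σ)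
    (hs : WarmState c ε η σ₁ σd L θ σ t X Y) : ‖asymB X Y‖ ≤ √σ₁ :=
  (norm_le_frobNorm _).trans ((hs.frobNorm_asymB_le h).trans h.beta_le)

theorem norm_lower_gram_add_le (h : Regime m' n' c ε η σ₁ σd N L κ θ σ)
    (hs : WarmState c ε η σ₁ σd L θ σ t X Y) :
    ‖(lower X)ᵀ * lower X‖ + ‖(lower Y)ᵀ * lower Y‖ ≤ θ := by
  have gram {p : ℕ} {J : Matrix (Fin p) (Fin d) ℝ} (hJ : ‖J‖ ≤ c * ε * √(max (p : ℝ) d)) :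
      ‖Jᵀ * J‖ ≤ (c * ε) ^ 2 * (d + p) := by
    rw [norm_transpose_mul_self]
    calc ‖J‖ ^ 2 ≤ (c * ε * √(max (p : ℝ) d)) ^ 2 := by gcongr
      _ = (c * ε) ^ 2 * max (p : ℝ) d := by rw [mul_pow, Real.sq_sqrt (by positivity)]
      _ ≤ (c * ε) ^ 2 * (d + p) := by
          gcongr
          exact max_le (by simp) (by simp)
  calc ‖(lower X)ᵀ * lower X‖ + ‖(lower Y)ᵀ * lower Y‖
      ≤ (c * ε) ^ 2 * (d + m') + (c * ε) ^ 2 * (d + n') := add_le_add (gram hs.J_le) (gram hs.K_le)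
    _ = c ^ 2 * ε ^ 2 * 1 * N := by rw [h.N_eq]; ring
    _ ≤ c ^ 2 * ε ^ 2 * d * N := by
        have : 0 ≤ N := by linarith [h.one_le_d, h.two_mul_d_le_N]
        gcongr
        exact h.one_le_d
    _ = θ := h.θ_eq.symm

theorem norm_driftA_le (h : Regime m' n' c ε η σ₁ σd N L κ θ σ)
    (hs : WarmState c ε η σ₁ σd L θ σ t X Y) : ‖driftA X Y‖ ≤ 14 * √σ₁ * θ :=
  (norm_pertA_le (hs.norm_symA_le h) ((norm_le_frobNorm _).trans (hs.frobNorm_asymB_le h))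
    (by linarith [h.beta_le, Real.sqrt_nonneg σ₁]) (hs.norm_lower_gram_add_le h)).trans
    h.driftA_bound_le

theorem norm_pertR_le (h : Regime m' n' c ε η σ₁ σd N L κ θ σ)
    (hs : WarmState c ε η σ₁ σd L θ σ t X Y) :
    ‖pertR (residual σ X Y) (symA X Y) (driftA X Y) η‖ ≤ η * (80 * σ₁ * θ) :=
  (LowRankGD.norm_pertR_le h.η_pos.le (hs.norm_symA_le h) (hs.norm_residual_le h)
    (hs.norm_driftA_le h)).trans (mul_le_mul_of_nonneg_left h.pertR_bound_le h.η_pos.le)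

theorem smul_symA_gram_le (h : Regime m' n' c ε η σ₁ σd N L κ θ σ)
    (hs : WarmState c ε η σ₁ σd L θ σ t X Y) :
    η • (symA X Y * (symA X Y)ᵀ) ≤ (1 / 8 : ℝ) • 1 := by
  refine le_smul_one_of_norm_le (by simp) ((norm_smul_le_of_norm_le h.η_pos.le le_rfl).trans ?_)
  rw [norm_mul_transpose_self]
  calc η * ‖symA X Y‖ ^ 2 ≤ η * (2 * √σ₁) ^ 2 := by
        have := h.η_pos
        gcongr
        exact hs.norm_symA_le h
    _ = 4 * (η * σ₁) := by rw [mul_pow, h.sq_sqrt_σ₁]; ring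
    _ ≤ 1 / 8 := by linarith [h.η_mul_σ₁_le]

theorem smul_symA_gram_le_one (h : Regime m' n' c ε η σ₁ σd N L κ θ σ)
    (hs : WarmState c ε η σ₁ σd L θ σ t X Y) : η • (symA X Y * (symA X Y)ᵀ) ≤ 1 :=
  (hs.smul_symA_gram_le h).trans
    ((smul_le_smul_of_nonneg_right (by norm_num) zero_le_one).trans_eq (one_smul ℝ _))

theorem norm_upper_le (h : Regime m' n' c ε η σ₁ σd N L κ θ σ)
    (hs : WarmState c ε η σ₁ σd L θ σ t X Y) : ‖upper X‖ ≤ 3 * √σ₁ ∧ ‖upper Y‖ ≤ 3 * √σ₁ := by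
  have hA := hs.norm_symA_le h
  have hB := hs.norm_asymB_le h
  rw [upper_left_eq X Y, upper_right_eq X Y]
  exact ⟨(norm_add_le_of_le hA hB).trans_eq (by ring),
    (norm_sub_le_of_le hA hB).trans_eq (by ring)⟩

theorem norm_lower_step_le (h : Regime m' n' c ε η σ₁ σd N L κ θ σ)
    (hs : WarmState c ε η σ₁ σd L θ σ t X Y) (hst : IsStep σ η X X' Y Y') :
    ‖lower X'‖ ≤ c * ε * √(max (m' : ℝ) d) ∧ ‖lower Y'‖ ≤ c * ε * √(max (n' : ℝ) d) := by
  obtain ⟨hX, hY⟩ := hs.norm_upper_le h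
  have gram := (hs.norm_lower_gram_add_le h).trans
    (show θ ≤ σ₁ by linarith [h.θ_le, h.σd_le_σ₁, h.σd_pos])
  have hJ := norm_nonneg ((lower X)ᵀ * lower X)
  have hK := norm_nonneg ((lower Y)ᵀ * lower Y)
  exact ⟨hst.left.norm_lower_le h hY (by linarith) hs.J_le,
    hst.right.norm_lower_le h hX (by linarith) hs.K_le⟩

theorem frobNorm_asymB_step_le (h : Regime m' n' c ε η σ₁ σd N L κ θ σ)
    (hs : WarmState c ε η σ₁ σd L θ σ t X Y) (hst : IsStep σ η X X' Y Y') :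
    frobNorm (asymB X' Y') ≤
      c * d * ε * (1 + (t + 1 : ℕ) * (η * (σd / (17 * L)))) := by
  rw [hst.asymB_eq]
  have hB : ‖asymB X Y‖ ≤ 2 * √σ₁ := by linarith [hs.norm_asymB_le h, Real.sqrt_nonneg σ₁]
  have step := frobNorm_asymB_step h.η_pos.le (loss_nonneg h) (hs.norm_symA_le h) hB
    (hs.norm_residual_le h) hs.R_ge (hs.norm_lower_gram_add_le h)
  have growth := mul_le_mul_of_nonneg_left
    (h.asymB_growth_le (hs.loss_le h) (frobNorm_nonneg _) (hs.frobNorm_asymB_le h)) h.η_pos.le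
  refine (step.trans (add_le_add hs.B_le growth)).trans_eq ?_
  push_cast
  ring

theorem neg_le_residual_step (h : Regime m' n' c ε η σ₁ σd N L κ θ σ)
    (hs : WarmState c ε η σ₁ σd L θ σ t X Y) (hst : IsStep σ η X X' Y Y') :
    -(((t + 1 : ℕ) * (η * (80 * σ₁ * θ))) • 1) ≤ residual σ X' Y' := by
  rw [hst.residual_eq]
  convert residual_lower_step (loss_nonneg h) h.η_pos.le (mul_transpose_self_nonneg _)
    (hs.smul_symA_gram_le_one h) hs.R_ge (pertR_transpose _ _ _ (by simp))
    (hs.norm_pertR_le h) using 3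
  push_cast
  ring

theorem symA_perturbation_le (h : Regime m' n' c ε η σ₁ σd N L κ θ σ)
    (hs : WarmState c ε η σ₁ σd L θ σ t X Y) :
    η * ‖diagonal σ * (symA X Y * (symA X Y)ᵀ) * symA X Y‖ + ‖driftA X Y‖ ≤ 22 * √σ₁ * θ := by
  have hσ := norm_diagonal_le h.σ₁_pos.le (fun i => h.σd_pos.le.trans (h.σd_le i)) h.le_σ₁
  have hA := hs.norm_symA_le h
  have hAt := (norm_transpose (symA X Y)).trans_le hA
  have cubic : η * ‖diagonal σ * (symA X Y * (symA X Y)ᵀ) * symA X Y‖ ≤ 8 * √σ₁ * θ := by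
    calc _ ≤ η * (σ₁ * (2 * √σ₁ * (2 * √σ₁)) * (2 * √σ₁)) :=
          mul_le_mul_of_nonneg_left (norm_mul_le_of_norm_le
            (norm_mul_le_of_norm_le hσ (norm_mul_le_of_norm_le hA hAt)) hA) h.η_pos.le
      _ = 8 * √σ₁ * (η * (σ₁ * √σ₁ ^ 2)) := by ring
      _ = 8 * √σ₁ * (η * σ₁ ^ 2) := by rw [h.sq_sqrt_σ₁, ← sq]
      _ ≤ 8 * √σ₁ * θ := mul_le_mul_of_nonneg_left h.η_le (by positivity)
  linarith [hs.norm_driftA_le h]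

theorem boundedBelow_symA_step (h : Regime m' n' c ε η σ₁ σd N L κ θ σ)
    (hs : WarmState c ε η σ₁ σd L θ σ t X Y) (hs₀ : ε / (c * √d) ≤ √σd / 2)
    (hst : IsStep σ η X X' Y Y') :
    BoundedBelow (min (ε / (c * √d) * (1 + η * σd / 4) ^ (t + 1)) (√σd / 2)) (symA X' Y')ᵀ := by
  have hc := h.c_pos; have hε := h.ε_pos; have hη := h.η_pos
  have hq : 1 ≤ 1 + η * σd / 4 := by linarith [h.η_mul_σd_pos]
  set s := min (ε / (c * √d) * (1 + η * σd / 4) ^ t) (√σd / 2)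
  have hs₀s : ε / (c * √d) ≤ s :=
    le_min (le_mul_of_one_le_right (by positivity) (one_le_pow₀ hq)) hs₀
  have hs0 : 0 ≤ s := le_trans (by positivity) hs₀s
  have hsmall : 8 * η * s ^ 2 ≤ 1 := by
    calc 8 * η * s ^ 2 ≤ 8 * η * (√σd / 2) ^ 2 := by gcongr; exact min_le_right _ _
      _ = 2 * (η * σd) := by rw [div_pow, Real.sq_sqrt h.σd_pos.le]; ring
      _ ≤ 1 := by linarith [h.η_mul_σd_le]
  rw [hst.symA_eq]
  refine (hs.A_ge.step hη.le hs0 (smul_one_le_diagonal h.σd_le) (hs.smul_symA_gram_le h) hsmall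
    (hs.symA_perturbation_le h)).mono ?_
  exact (min_mul_pow_succ_le hq (by positivity) t).trans (h.growth_le hs₀s (min_le_right _ _))

theorem succ (h : Regime m' n' c ε η σ₁ σd N L κ θ σ) (hs : WarmState c ε η σ₁ σd L θ σ t X Y)
    (ht : ((t + 1 : ℕ) : ℝ) ≤ 17 * L / (η * σd)) (hs₀ : ε / (c * √d) ≤ √σd / 2)
    (hst : IsStep σ η X X' Y Y') : WarmState c ε η σ₁ σd L θ σ (t + 1) X' Y' where
  t_le := ht
  J_le := (hs.norm_lower_step_le h hst).1
  K_le := (hs.norm_lower_step_le h hst).2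
  B_le := hs.frobNorm_asymB_step_le h hst
  R_ge := hs.neg_le_residual_step h hst
  A_ge := hs.boundedBelow_symA_step h hs₀ hst

theorem zero (h : Regime m' n' c ε η σ₁ σd N L κ θ σ) (h0 : InitBound c ε X Y)
    (hs₀ : ε / (c * √d) ≤ √σd / 2) : WarmState c ε η σ₁ σd L θ σ 0 X Y where
  t_le := by
    have := h.L_pos; have := h.η_mul_σd_pos
    rw [Nat.cast_zero]
    positivity
  J_le := h0.J_le
  K_le := h0.K_le
  B_le := by simpa using h0.B_le
  R_ge := by
    have hA : ‖symA X Y‖ ≤ √σd / 2 := by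
      rw [← singVal_one_eq_norm]
      exact h0.A_le.trans h.init_le_half_sqrt
    have gram : symA X Y * (symA X Y)ᵀ ≤ σd • 1 := by
      refine le_smul_one_of_norm_le (by simp) ?_
      rw [norm_mul_transpose_self]
      calc ‖symA X Y‖ ^ 2 ≤ (√σd / 2) ^ 2 := by gcongr
        _ ≤ σd := by rw [div_pow, Real.sq_sqrt h.σd_pos.le]; linarith [h.σd_pos]
    simpa using gram.trans (smul_one_le_diagonal h.σd_le)
  A_ge := by
    rw [pow_zero, mul_one, min_eq_left hs₀]
    exact ((le_singVal_iff h.d_pos).1 h0.le_A).transpose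

end WarmState

theorem InitBound.le_half_sqrt {X : Matrix (Fin (d + m')) (Fin d) ℝ}
    {Y : Matrix (Fin (d + n')) (Fin d) ℝ} (h : Regime m' n' c ε η σ₁ σd N L κ θ σ)
    (h0 : InitBound c ε X Y) : ε / (c * √d) ≤ √σd / 2 :=
  calc ε / (c * √d) ≤ singVal d (symA X Y) := h0.le_A
    _ ≤ singVal 1 (symA X Y) := by rw [singVal_one_eq_norm]; exact singVal_le_norm _ _
    _ ≤ c * √d * ε := h0.A_le
    _ ≤ √σd / 2 := h.init_le_half_sqrt

variable {X : ℕ → Matrix (Fin (d + m')) (Fin d) ℝ} {Y : ℕ → Matrix (Fin (d + n')) (Fin d) ℝ}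

theorem warmState_of_le (h : Regime m' n' c ε η σ₁ σd N L κ θ σ)
    (hst : ∀ t, IsStep σ η (X t) (X (t + 1)) (Y t) (Y (t + 1)))
    (h0 : InitBound c ε (X 0) (Y 0)) (t : ℕ) (ht : (t : ℝ) ≤ 17 * L / (η * σd)) :
    WarmState c ε η σ₁ σd L θ σ t (X t) (Y t) := by
  induction t with
  | zero => exact .zero h h0 (h0.le_half_sqrt h)
  | succ t ih =>
    have ht' : (t : ℝ) ≤ 17 * L / (η * σd) := le_trans (by simp) ht
    exact (ih ht').succ h ht (h0.le_half_sqrt h) (hst t)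

theorem WarmState.smul_one_le_symA_gram {X : Matrix (Fin (d + m')) (Fin d) ℝ}
    {Y : Matrix (Fin (d + n')) (Fin d) ℝ} {t : ℕ} {s : ℝ} (hs0 : 0 ≤ s)
    (hs : WarmState c ε η σ₁ σd L θ σ t X Y)
    (hsle : s ≤ min (ε / (c * √d) * (1 + η * σd / 4) ^ t) (√σd / 2)) :
    s ^ 2 • 1 ≤ symA X Y * (symA X Y)ᵀ := by
  simpa using (boundedBelow_iff_le hs0).1 (hs.A_ge.mono hsle)

theorem norm_residual_add_le (h : Regime m' n' c ε η σ₁ σd N L κ θ σ)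
    (hst : ∀ t, IsStep σ η (X t) (X (t + 1)) (Y t) (Y (t + 1)))
    (h0 : InitBound c ε (X 0) (Y 0)) {T : ℕ} (hT : 8 * L / (η * σd) ≤ T) (s : ℕ)
    (hs : ((T + s : ℕ) : ℝ) ≤ 17 * L / (η * σd)) :
    ‖residual σ (X (T + s)) (Y (T + s))‖ ≤
      (1 - η * (σd / 4)) ^ s * σ₁ + 320 * σ₁ * θ / σd := by
  have hσd := h.σd_pos; have hθ := h.θ_pos; have hσ₁ := h.σ₁_pos; have hη := h.η_pos
  induction s with
  | zero =>
    have : 0 ≤ 320 * σ₁ * θ / σd := by positivity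
    simpa using ((warmState_of_le h hst h0 T hs).norm_residual_le h).trans (by linarith)
  | succ s ih =>
    have hs' : ((T + s : ℕ) : ℝ) ≤ 17 * L / (η * σd) := le_trans (by push_cast; linarith) hs
    have hw := warmState_of_le h hst h0 (T + s) hs'
    have large : (σd / 4) • 1 ≤ symA (X (T + s)) (Y (T + s)) * (symA (X (T + s)) (Y (T + s)))ᵀ := by
      have := hw.smul_one_le_symA_gram (s := √σd / 2) (by positivity)
        (le_min (h.half_sqrt_le_growth (hT.trans (by simp))) le_rfl)
      rwa [div_pow, Real.sq_sqrt hσd.le, show (2 : ℝ) ^ 2 = 4 by norm_num] at this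
    have step := residual_norm_step hη.le (by positivity) (by linarith [h.η_mul_σd_le]) large
      (hw.smul_symA_gram_le_one h) (ih hs') (hw.norm_pertR_le h)
    rw [← (hst (T + s)).residual_eq] at step
    refine step.trans_eq ?_
    field_simp
    ring

theorem le_singVal_symA {X : Matrix (Fin (d + m')) (Fin d) ℝ}
    {Y : Matrix (Fin (d + n')) (Fin d) ℝ} {x r : ℝ} (hd : 0 < d) (hσ : ∀ i, x ≤ σ i)
    (hR : ‖residual σ X Y‖ ≤ r) : √(x - r) ≤ singVal d (symA X Y) := by
  rcases le_total x r with hxr | hrx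
  · rw [Real.sqrt_eq_zero_of_nonpos (by linarith)]
    exact (le_singVal_iff hd).2 fun v => by simp
  have hA : √(x - r) ^ 2 • 1 ≤ symA X Y * (symA X Y)ᵀ := by
    rw [Real.sq_sqrt (by linarith), sub_smul, sub_le_comm]
    exact le_trans (sub_le_sub_right (smul_one_le_diagonal hσ) _)
      (le_smul_one_of_norm_le (by simp) hR)
  have := (boundedBelow_iff_le (M := (symA X Y)ᵀ) (Real.sqrt_nonneg (x - r))).2 (by simpa using hA)
  exact (le_singVal_iff hd).2 (by simpa using this.transpose)

/-- The conclusions of the theorem on the warm-up stage about a trajectory `X`, `Y` in the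
coordinates of the singular vectors. -/
def WarmUpConclusion (c ε σd : ℝ) (σ : Fin d → ℝ) (X : ℕ → Matrix (Fin (d + m')) (Fin d) ℝ)
    (Y : ℕ → Matrix (Fin (d + n')) (Fin d) ℝ) (T₀ : ℕ) : Prop :=
  (∀ t ≤ T₀,
    Loewner ((ε ^ 2 / (c ^ 2 * d)) • (1 : Matrix (Fin d) (Fin d) ℝ))
      (symA (X t) (Y t) * (symA (X t) (Y t)).transpose) ∧
    Loewner (symA (X t) (Y t) * (symA (X t) (Y t)).transpose) ((2 : ℝ) • Matrix.diagonal σ) ∧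
    frobNorm (asymB (X t) (Y t)) ≤ 2 * c * d * ε ∧
    opNorm (lower (X t)) ≤ c * ε * √(max (m' : ℝ) d) ∧
    opNorm (lower (Y t)) ≤ c * ε * √(max (n' : ℝ) d)) ∧
  √(σd / 2) ≤ singVal d (symA (X T₀) (Y T₀)) ∧
  singVal 1 (errP σ (X T₀) (Y T₀)) ≤ σd / 4

theorem WarmState.symA_gram_le {X : Matrix (Fin (d + m')) (Fin d) ℝ}
    {Y : Matrix (Fin (d + n')) (Fin d) ℝ} {t : ℕ} (h : Regime m' n' c ε η σ₁ σd N L κ θ σ)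
    (hs : WarmState c ε η σ₁ σd L θ σ t X Y) :
    symA X Y * (symA X Y)ᵀ ≤ (2 : ℝ) • diagonal σ := by
  have loss : (t * (η * (80 * σ₁ * θ))) • (1 : Matrix (Fin d) (Fin d) ℝ) ≤ σd • 1 :=
    smul_le_smul_of_nonneg_right (by linarith [hs.loss_le h, h.loss_le, h.σd_pos]) zero_le_one
  have hR : -diagonal σ ≤ residual σ X Y :=
    (neg_le_neg (loss.trans (smul_one_le_diagonal h.σd_le))).trans hs.R_ge
  rw [two_smul]
  simpa [residual] using sub_le_sub_left hR (diagonal σ)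

theorem WarmState.smul_one_le_symA_gram_of_init {X : Matrix (Fin (d + m')) (Fin d) ℝ}
    {Y : Matrix (Fin (d + n')) (Fin d) ℝ} {t : ℕ} (h : Regime m' n' c ε η σ₁ σd N L κ θ σ)
    (hs : WarmState c ε η σ₁ σd L θ σ t X Y) (hs₀ : ε / (c * √d) ≤ √σd / 2) :
    (ε ^ 2 / (c ^ 2 * d)) • 1 ≤ symA X Y * (symA X Y)ᵀ := by
  have hc := h.c_pos; have hε := h.ε_pos
  have hsq : (ε / (c * √d)) ^ 2 = ε ^ 2 / (c ^ 2 * d) := by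
    rw [div_pow, mul_pow, Real.sq_sqrt d.cast_nonneg]
  rw [← hsq]
  refine hs.smul_one_le_symA_gram (by positivity) (le_min ?_ hs₀)
  exact le_mul_of_one_le_right (by positivity) (one_le_pow₀ (by linarith [h.η_mul_σd_pos]))

theorem norm_errP_le {X : Matrix (Fin (d + m')) (Fin d) ℝ}
    {Y : Matrix (Fin (d + n')) (Fin d) ℝ} :
    ‖errP σ X Y‖ ≤ ‖residual σ X Y‖ + frobNorm (asymB X Y) ^ 2 := by
  refine (norm_add_le _ _).trans (add_le_add_right ?_ _)
  rw [norm_mul_transpose_self]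
  exact pow_le_pow_left₀ (norm_nonneg _) (norm_le_frobNorm _) 2

theorem warmUpConclusion_of_initBound (h : Regime m' n' c ε η σ₁ σd N L κ θ σ)
    (hst : ∀ t, IsStep σ η (X t) (X (t + 1)) (Y t) (Y (t + 1)))
    (h0 : InitBound c ε (X 0) (Y 0)) {T : ℕ} (hT : 8 * L / (η * σd) ≤ T)
    (hT2 : ((2 * T : ℕ) : ℝ) ≤ 17 * L / (η * σd)) : WarmUpConclusion c ε σd σ X Y (2 * T) := by
  have hσd := h.σd_pos
  have hR : ‖residual σ (X (2 * T)) (Y (2 * T))‖ ≤ σd / 16 := by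
    rw [two_mul] at hT2 ⊢
    linarith [norm_residual_add_le h hst h0 hT T hT2, h.one_sub_pow_mul_σ₁_le hT,
      h.residual_floor_le]
  refine ⟨fun t ht => ?_, ?_, ?_⟩
  · have hw := warmState_of_le h hst h0 t (le_trans (by exact_mod_cast ht) hT2)
    exact ⟨hw.smul_one_le_symA_gram_of_init h (h0.le_half_sqrt h), hw.symA_gram_le h,
      hw.frobNorm_asymB_le h, hw.J_le, hw.K_le⟩
  · exact (Real.sqrt_le_sqrt (by linarith)).trans (le_singVal_symA h.d_pos h.σd_le hR)
  · have hB := (warmState_of_le h hst h0 (2 * T) hT2).frobNorm_asymB_le h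
    rw [singVal_one_eq_norm]
    linarith [norm_errP_le (σ := σ) (X := X (2 * T)) (Y := Y (2 * T)),
      pow_le_pow_left₀ (frobNorm_nonneg _) hB 2, h.sq_beta_le, h.θ_le]

end WarmUp

section Parameters

theorem log_one_div_le {y : ℝ} (hy : 0 < y) : Real.log (1 / y) ≤ 2 * (1 / √y) := by
  have hsq : 1 / y = (1 / √y) ^ 2 := by rw [div_pow, Real.sq_sqrt hy.le, one_pow]
  have := Real.log_le_sub_one_of_pos (show 0 < 1 / √y by positivity)
  rw [hsq, Real.log_pow, Nat.cast_ofNat]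
  linarith

theorem log_mul_le_of_le_pow {y M u E : ℝ} (hy : 0 < y) (hM : 1 ≤ M) (hu : 0 ≤ u) (hu1 : u ≤ 1)
    (hyu : y * (1 + Real.log M) ≤ u ^ 2) (hE : 0 < E) (hEM : E ≤ M ^ 6 * (1 / y) ^ 2) :
    Real.log E * y ≤ 10 * u := by
  have hyM : 0 ≤ y * Real.log M := mul_nonneg hy.le (Real.log_nonneg hM)
  have hsy : √y ≤ u := (Real.sqrt_le_sqrt (by linarith)).trans_eq (Real.sqrt_sq hu)
  have hlog : Real.log E ≤ 6 * Real.log M + 4 * (1 / √y) := by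
    calc Real.log E ≤ Real.log (M ^ 6 * (1 / y) ^ 2) := Real.log_le_log hE hEM
      _ = 6 * Real.log M + 2 * Real.log (1 / y) := by
          rw [Real.log_mul (by positivity) (by positivity), Real.log_pow, Real.log_pow]
          norm_num
      _ ≤ 6 * Real.log M + 4 * (1 / √y) := by linarith [log_one_div_le hy]
  calc Real.log E * y ≤ (6 * Real.log M + 4 * (1 / √y)) * y :=
        mul_le_mul_of_nonneg_right hlog hy.le
    _ = 6 * (y * Real.log M) + 4 * √y := by
        have : 1 / √y * y = √y := by rw [one_div_mul_eq_div, Real.div_sqrt]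
        rw [add_mul, mul_assoc 4, this]
        ring
    _ ≤ 6 * u + 4 * u := by
        have : u ^ 2 ≤ u := pow_le_of_le_one hu hu1 two_ne_zero
        linarith
    _ = 10 * u := by ring

/-- The ratio of the scale `ε` of the initialization to `σd / (√(d³ σ₁) N)`, the largest scale
that the theorem admits up to constants and logarithmic factors. -/
def relScale (d : ℕ) (σ₁ σd N ε : ℝ) : ℝ := ε * (d * √d * √σ₁ * N) / σd

variable {d : ℕ} {ε σ₁ σd N : ℝ}

theorem relScale_pos (hd : 0 < d) (hσ₁ : 0 < σ₁) (hσd : 0 < σd) (hN : 0 < N) (hε : 0 < ε) :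
    0 < relScale d σ₁ σd N ε := by
  have : (0 : ℝ) < d := Nat.cast_pos.2 hd
  rw [relScale]
  positivity

theorem relScale_mul_le {x Λ : ℝ} (hd : 0 < d) (hσ₁ : 0 < σ₁) (hσd : 0 < σd) (hN : 0 < N)
    (hΛ : 0 < Λ) (hε : ε ≤ x * (σd / (√((d : ℝ) ^ 3 * σ₁) * N)) / Λ) :
    relScale d σ₁ σd N ε * Λ ≤ x := by
  have : (0 : ℝ) < d := Nat.cast_pos.2 hd
  have hsqrt : √((d : ℝ) ^ 3 * σ₁) = d * √d * √σ₁ := by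
    rw [Real.sqrt_mul (by positivity), pow_succ, Real.sqrt_mul (by positivity),
      Real.sqrt_sq (by positivity)]
  rw [hsqrt, le_div_iff₀ hΛ, ← mul_div_assoc, le_div_iff₀ (by positivity)] at hε
  rw [relScale, div_mul_eq_mul_div, div_le_iff₀ hσd]
  linarith

theorem ratio_eq (hd : 0 < d) (hσ₁ : 0 < σ₁) (hσd : 0 < σd) (hN : 0 < N) (hε : 0 < ε) :
    d * σd / ε ^ 2 = d ^ 4 * (σ₁ / σd) * N ^ 2 * (1 / relScale d σ₁ σd N ε) ^ 2 := by
  have : (0 : ℝ) < d := Nat.cast_pos.2 hd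
  have hsq : relScale d σ₁ σd N ε ^ 2 = ε ^ 2 * (d ^ 3 * σ₁ * N ^ 2) / σd ^ 2 := by
    rw [relScale, div_pow, mul_pow, mul_pow, mul_pow, mul_pow, Real.sq_sqrt d.cast_nonneg,
      Real.sq_sqrt hσ₁.le]
    ring
  rw [div_pow, hsq]
  field_simp

theorem ratio_le (hd : 0 < d) (hσd : 0 < σd) (hσ : σd ≤ σ₁) (hN : (d : ℝ) ≤ N) (hε : 0 < ε) :
    d * σd / ε ^ 2 ≤ (N * (σ₁ / σd)) ^ 6 * (1 / relScale d σ₁ σd N ε) ^ 2 := by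
  have hN0 : 0 < N := (Nat.cast_pos.2 hd).trans_le hN
  have hκ : 1 ≤ σ₁ / σd := (one_le_div hσd).2 hσ
  rw [ratio_eq hd (hσd.trans_le hσ) hσd hN0 hε]
  refine mul_le_mul_of_nonneg_right ?_ (by positivity)
  calc (d : ℝ) ^ 4 * (σ₁ / σd) * N ^ 2 ≤ N ^ 4 * (σ₁ / σd) ^ 6 * N ^ 2 := by
        gcongr
        exact le_self_pow₀ hκ (by norm_num)
    _ = (N * (σ₁ / σd)) ^ 6 := by ring

theorem four_le_log_ratio (hd : 0 < d) (hσd : 0 < σd) (hσ : σd ≤ σ₁) (hN : (d : ℝ) ≤ N)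
    (hε : 0 < ε) (hy : relScale d σ₁ σd N ε ≤ 1 / 10) : 4 ≤ Real.log (d * σd / ε ^ 2) := by
  have hd1 : (1 : ℝ) ≤ d := Nat.one_le_cast.2 hd
  have hN0 : 0 < N := by linarith
  have hy0 := relScale_pos hd (hσd.trans_le hσ) hσd hN0 hε
  rw [Real.le_log_iff_exp_le (by positivity), ratio_eq hd (hσd.trans_le hσ) hσd hN0 hε]
  have hexp : Real.exp 4 ≤ (10 : ℝ) ^ 2 := by
    calc Real.exp 4 = Real.exp 1 ^ 4 := by rw [← Real.exp_nat_mul]; norm_num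
      _ ≤ (2.8 : ℝ) ^ 4 := by
          gcongr
          linarith [Real.exp_one_lt_d9]
      _ ≤ 10 ^ 2 := by norm_num
  have hprefix : 1 ≤ (d : ℝ) ^ 4 * (σ₁ / σd) * N ^ 2 :=
    one_le_mul_of_one_le_of_one_le (one_le_mul_of_one_le_of_one_le (one_le_pow₀ hd1)
      ((one_le_div hσd).2 hσ)) (one_le_pow₀ (hd1.trans hN))
  calc Real.exp 4 ≤ 10 ^ 2 := hexp
    _ ≤ (1 / relScale d σ₁ σd N ε) ^ 2 := by
        gcongr
        rwa [le_one_div (by norm_num) hy0]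
    _ ≤ _ := le_mul_of_one_le_left (by positivity) hprefix

theorem mul_sq_le_of_step_le {c η : ℝ} (hd : 0 < d) (hσd : 0 < σd) (hσ : σd ≤ σ₁) (hN : 1 ≤ N)
    (hη : η ≤ c ^ 2 * (σd * ε ^ 2 / (d * σ₁ ^ 3))) : η * σ₁ ^ 2 ≤ c ^ 2 * ε ^ 2 * d * N := by
  have hσ₁ : 0 < σ₁ := hσd.trans_le hσ
  have hd1 : (1 : ℝ) ≤ d := Nat.one_le_cast.2 hd
  have hratio : σd / (d * σ₁) ≤ 1 := by
    rw [div_le_one (by positivity)]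
    exact hσ.trans (le_mul_of_one_le_left hσ₁.le hd1)
  calc η * σ₁ ^ 2 ≤ c ^ 2 * (σd * ε ^ 2 / (d * σ₁ ^ 3)) * σ₁ ^ 2 := by gcongr
    _ = c ^ 2 * ε ^ 2 * (σd / (d * σ₁)) := by field_simp
    _ ≤ c ^ 2 * ε ^ 2 * (d * N) := by
        gcongr
        exact hratio.trans (one_le_mul_of_one_le_of_one_le hd1 hN)
    _ = c ^ 2 * ε ^ 2 * d * N := by ring

theorem regime_of_le {m' n' : ℕ} {c η κ u : ℝ} {σ : Fin d → ℝ} (hd : 0 < d) (hc : 0 < c)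
    (hε : 0 < ε) (hη : 0 < η) (hσd : 0 < σd) (hlow : ∀ i, σd ≤ σ i) (hupp : ∀ i, σ i ≤ σ₁)
    (hN : N = (d + m') + (d + n')) (hκ : 0 < κ) (hκ1 : κ ≤ 1 / 1000)
    (hκ2 : 200 * κ * c ^ 2 ≤ 1) (hκ3 : κ ≤ c) (hu0 : 0 < u) (hu1 : u ≤ 1 / 10)
    (hu2 : 10 * u * c ≤ κ)
    (hεle : ε ≤ u ^ 2 * (σd / (√((d : ℝ) ^ 3 * σ₁) * N)) / (1 + Real.log (N * (σ₁ / σd))))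
    (hηle : η ≤ c ^ 2 * (σd * ε ^ 2 / (d * σ₁ ^ 3))) :
    Regime m' n' c ε η σ₁ σd N (Real.log (d * σd / ε ^ 2)) κ (c ^ 2 * ε ^ 2 * d * N) σ := by
  have hd1 : (1 : ℝ) ≤ d := Nat.one_le_cast.2 hd
  have hσ : σd ≤ σ₁ := (hlow ⟨0, hd⟩).trans (hupp _)
  have hσ₁ : 0 < σ₁ := hσd.trans_le hσ
  have hdN : (d : ℝ) ≤ N := by
    linarith [m'.cast_nonneg (α := ℝ), n'.cast_nonneg (α := ℝ)]
  have hN0 : 0 < N := by linarith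
  have hM : 1 ≤ N * (σ₁ / σd) :=
    one_le_mul_of_one_le_of_one_le (hd1.trans hdN) ((one_le_div hσd).2 hσ)
  have hlogM := Real.log_nonneg hM
  have hy0 := relScale_pos hd hσ₁ hσd hN0 hε
  have hyM := relScale_mul_le hd hσ₁ hσd hN0 (by linarith) hεle
  have hy : relScale d σ₁ σd N ε ≤ 1 / 10 := by
    have : u ^ 2 ≤ u := pow_le_of_le_one hu0.le (by linarith) two_ne_zero
    linarith [mul_nonneg hy0.le hlogM]
  have hE : 0 < d * σd / ε ^ 2 := by positivity
  refine ⟨hd, hc, hε, hη, hσd, hlow, hupp, hN, rfl, Real.exp_log hE,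
    four_le_log_ratio hd hσd hσ hdN hε hy, hκ, hκ1, hκ2, hκ3, ?_,
    mul_sq_le_of_step_le hd hσd hσ (hd1.trans hdN) hηle⟩
  calc _ = Real.log (d * σd / ε ^ 2) * relScale d σ₁ σd N ε * (c * σd) := by
        rw [relScale]
        field_simp
    _ ≤ 10 * u * (c * σd) :=
        mul_le_mul_of_nonneg_right (log_mul_le_of_le_pow hy0 hM hu0.le (by linarith) hyM hE
          (ratio_le hd hσd hσ hdN hε)) (by positivity)
    _ = 10 * u * c * σd := by ring
    _ ≤ κ * σd := by gcongr

theorem exists_regime_constants {c : ℝ} (hc : 0 < c) : ∃ κ u : ℝ, 0 < κ ∧ κ ≤ 1 / 1000 ∧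
    200 * κ * c ^ 2 ≤ 1 ∧ κ ≤ c ∧ 0 < u ∧ u ≤ 1 / 10 ∧ 10 * u * c ≤ κ := by
  set κ := min (1 / 1000) (min (1 / (200 * c ^ 2)) c)
  have hκ : κ ≤ 1 / (200 * c ^ 2) := (min_le_right _ _).trans (min_le_left _ _)
  have hκ0 : 0 < κ := by positivity
  have hu := min_le_right (1 / 10) (κ / (10 * c))
  rw [le_div_iff₀ (by positivity)] at hκ hu
  exact ⟨κ, min (1 / 10) (κ / (10 * c)), hκ0, min_le_left _ _, by linarith,
    (min_le_right _ _).trans (min_le_right _ _), by positivity, min_le_left _ _, by linarith⟩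

end Parameters

section WarmUpTheorem

variable {d m' n' : ℕ} {S : Matrix (Fin (d + m')) (Fin (d + n')) ℝ} {σ : Fin d → ℝ}
  {Φ : Matrix (Fin (d + m')) (Fin (d + m')) ℝ} {Ψ : Matrix (Fin (d + n')) (Fin (d + n')) ℝ}

theorem IsSVD.last_le (h : IsSVD S σ Φ Ψ) (hd : 0 < d) (i : Fin d) :
    σ ⟨d - 1, Nat.sub_lt hd one_pos⟩ ≤ σ i :=
  h.antitone (Fin.le_def.2 (Nat.le_sub_one_of_lt i.isLt))

theorem IsSVD.le_first (h : IsSVD S σ Φ Ψ) (hd : 0 < d) (i : Fin d) : σ i ≤ σ ⟨0, hd⟩ :=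
  h.antitone (Fin.le_def.2 (Nat.zero_le _))

theorem exists_warmUpConclusion {c ε η σ₁ σd N κ θ : ℝ}
    (h : Regime m' n' c ε η σ₁ σd N (Real.log (d * σd / ε ^ 2)) κ θ σ) (hsvd : IsSVD S σ Φ Ψ) :
    ∃ T₀ : ℕ, (T₀ : ℝ) ≤ 17 * (1 / (η * σd) * Real.log (d * σd / ε ^ 2)) ∧
      ∀ (U₀ : Matrix (Fin (d + m')) (Fin d) ℝ) (V₀ : Matrix (Fin (d + n')) (Fin d) ℝ)
        (X : ℕ → Matrix (Fin (d + m')) (Fin d) ℝ) (Y : ℕ → Matrix (Fin (d + n')) (Fin d) ℝ),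
        (∀ t, X t = Φᵀ * (gd S η U₀ V₀ t).1) → (∀ t, Y t = Ψᵀ * (gd S η U₀ V₀ t).2) →
        InitBound c ε (X 0) (Y 0) → WarmUpConclusion c ε σd σ X Y T₀ :=
  ⟨_, h.two_mul_ceil_le.trans_eq (by ring), fun _ _ _ _ hX hY h0 =>
    warmUpConclusion_of_initBound h (isStep_of_gd hsvd hX hY) h0 (Nat.le_ceil _)
      h.two_mul_ceil_le⟩

theorem exists_warmUp_constants {c : ℝ} (hc : 0 < c) : ∃ k₁ k₂ C : ℝ, 0 < k₁ ∧ 0 < k₂ ∧ 0 < C ∧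
    ∀ (d m' n' : ℕ) (hd : 0 < d) (S : Matrix (Fin (d + m')) (Fin (d + n')) ℝ) (σ : Fin d → ℝ)
      (Φ : Matrix (Fin (d + m')) (Fin (d + m')) ℝ) (Ψ : Matrix (Fin (d + n')) (Fin (d + n')) ℝ)
      (_ : IsSVD S σ Φ Ψ) (m n σ₁ σd ε η : ℝ) (_ : m = d + m') (_ : n = d + n')
      (_ : σ₁ = σ ⟨0, hd⟩) (_ : σd = σ ⟨d - 1, Nat.sub_lt hd one_pos⟩) (_ : 0 < ε)
      (_ : ε ≤ k₁ * (σd / (√((d : ℝ) ^ 3 * σ₁) * (m + n))) /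
        (1 + Real.log ((m + n) * (σ₁ / σd))))
      (_ : 0 < η) (_ : η ≤ k₂ * (σd * ε ^ 2 / (d * σ₁ ^ 3))),
      ∃ T₀ : ℕ, (T₀ : ℝ) ≤ C * (1 / (η * σd) * Real.log (d * σd / ε ^ 2)) ∧
        ∀ (U₀ : Matrix (Fin (d + m')) (Fin d) ℝ) (V₀ : Matrix (Fin (d + n')) (Fin d) ℝ)
          (X : ℕ → Matrix (Fin (d + m')) (Fin d) ℝ) (Y : ℕ → Matrix (Fin (d + n')) (Fin d) ℝ),
          (∀ t, X t = Φᵀ * (gd S η U₀ V₀ t).1) → (∀ t, Y t = Ψᵀ * (gd S η U₀ V₀ t).2) →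
          InitBound c ε (X 0) (Y 0) → WarmUpConclusion c ε σd σ X Y T₀ := by
  obtain ⟨κ, u, hκ, hκ1, hκ2, hκ3, hu, hu1, hu2⟩ := exists_regime_constants hc
  refine ⟨u ^ 2, c ^ 2, 17, by positivity, by positivity, by norm_num, ?_⟩
  rintro d m' n' hd S σ Φ Ψ hsvd _ _ _ _ ε η rfl rfl rfl rfl hε hεle hη hηle
  exact exists_warmUpConclusion (regime_of_le hd hc hε hη (hsvd.pos _) (hsvd.last_le hd)
    (hsvd.le_first hd) rfl hκ hκ1 hκ2 hκ3 hu hu1 hu2 hεle hηle) hsvd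

end WarmUpTheorem

section GaussianMeasures

variable {k m n : Type*} [Fintype k] [Fintype m] [Fintype n]

/-- The standard Gaussian measure on coordinate vectors; it lives on functions rather than on
`EuclideanSpace ℝ n` because the initialization is a measure on tuples of reals. -/
def gaussianVec (n : Type*) [Fintype n] : Measure (n → ℝ) := Measure.pi fun _ => gaussianReal 0 1

/-- The law of a matrix with independent standard Gaussian entries, listed row by row. -/
def gaussianMat (m n : Type*) [Fintype m] [Fintype n] : Measure (m → n → ℝ) :=
  Measure.pi fun _ => gaussianVec n

instance : IsProbabilityMeasure (gaussianVec n) := by unfold gaussianVec; infer_instance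

instance : IsProbabilityMeasure (gaussianMat m n) := by unfold gaussianMat; infer_instance

theorem measure_preimage_le_of_measurePreserving {α β : Type*} [MeasurableSpace α]
    [MeasurableSpace β] {μ : Measure α} {ν : Measure β} {f : α → β} (hf : MeasurePreserving f μ ν)
    (s : Set β) : μ (f ⁻¹' s) ≤ ν s :=
  (Measure.le_map_apply hf.aemeasurable s).trans_eq (by rw [hf.map_eq])

theorem measurePreserving_pi_comp {α : Type*} [MeasurableSpace α] (μ : Measure α)
    [IsProbabilityMeasure μ] {f : n → m} (hf : Function.Injective f) :
    MeasurePreserving (fun (w : m → α) j => w (f j)) (Measure.pi fun _ => μ)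
      (Measure.pi fun _ => μ) := by
  have hindep := iIndepFun_pi (μ := fun _ : m => μ) (X := fun _ => id) fun _ => aemeasurable_id
  refine ⟨by fun_prop, ?_⟩
  rw [(hindep.precomp hf).map_fun_eq_pi_map fun j => (measurable_pi_apply (f j)).aemeasurable]
  exact congrArg Measure.pi (funext fun j => (measurePreserving_eval (fun _ : m => μ) (f j)).map_eq)

theorem measurePreserving_gaussianMat_comp {f : k → m} (hf : Function.Injective f) :
    MeasurePreserving (fun (w : m → n → ℝ) i => w (f i)) (gaussianMat m n) (gaussianMat k n) :=
  measurePreserving_pi_comp _ hf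

theorem measurePreserving_uncurry :
    MeasurePreserving (fun (w : m → n → ℝ) (p : m × n) => w p.1 p.2) (gaussianMat m n)
      (gaussianVec (m × n)) := by
  have h := Measure.infinitePi_map_curry_symm fun (_ : m) (_ : n) => gaussianReal (0 : ℝ) 1
  simp only [Measure.infinitePi_eq_pi] at h
  exact ⟨by fun_prop, h⟩

theorem measurePreserving_curry :
    MeasurePreserving (fun (w : m × n → ℝ) i j => w (i, j)) (gaussianVec (m × n))
      (gaussianMat m n) := by
  have h := Measure.infinitePi_map_curry fun (_ : m) (_ : n) => gaussianReal (0 : ℝ) 1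
  simp only [Measure.infinitePi_eq_pi] at h
  exact ⟨by fun_prop, h⟩

theorem measurePreserving_swap :
    MeasurePreserving (fun (w : m → n → ℝ) j i => w i j) (gaussianMat m n) (gaussianMat n m) :=
  measurePreserving_curry.comp
    ((measurePreserving_pi_comp _ Prod.swap_injective).comp measurePreserving_uncurry)

theorem measurePreserving_toLp :
    MeasurePreserving (WithLp.toLp 2) (gaussianVec n) (stdGaussian (EuclideanSpace ℝ n)) :=
  ⟨by fun_prop, map_pi_eq_stdGaussian⟩

theorem measurePreserving_dotProduct {h : n → ℝ} (hh : ‖h‖₂ = 1) :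
    MeasurePreserving (fun x => x ⬝ᵥ h) (gaussianVec n) (gaussianReal 0 1) := by
  have hinner : MeasurePreserving (innerSL ℝ (WithLp.toLp 2 h))
      (stdGaussian (EuclideanSpace ℝ n)) (gaussianReal 0 1) := by
    refine ⟨by fun_prop, ?_⟩
    rw [IsGaussian.map_eq_gaussianReal, integral_strongDual_stdGaussian, variance_dual_stdGaussian,
      innerSL_apply_norm]
    simp [hh]
  convert hinner.comp measurePreserving_toLp using 1
  funext x
  simp [EuclideanSpace.inner_toLp_toLp]

theorem measurePreserving_orthogonal_mulVec [DecidableEq n] {O : Matrix n n ℝ}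
    (hO : O ∈ orthogonalGroup n ℝ) :
    MeasurePreserving (fun x => O *ᵥ x) (gaussianVec n) (gaussianVec n) := by
  have hnorm : ∀ v, ‖O *ᵥ v‖₂ = ‖v‖₂ := fun v => by
    refine (pow_left_inj₀ (norm_nonneg _) (norm_nonneg _) two_ne_zero).1 ?_
    rw [norm_toLp_sq, norm_toLp_sq, dotProduct_mulVec, ← mulVec_transpose, mulVec_mulVec,
      (mem_orthogonalGroup_iff' n ℝ).1 hO, one_mulVec]
  let e := (⟨toEuclideanLin O, fun x => hnorm x.ofLp⟩ :
    EuclideanSpace ℝ n →ₗᵢ[ℝ] EuclideanSpace ℝ n).toLinearIsometryEquiv rfl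
  have he : MeasurePreserving e (stdGaussian (EuclideanSpace ℝ n))
      (stdGaussian (EuclideanSpace ℝ n)) := ⟨by fun_prop, stdGaussian_map e⟩
  exact (measurePreserving_toLp.symm (MeasurableEquiv.toLp 2 (n → ℝ))).comp
    (he.comp measurePreserving_toLp)

theorem measurePreserving_orthogonal_mul [DecidableEq m] {O : Matrix m m ℝ}
    (hO : O ∈ orthogonalGroup m ℝ) :
    MeasurePreserving (fun w : m → n → ℝ => of.symm (O * of w)) (gaussianMat m n)
      (gaussianMat m n) := by
  have hcols : MeasurePreserving (fun (w : n → m → ℝ) j => O *ᵥ w j) (gaussianMat n m)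
      (gaussianMat n m) := measurePreserving_pi _ _ fun _ => measurePreserving_orthogonal_mulVec hO
  exact measurePreserving_swap.comp (hcols.comp measurePreserving_swap)

theorem measurePreserving_inv_smul {ε : ℝ} (hε : ε ≠ 0) :
    MeasurePreserving (fun w : m → n → ℝ => ε⁻¹ • w)
      (Measure.pi fun _ => Measure.pi fun _ => gaussianReal 0 (Real.toNNReal (ε ^ 2)))
      (gaussianMat m n) := by
  have hreal : MeasurePreserving (fun x => ε⁻¹ * x) (gaussianReal 0 (Real.toNNReal (ε ^ 2)))
      (gaussianReal 0 1) := by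
    refine ⟨by fun_prop, ?_⟩
    rw [gaussianReal_map_const_mul, mul_zero]
    congr 1
    rw [← NNReal.coe_inj, NNReal.coe_mul, Real.coe_toNNReal _ (sq_nonneg ε), NNReal.coe_one,
      NNReal.coe_mk, inv_pow, inv_mul_cancel₀ (pow_ne_zero 2 hε)]
  exact measurePreserving_pi _ _ fun _ => measurePreserving_pi _ _ fun _ => hreal

end GaussianMeasures

section OneDimensional

theorem gaussianReal_le_volume (s : Set ℝ) :
    gaussianReal 0 1 s ≤ ENNReal.ofReal (1 / 2) * volume s := by
  have hpdf : ∀ x, gaussianPDFReal 0 1 x ≤ 1 / 2 := fun x => by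
    rw [gaussianPDFReal_def, ← mul_one (1 / 2 : ℝ)]
    refine mul_le_mul ?_ (Real.exp_le_one_iff.2 ?_) (Real.exp_pos _).le (by norm_num)
    · rw [← one_div, NNReal.coe_one]
      refine one_div_le_one_div_of_le two_pos (Real.le_sqrt_of_sq_le ?_)
      linarith [Real.pi_gt_three]
    · exact div_nonpos_of_nonpos_of_nonneg (neg_nonpos.2 (sq_nonneg _)) (by positivity)
  rw [gaussianReal_apply 0 one_ne_zero]
  exact (lintegral_mono fun x => ENNReal.ofReal_le_ofReal (hpdf x)).trans_eq (by simp)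

theorem gaussianReal_abs_add_lt_le (b s : ℝ) :
    gaussianReal 0 1 {x | |x + b| < s} ≤ ENNReal.ofReal s := by
  have hball : {x : ℝ | |x + b| < s} = Metric.ball (-b) s := by
    ext x
    simp [Real.dist_eq]
  refine (gaussianReal_le_volume _).trans ?_
  rw [hball, Real.volume_ball, ← ENNReal.ofReal_mul (by norm_num)]
  exact ENNReal.ofReal_le_ofReal (by linarith)

theorem half_le_gaussianReal_half_lt_abs :
    ENNReal.ofReal (1 / 2) ≤ gaussianReal 0 1 {x | 1 / 2 < |x|} := by
  have hball : gaussianReal 0 1 (Metric.closedBall (0 : ℝ) (1 / 2)) ≤ ENNReal.ofReal (1 / 2) := by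
    refine (gaussianReal_le_volume _).trans ?_
    rw [Real.volume_closedBall, ← ENNReal.ofReal_mul (by norm_num)]
    norm_num
  have hcompl : {x : ℝ | 1 / 2 < |x|} = (Metric.closedBall (0 : ℝ) (1 / 2))ᶜ := by
    ext x
    simp
  rw [hcompl, prob_compl_eq_one_sub Metric.isClosed_closedBall.measurableSet]
  refine le_trans ?_ (tsub_le_tsub_left hball 1)
  rw [← ENNReal.ofReal_one, ← ENNReal.ofReal_sub _ (by norm_num)]
  exact ENNReal.ofReal_le_ofReal (by norm_num)

theorem gaussianPDFReal_one_mul_exp_le (x : ℝ) :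
    gaussianPDFReal 0 1 x * Real.exp (x ^ 2 / 4) ≤ 2 * gaussianPDFReal 0 2 x := by
  have hexp : Real.exp (-(x - 0) ^ 2 / (2 * ((1 : NNReal) : ℝ))) * Real.exp (x ^ 2 / 4) =
      Real.exp (-(x - 0) ^ 2 / (2 * ((2 : NNReal) : ℝ))) := by
    rw [← Real.exp_add]
    congr 1
    push_cast
    ring
  rw [gaussianPDFReal_def, gaussianPDFReal_def]
  dsimp only
  rw [mul_assoc, hexp, ← mul_assoc]
  refine mul_le_mul_of_nonneg_right ?_ (Real.exp_pos _).le
  rw [← div_eq_mul_inv, ← one_div, div_le_div_iff₀ (by positivity) (by positivity), one_mul]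
  refine Real.sqrt_le_iff.2 ⟨by positivity, ?_⟩
  rw [mul_pow, Real.sq_sqrt (by positivity)]
  push_cast
  linarith [Real.pi_pos]

theorem lintegral_exp_sq_gaussianReal_le :
    ∫⁻ x, ENNReal.ofReal (Real.exp (x ^ 2 / 4)) ∂(gaussianReal 0 1) ≤ 2 := by
  rw [gaussianReal_of_var_ne_zero 0 one_ne_zero,
    lintegral_withDensity_eq_lintegral_mul _ (measurable_gaussianPDF 0 1) (by fun_prop)]
  calc _ ≤ ∫⁻ x, 2 * gaussianPDF 0 2 x := lintegral_mono fun x => by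
        rw [Pi.mul_apply, gaussianPDF, gaussianPDF,
          ← ENNReal.ofReal_mul (gaussianPDFReal_nonneg _ _ _), ← ENNReal.ofReal_ofNat 2,
          ← ENNReal.ofReal_mul zero_le_two]
        exact ENNReal.ofReal_le_ofReal (gaussianPDFReal_one_mul_exp_le x)
    _ = 2 := by
      rw [lintegral_const_mul _ (measurable_gaussianPDF 0 2), lintegral_gaussianPDF_eq_one 0
        two_ne_zero, mul_one]

end OneDimensional

section Net

open Metric Module

variable {E F : Type*} [NormedAddCommGroup E] [NormedSpace ℝ E]

theorem packingNumber_sphere_le [FiniteDimensional ℝ E] :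
    packingNumber (1 / 2) (sphere (0 : E) 1) ≤ (5 ^ finrank ℝ E : ℕ) := by
  classical
  -- Besicovitch's bound on separated sets is normalized to radius 2 and separation 1
  refine iSup₂_le fun C hC => iSup_le fun hsep => Set.encard_le_coe_iff_finite_ncard_le.2 ?_
  have hcard : ∀ s : Finset E, ↑s ⊆ C → s.card ≤ 5 ^ finrank ℝ E := fun s hs => by
    have hinj : Function.Injective fun x : E => (2 : ℝ) • x := smul_right_injective E two_ne_zero
    rw [← Finset.card_image_of_injective s hinj]
    refine Besicovitch.card_le_of_separated _ ?_ ?_ <;> simp only [Finset.forall_mem_image]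
    · intro x hx
      rw [norm_smul, mem_sphere_zero_iff_norm.1 (hC (hs hx))]
      norm_num
    · intro x hx y hy hxy
      have hdist : ((1 / 2 : NNReal) : ℝ≥0∞) < edist x y :=
        hsep (hs hx) (hs hy) (ne_of_apply_ne _ hxy)
      rw [edist_nndist, ENNReal.coe_lt_coe, ← NNReal.coe_lt_coe, coe_nndist, dist_eq_norm] at hdist
      rw [← smul_sub, norm_smul, Real.norm_two]
      push_cast at hdist
      linarith
  have hfin : C.Finite := by
    by_contra hinf
    obtain ⟨s, hs, hsc⟩ := Set.Infinite.exists_subset_card_eq hinf (5 ^ finrank ℝ E + 1)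
    exact absurd (hcard s hs) (by omega)
  refine ⟨hfin, ?_⟩
  rw [Set.ncard_eq_toFinset_card C hfin]
  exact hcard _ (by simp)

theorem exists_finset_net_sphere [FiniteDimensional ℝ E] :
    ∃ s : Finset E, s.card ≤ 5 ^ finrank ℝ E ∧ (∀ c ∈ s, ‖c‖ = 1) ∧
      ∀ v : E, ‖v‖ = 1 → ∃ c ∈ s, ‖v - c‖ ≤ 1 / 2 := by
  have hle := (coveringNumber_le_packingNumber _ _).trans (packingNumber_sphere_le (E := E))
  obtain ⟨C, hC, hfin, hcover, hcard⟩ :=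
    exists_set_encard_eq_coveringNumber (hle.trans_lt (ENat.natCast_lt_top _)).ne
  lift C to Finset E using hfin
  rw [← hcard, Set.encard_coe_eq_coe_finsetCard] at hle
  refine ⟨C, Nat.cast_le.1 hle, fun c hc => mem_sphere_zero_iff_norm.1 (hC hc), fun v hv => ?_⟩
  obtain ⟨c, hc, hvc : edist v c ≤ ((1 / 2 : NNReal) : ℝ≥0∞)⟩ :=
    hcover (mem_sphere_zero_iff_norm.2 hv)
  refine ⟨c, hc, ?_⟩
  rw [edist_nndist, ENNReal.coe_le_coe, ← NNReal.coe_le_coe, coe_nndist,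
    dist_eq_norm] at hvc
  simpa using hvc

theorem norm_le_two_mul_of_net [NormedAddCommGroup F] [NormedSpace ℝ F] {s : Finset E}
    (hnet : ∀ v, ‖v‖ = 1 → ∃ c ∈ s, ‖v - c‖ ≤ 1 / 2) (f : E →L[ℝ] F) {r : ℝ} (hr : 0 ≤ r)
    (h : ∀ c ∈ s, ‖f c‖ ≤ r) : ‖f‖ ≤ 2 * r := by
  have hself : ‖f‖ ≤ r + ‖f‖ * (1 / 2) := by
    refine f.opNorm_le_of_unit_norm (by positivity) fun v hv => ?_
    obtain ⟨c, hc, hvc⟩ := hnet v hv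
    calc ‖f v‖ = ‖f c + f (v - c)‖ := by rw [← map_add, add_sub_cancel]
      _ ≤ ‖f c‖ + ‖f (v - c)‖ := norm_add_le _ _
      _ ≤ r + ‖f‖ * (1 / 2) := add_le_add (h c hc) (f.le_opNorm_of_le hvc)
  linarith

end Net

section OperatorNormTail

variable {m n : Type*} [Fintype m] [Fintype n]

theorem lintegral_exp_norm_mulVec_sq_le {v : n → ℝ} (hv : ‖v‖₂ = 1) :
    ∫⁻ w, ENNReal.ofReal (Real.exp (‖of w *ᵥ v‖₂ ^ 2 / 4)) ∂(gaussianMat m n) ≤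
      2 ^ Fintype.card m := by
  let f : (n → ℝ) → ℝ≥0∞ := fun x => ENNReal.ofReal (Real.exp ((x ⬝ᵥ v) ^ 2 / 4))
  have hf : Measurable f := by
    have := (measurePreserving_dotProduct hv).measurable
    fun_prop
  have hrow : ∀ i : m, ∫⁻ w : m → n → ℝ, f (w i) ∂(gaussianMat m n) ≤ 2 := fun i =>
    ((measurePreserving_eval (fun _ : m => gaussianVec n) i).lintegral_comp hf).trans_le
      (((measurePreserving_dotProduct hv).lintegral_comp (by fun_prop)).trans_le
        lintegral_exp_sq_gaussianReal_le)
  have hprod : ∀ w : m → n → ℝ,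
      ENNReal.ofReal (Real.exp (‖of w *ᵥ v‖₂ ^ 2 / 4)) = ∏ i, f (w i) := fun w => by
    rw [← ENNReal.ofReal_prod_of_nonneg fun i _ => (Real.exp_pos _).le, ← Real.exp_sum,
      ← Finset.sum_div, norm_toLp_sq]
    simp [dotProduct, mulVec, sq]
  calc _ = ∫⁻ w, ∏ i, f (w i) ∂(gaussianMat m n) := lintegral_congr hprod
    _ = ∏ i, ∫⁻ w : m → n → ℝ, f (w i) ∂(gaussianMat m n) :=
        lintegral_prod_eq_prod_lintegral_of_indepFun Finset.univ _
          (iIndepFun_pi (X := fun _ => f) fun _ => hf.aemeasurable)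
          fun i => hf.comp (measurable_pi_apply i)
    _ ≤ ∏ _i : m, (2 : ℝ≥0∞) := Finset.prod_le_prod' fun i _ => hrow i
    _ = 2 ^ Fintype.card m := by simp

theorem gaussianMat_lt_norm_mulVec_le {v : n → ℝ} (hv : ‖v‖₂ = 1) {r : ℝ} (hr : 0 ≤ r) :
    gaussianMat m n {w | r < ‖of w *ᵥ v‖₂} ≤
      ENNReal.ofReal (2 ^ Fintype.card m * Real.exp (-(r ^ 2 / 4))) := by
  have hmeas : Measurable fun w : m → n → ℝ =>
      ENNReal.ofReal (Real.exp (‖of w *ᵥ v‖₂ ^ 2 / 4)) := by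
    have : Measurable fun w : m → n → ℝ => of w *ᵥ v :=
      measurable_pi_lambda _ fun i =>
        (measurePreserving_dotProduct hv).measurable.comp (measurable_pi_apply i)
    fun_prop
  have hsub : {w : m → n → ℝ | r < ‖of w *ᵥ v‖₂} ⊆
      {w | ENNReal.ofReal (Real.exp (r ^ 2 / 4)) ≤
        ENNReal.ofReal (Real.exp (‖of w *ᵥ v‖₂ ^ 2 / 4))} :=
      fun w (hw : r < ‖of w *ᵥ v‖₂) => by
    have := pow_le_pow_left₀ hr hw.le 2
    exact ENNReal.ofReal_le_ofReal (Real.exp_le_exp.2 (by linarith))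
  calc _ ≤ (∫⁻ w, ENNReal.ofReal (Real.exp (‖of w *ᵥ v‖₂ ^ 2 / 4)) ∂(gaussianMat m n)) /
        ENNReal.ofReal (Real.exp (r ^ 2 / 4)) :=
        (measure_mono hsub).trans (meas_ge_le_lintegral_div hmeas.aemeasurable
          (ENNReal.ofReal_pos.2 (Real.exp_pos _)).ne' ENNReal.ofReal_ne_top)
    _ ≤ ENNReal.ofReal (2 ^ Fintype.card m) / ENNReal.ofReal (Real.exp (r ^ 2 / 4)) := by
        gcongr
        simpa using lintegral_exp_norm_mulVec_sq_le hv
    _ = _ := by rw [← ENNReal.ofReal_div_of_pos (Real.exp_pos _), Real.exp_neg, div_eq_mul_inv]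

theorem gaussianMat_two_mul_lt_norm_le [DecidableEq n] {r : ℝ} (hr : 0 ≤ r) :
    gaussianMat m n {w | 2 * r < ‖of w‖} ≤ ENNReal.ofReal
      (5 ^ Fintype.card n * (2 ^ Fintype.card m * Real.exp (-(r ^ 2 / 4)))) := by
  obtain ⟨s, hcard, hs, hnet⟩ := exists_finset_net_sphere (E := EuclideanSpace ℝ n)
  rw [finrank_euclideanSpace] at hcard
  set p := 2 ^ Fintype.card m * Real.exp (-(r ^ 2 / 4))
  have hsub : {w : m → n → ℝ | 2 * r < ‖of w‖} ⊆ ⋃ c ∈ s, {w | r < ‖of w *ᵥ c.ofLp‖₂} := by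
    intro w (hw : 2 * r < ‖of w‖)
    by_contra hcon
    simp only [Set.mem_iUnion, Set.mem_ofPred_eq, not_exists, not_lt] at hcon
    refine absurd ?_ hw.not_ge
    rw [l2_opNorm_def]
    exact norm_le_two_mul_of_net hnet _ hr hcon
  calc _ ≤ ∑ c ∈ s, gaussianMat m n {w | r < ‖of w *ᵥ c.ofLp‖₂} :=
        (measure_mono hsub).trans (measure_biUnion_finset_le _ _)
    _ ≤ ∑ _c ∈ s, ENNReal.ofReal p :=
        Finset.sum_le_sum fun c hc => gaussianMat_lt_norm_mulVec_le (hs c hc) hr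
    _ = s.card * ENNReal.ofReal p := by rw [Finset.sum_const, nsmul_eq_mul]
    _ ≤ (5 ^ Fintype.card n : ℕ) * ENNReal.ofReal p := by gcongr
    _ = ENNReal.ofReal (5 ^ Fintype.card n * p) := by
        rw [ENNReal.ofReal_mul (p := 5 ^ Fintype.card n) (by positivity),
          ENNReal.ofReal_pow (by norm_num), ENNReal.ofReal_ofNat, Nat.cast_pow, Nat.cast_ofNat]

theorem gaussianMat_sqrt_max_card_lt_norm_le [DecidableEq n] [Nonempty n] {δ : ℝ} (hδ : 0 < δ)
    (hδ1 : δ ≤ 1) :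
    gaussianMat m n {w | 2 * (√(4 * Real.log (10 / δ)) *
      √(max (Fintype.card m) (Fintype.card n))) < ‖of w‖} ≤ ENNReal.ofReal δ := by
  refine (gaussianMat_two_mul_lt_norm_le (by positivity)).trans (ENNReal.ofReal_le_ofReal ?_)
  set k := max (Fintype.card m) (Fintype.card n)
  have hk : k ≠ 0 := (Fintype.card_pos.trans_le (le_max_right _ _)).ne'
  have hlog : 0 ≤ Real.log (10 / δ) := Real.log_nonneg (by rw [le_div_iff₀ hδ]; linarith)
  have hexp : Real.exp (-((√(4 * Real.log (10 / δ)) *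
      √(max (Fintype.card m) (Fintype.card n))) ^ 2 / 4)) = (δ / 10) ^ k := by
    rw [← Nat.cast_max, mul_pow, Real.sq_sqrt (by positivity), Real.sq_sqrt (by positivity),
      show -(4 * Real.log (10 / δ) * (k : ℝ) / 4) = k * Real.log (δ / 10) by
        rw [← inv_div 10 δ, Real.log_inv]
        ring, Real.exp_nat_mul, Real.exp_log (by positivity)]
  rw [hexp]
  calc (5 : ℝ) ^ Fintype.card n * (2 ^ Fintype.card m * (δ / 10) ^ k)
      ≤ 5 ^ k * (2 ^ k * (δ / 10) ^ k) := by
        gcongr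
        · norm_num
        · exact le_max_right _ _
        · norm_num
        · exact le_max_left _ _
    _ = δ ^ k := by
        rw [← mul_pow, ← mul_pow]
        congr 1
        ring
    _ ≤ δ := pow_le_of_le_one hδ.le hδ1 hk

end OperatorNormTail

section LeastSingularValue

variable {m n : Type*} [Fintype m] [Fintype n] {d : ℕ}

theorem exists_norm_eq_one_mulVec_eq_zero (M : Matrix m n ℝ)
    (hcard : Fintype.card m < Fintype.card n) : ∃ h, ‖h‖₂ = 1 ∧ M *ᵥ h = 0 := by
  have hker : LinearMap.ker M.mulVecLin ≠ ⊥ := LinearMap.ker_ne_bot_of_finrank_lt (by simpa)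
  obtain ⟨x, hx : M *ᵥ x = 0, hx0⟩ := Submodule.exists_mem_ne_zero_of_ne_bot hker
  have hnorm : ‖x‖₂ ≠ 0 := norm_ne_zero_iff.2 ((WithLp.toLp_eq_zero 2).not.2 hx0)
  refine ⟨‖x‖₂⁻¹ • x, ?_, by rw [mulVec_smul, hx, smul_zero]⟩
  rw [WithLp.toLp_smul, norm_smul, norm_inv, norm_norm, inv_mul_cancel₀ hnorm]

theorem exists_mem_orthogonalGroup_row_eq [DecidableEq n] (i : n) {g : n → ℝ} (hg : ‖g‖₂ = 1) :
    ∃ O ∈ orthogonalGroup n ℝ, O i = g := by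
  have hon : Orthonormal ℝ (({i} : Set n).domRestrict fun _ : n => WithLp.toLp 2 g) :=
    ⟨fun _ => hg, fun j k hjk => absurd (Subsingleton.elim j k) hjk⟩
  obtain ⟨b, hb⟩ := hon.exists_orthonormalBasis_extension_of_card_eq (by simp)
  refine ⟨of fun j => (b j).ofLp, (mem_orthogonalGroup_iff n ℝ).2 ?_, ?_⟩
  · ext j k
    have hjk := orthonormal_iff_ite.1 b.orthonormal k j
    rw [PiLp.inner_apply] at hjk
    rw [mul_apply, one_apply]
    simpa [eq_comm (a := j)] using hjk
  · exact congrArg WithLp.ofLp (hb i rfl)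

theorem isOpen_exists_norm_vecMul_lt {X : Type*} [TopologicalSpace X] {F : X → Matrix m n ℝ}
    (hF : Continuous F) (s : ℝ) {p : (m → ℝ) → X → Prop} (hp : ∀ u, IsOpen {x | p u x}) :
    IsOpen {x | ∃ u, ‖u ᵥ* F x‖₂ < s ∧ p u x} := by
  have hnorm : ∀ u : m → ℝ, Continuous fun x => ‖u ᵥ* F x‖₂ := fun u =>
    ((PiLp.continuous_toLp 2 _).comp (continuous_const.matrix_vecMul hF)).norm
  simp only [Set.ofPred_exists]
  exact isOpen_iUnion fun u => (isOpen_lt (hnorm u) continuous_const).inter (hp u)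

theorem continuous_of_add {k l : Type*} (M : Matrix k l ℝ) :
    Continuous fun w : k → l → ℝ => of w + M :=
  continuous_id.add continuous_const

theorem measurableSet_exists_norm_vecMul_add_lt (M : Matrix m n ℝ) (s : ℝ)
    (p : (m → ℝ) → Prop) :
    MeasurableSet {w : m → n → ℝ | ∃ u, ‖u ᵥ* (of w + M)‖₂ < s ∧ p u} :=
  (isOpen_exists_norm_vecMul_lt (p := fun u _ => p u) (continuous_of_add M) s
    fun _ => isOpen_const).measurableSet

theorem gaussianVec_abs_dotProduct_add_lt_le {h : n → ℝ} (hh : ‖h‖₂ = 1) (b s : ℝ) :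
    gaussianVec n {x | |x ⬝ᵥ h + b| < s} ≤ ENNReal.ofReal s :=
  (measure_preimage_le_of_measurePreserving (measurePreserving_dotProduct hh) _).trans
    (gaussianReal_abs_add_lt_le b s)

theorem abs_row_dotProduct_le_norm_vecMul {M : Matrix m n ℝ} {h : n → ℝ} (hh : ‖h‖₂ = 1) {i : m}
    (horth : ∀ j ≠ i, M j ⬝ᵥ h = 0) {u : m → ℝ} (hu : u i = 1) :
    |M i ⬝ᵥ h| ≤ ‖u ᵥ* M‖₂ := by
  have hrow : (u ᵥ* M) ⬝ᵥ h = M i ⬝ᵥ h := by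
    rw [← dotProduct_mulVec, dotProduct, Finset.sum_eq_single i, hu, one_mul]
    · rfl
    · exact fun j _ hj => mul_eq_zero_of_right _ (horth j hj)
    · simp
  rw [← hrow, ← mul_one ‖u ᵥ* M‖₂, ← hh]
  exact abs_dotProduct_le _ _

/- Given the other rows, the event forces the Gaussian row to be close to a hyperplane that
contains all of them. -/
theorem gaussianMat_exists_norm_vecMul_lt_of_apply_zero_le
    (M : Matrix (Fin (d + 1)) (Fin (d + 1)) ℝ) (s : ℝ) :
    gaussianMat (Fin (d + 1)) (Fin (d + 1)) {w | ∃ u, ‖u ᵥ* (of w + M)‖₂ < s ∧ u 0 = 1} ≤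
      ENNReal.ofReal s := by
  let e := MeasurableEquiv.piFinSuccAbove (fun _ : Fin (d + 1) => Fin (d + 1) → ℝ) 0
  have he : MeasurePreserving e.symm ((gaussianVec (Fin (d + 1))).prod
      (gaussianMat (Fin d) (Fin (d + 1)))) (gaussianMat (Fin (d + 1)) (Fin (d + 1))) :=
    (measurePreserving_piFinSuccAbove (fun _ => gaussianVec (Fin (d + 1))) 0).symm
  have hE := measurableSet_exists_norm_vecMul_add_lt M s fun u => u 0 = 1
  rw [← he.measure_preimage hE.nullMeasurableSet,
    Measure.prod_apply_symm (e.symm.measurable hE)]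
  refine (lintegral_mono fun y => ?_ : _ ≤ ∫⁻ _, ENNReal.ofReal s ∂_).trans_eq (by simp)
  obtain ⟨h, hh, horth⟩ :=
    exists_norm_eq_one_mulVec_eq_zero (of fun i => y i + M i.succ) (by simp)
  refine (measure_mono ?_).trans (gaussianVec_abs_dotProduct_add_lt_le hh (M 0 ⬝ᵥ h) s)
  rintro x ⟨u, hu, hu0⟩
  set N := of (e.symm (x, y)) + M
  have hN : ∀ i : Fin d, N i.succ ⬝ᵥ h = 0 := congrFun horth
  have hN0 : N 0 ⬝ᵥ h = x ⬝ᵥ h + M 0 ⬝ᵥ h := add_dotProduct x (M 0) h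
  refine lt_of_le_of_lt ?_ hu
  rw [← hN0]
  exact abs_row_dotProduct_le_norm_vecMul hh
    (Fin.forall_fin_succ.2 ⟨fun h0 => absurd rfl h0, fun i _ => hN i⟩) hu0

/- An orthogonal change of coordinates on the left turns the direction `g` into the first
coordinate axis. -/
theorem gaussianMat_exists_norm_vecMul_lt_of_dotProduct_le (M : Matrix (Fin d) (Fin d) ℝ) {t : ℝ}
    (ht : 0 ≤ t) (g : Fin d → ℝ) :
    gaussianMat (Fin d) (Fin d) {w | ∃ u, ‖u ᵥ* (of w + M)‖₂ < t ∧ 1 / 2 < |u ⬝ᵥ g|} ≤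
      ENNReal.ofReal (2 * t * ‖g‖₂) := by
  rcases eq_or_ne g 0 with rfl | hg
  · simp [not_lt_of_ge]
  obtain _ | d := d
  · exact absurd (Subsingleton.elim g 0) hg
  have hgn : 0 < ‖g‖₂ := norm_pos_iff.2 ((WithLp.toLp_eq_zero 2).not.2 hg)
  obtain ⟨O, hO, hO0⟩ := exists_mem_orthogonalGroup_row_eq 0 (g := ‖g‖₂⁻¹ • g) (by
    rw [WithLp.toLp_smul, norm_smul, norm_inv, norm_norm, inv_mul_cancel₀ hgn.ne'])
  refine (measure_mono ?_).trans ((measure_preimage_le_of_measurePreserving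
    (measurePreserving_orthogonal_mul hO) _).trans
      (gaussianMat_exists_norm_vecMul_lt_of_apply_zero_le (O * M) (2 * t * ‖g‖₂)))
  rintro w ⟨u, hu, hug⟩
  set y := (O *ᵥ u) 0 with hy
  have hyg : y = ‖g‖₂⁻¹ * (u ⬝ᵥ g) := by
    rw [hy, mulVec, hO0, smul_dotProduct, smul_eq_mul, dotProduct_comm]
  have hty : t ≤ |y| * (2 * t * ‖g‖₂) := by
    rw [hyg, abs_mul, abs_of_pos (inv_pos.2 hgn)]
    calc t ≤ t * (2 * |u ⬝ᵥ g|) := le_mul_of_one_le_right ht (by linarith)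
      _ = _ := by field_simp
  have hy0 : y ≠ 0 := by
    rw [hyg]
    exact mul_ne_zero (inv_ne_zero hgn.ne') (abs_pos.1 (one_half_pos.trans hug))
  refine ⟨y⁻¹ • (O *ᵥ u), ?_, inv_mul_cancel₀ hy0⟩
  have hrot : (y⁻¹ • (O *ᵥ u)) ᵥ* (of (of.symm (O * of w)) + O * M) =
      y⁻¹ • (u ᵥ* (of w + M)) := by
    rw [Equiv.apply_symm_apply, ← Matrix.mul_add, smul_vecMul, ← vecMul_vecMul,
      ← vecMul_transpose, vecMul_vecMul u, (mem_orthogonalGroup_iff' _ ℝ).1 hO, vecMul_one]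
  rw [hrot, WithLp.toLp_smul, norm_smul, norm_inv, Real.norm_eq_abs,
    inv_mul_lt_iff₀ (abs_pos.2 hy0)]
  exact hu.trans_le hty

theorem norm_toLp_le_sum_exp [Nonempty n] (g : n → ℝ) :
    ‖g‖₂ ≤ √(Fintype.card n) + 4 / √(Fintype.card n) * ∑ i, Real.exp (g i ^ 2 / 4) := by
  have hcard : 0 < √(Fintype.card n : ℝ) := Real.sqrt_pos.2 (Nat.cast_pos.2 Fintype.card_pos)
  have hsq : ‖g‖₂ ^ 2 ≤ 4 * ∑ i, Real.exp (g i ^ 2 / 4) := by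
    rw [norm_toLp_sq, dotProduct, Finset.mul_sum]
    exact Finset.sum_le_sum fun i _ => by linarith [Real.add_one_le_exp (g i ^ 2 / 4)]
  calc ‖g‖₂ ≤ √(Fintype.card n) + ‖g‖₂ ^ 2 / √(Fintype.card n) := by
        rw [← sub_le_iff_le_add', le_div_iff₀ hcard]
        nlinarith [sq_nonneg (‖g‖₂ - √(Fintype.card n)), norm_nonneg (WithLp.toLp 2 g)]
    _ ≤ √(Fintype.card n) + 4 * (∑ i, Real.exp (g i ^ 2 / 4)) / √(Fintype.card n) := by gcongr
    _ = _ := by ring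

theorem lintegral_norm_gaussianVec_le [Nonempty n] :
    ∫⁻ g, ENNReal.ofReal ‖g‖₂ ∂(gaussianVec n) ≤ ENNReal.ofReal (9 * √(Fintype.card n)) := by
  set s := √(Fintype.card n : ℝ)
  have hs : s * s = Fintype.card n := Real.mul_self_sqrt (Nat.cast_nonneg _)
  have hs0 : 0 < s := Real.sqrt_pos.2 (Nat.cast_pos.2 Fintype.card_pos)
  have hpt : ∀ g : n → ℝ, ENNReal.ofReal ‖g‖₂ ≤ ENNReal.ofReal s +
      ENNReal.ofReal (4 / s) * ∑ i, ENNReal.ofReal (Real.exp (g i ^ 2 / 4)) := fun g => by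
    have hsum : 0 ≤ ∑ i, Real.exp (g i ^ 2 / 4) :=
      Finset.sum_nonneg fun i _ => (Real.exp_pos _).le
    rw [← ENNReal.ofReal_sum_of_nonneg fun i _ => (Real.exp_pos _).le,
      ← ENNReal.ofReal_mul (by positivity), ← ENNReal.ofReal_add hs0.le (by positivity)]
    exact ENNReal.ofReal_le_ofReal (norm_toLp_le_sum_exp g)
  have hcoord : ∀ i : n,
      ∫⁻ g : n → ℝ, ENNReal.ofReal (Real.exp (g i ^ 2 / 4)) ∂(gaussianVec n) ≤ 2 := fun i =>
    ((measurePreserving_eval (fun _ : n => gaussianReal 0 1) i).lintegral_comp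
      (f := fun x => ENNReal.ofReal (Real.exp (x ^ 2 / 4))) (by fun_prop)).trans_le
      lintegral_exp_sq_gaussianReal_le
  calc _ ≤ ∫⁻ g : n → ℝ, (ENNReal.ofReal s +
          ENNReal.ofReal (4 / s) * ∑ i, ENNReal.ofReal (Real.exp (g i ^ 2 / 4))) ∂(gaussianVec n) :=
        lintegral_mono hpt
    _ = ENNReal.ofReal s + ENNReal.ofReal (4 / s) *
          ∑ i, ∫⁻ g : n → ℝ, ENNReal.ofReal (Real.exp (g i ^ 2 / 4)) ∂(gaussianVec n) := by
        rw [lintegral_add_left measurable_const, lintegral_const, measure_univ, mul_one,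
          lintegral_const_mul _ (by fun_prop), lintegral_finsetSum _ fun i _ => by fun_prop]
    _ ≤ ENNReal.ofReal s + ENNReal.ofReal (4 / s) * ∑ _i : n, 2 := by
        gcongr with i
        exact hcoord i
    _ = ENNReal.ofReal (s + 4 / s * (s * s * 2)) := by
        rw [ENNReal.ofReal_add hs0.le (by positivity), ENNReal.ofReal_mul (by positivity), hs,
          ENNReal.ofReal_mul (Nat.cast_nonneg _), Finset.sum_const, nsmul_eq_mul,
          ENNReal.ofReal_natCast, ENNReal.ofReal_ofNat, Finset.card_univ]
    _ = _ := by
        congr 1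
        field_simp
        norm_num

theorem measurableSet_exists_norm_vecMul_add_lt_and_lt_abs_dotProduct (M : Matrix m n ℝ) (t : ℝ) :
    MeasurableSet {p : (m → ℝ) × (m → n → ℝ) |
      ∃ u, ‖u ᵥ* (of p.2 + M)‖₂ < t ∧ ‖u‖₂ = 1 ∧ 1 / 2 < |u ⬝ᵥ p.1|} :=
  (isOpen_exists_norm_vecMul_lt (F := fun p : (m → ℝ) × (m → n → ℝ) => of p.2 + M)
    (p := fun u p => ‖u‖₂ = 1 ∧ 1 / 2 < |u ⬝ᵥ p.1|)
    ((continuous_of_add M).comp continuous_snd) t fun _ =>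
      isOpen_const.and (isOpen_lt continuous_const
        (continuous_const.dotProduct continuous_fst).abs)).measurableSet

/- A unit vector `u` that witnesses a small singular value has `1 / 2 < |u ⬝ᵥ g|` with probability
at least `1 / 2` for an independent Gaussian `g`, which reduces the claim to a fixed direction at
the cost of a factor of two. -/
theorem half_mul_gaussianMat_exists_norm_vecMul_lt_le (M : Matrix m n ℝ) (t : ℝ) :
    ENNReal.ofReal (1 / 2) *
        gaussianMat m n {w | ∃ u, ‖u ᵥ* (of w + M)‖₂ < t ∧ ‖u‖₂ = 1} ≤
      (gaussianVec m).prod (gaussianMat m n)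
        {p | ∃ u, ‖u ᵥ* (of p.2 + M)‖₂ < t ∧ ‖u‖₂ = 1 ∧ 1 / 2 < |u ⬝ᵥ p.1|} := by
  rw [Measure.prod_apply_symm
      (measurableSet_exists_norm_vecMul_add_lt_and_lt_abs_dotProduct M t),
    ← lintegral_indicator_const (measurableSet_exists_norm_vecMul_add_lt M t fun u => ‖u‖₂ = 1)]
  refine lintegral_mono fun w => Set.indicator_apply_le' ?_ fun _ => zero_le
  rintro ⟨u, hu, hu1⟩
  have hms : MeasurableSet {x : ℝ | 1 / 2 < |x|} :=
    (isOpen_lt continuous_const continuous_abs).measurableSet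
  refine half_le_gaussianReal_half_lt_abs.trans ?_
  rw [← (measurePreserving_dotProduct hu1).measure_preimage hms.nullMeasurableSet]
  exact measure_mono fun g (hg : 1 / 2 < |g ⬝ᵥ u|) => ⟨u, hu, hu1, by rwa [dotProduct_comm]⟩

theorem gaussianMat_exists_norm_vecMul_lt_le (hd : 0 < d) (M : Matrix (Fin d) (Fin d) ℝ) {t : ℝ}
    (ht : 0 ≤ t) :
    gaussianMat (Fin d) (Fin d) {w | ∃ u, ‖u ᵥ* (of w + M)‖₂ < t ∧ ‖u‖₂ = 1} ≤
      ENNReal.ofReal (36 * t * √d) := by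
  have : Nonempty (Fin d) := ⟨⟨0, hd⟩⟩
  have hslice : ∀ g, gaussianMat (Fin d) (Fin d)
      {w | ∃ u, ‖u ᵥ* (of w + M)‖₂ < t ∧ ‖u‖₂ = 1 ∧ 1 / 2 < |u ⬝ᵥ g|} ≤
        ENNReal.ofReal (2 * t) * ENNReal.ofReal ‖g‖₂ := fun g => by
    rw [← ENNReal.ofReal_mul (by positivity)]
    refine (measure_mono ?_).trans (gaussianMat_exists_norm_vecMul_lt_of_dotProduct_le M ht g)
    exact fun w ⟨u, hu, _, hug⟩ => ⟨u, hu, hug⟩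
  have hprod : (gaussianVec (Fin d)).prod (gaussianMat (Fin d) (Fin d))
      {p | ∃ u, ‖u ᵥ* (of p.2 + M)‖₂ < t ∧ ‖u‖₂ = 1 ∧ 1 / 2 < |u ⬝ᵥ p.1|} ≤
        ENNReal.ofReal (2 * t) * ENNReal.ofReal (9 * √d) := by
    rw [Measure.prod_apply (measurableSet_exists_norm_vecMul_add_lt_and_lt_abs_dotProduct M t)]
    refine (lintegral_mono hslice).trans ?_
    rw [lintegral_const_mul _ (by fun_prop)]
    gcongr
    simpa using lintegral_norm_gaussianVec_le (n := Fin d)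
  calc _ = ENNReal.ofReal 2 * (ENNReal.ofReal (1 / 2) *
          gaussianMat (Fin d) (Fin d) {w | ∃ u, ‖u ᵥ* (of w + M)‖₂ < t ∧ ‖u‖₂ = 1}) := by
        rw [← mul_assoc, ← ENNReal.ofReal_mul two_pos.le, mul_one_div_cancel two_ne_zero,
          ENNReal.ofReal_one, one_mul]
    _ ≤ ENNReal.ofReal 2 * (ENNReal.ofReal (2 * t) * ENNReal.ofReal (9 * √d)) := by
        exact mul_le_mul_right ((half_mul_gaussianMat_exists_norm_vecMul_lt_le M t).trans hprod) _
    _ = _ := by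
        rw [← ENNReal.ofReal_mul (by positivity), ← ENNReal.ofReal_mul two_pos.le]
        congr 1
        ring

end LeastSingularValue

section GaussianInitialization

variable {d m' n' : ℕ}

theorem boundedBelow_of_le_norm_vecMul {n : Type*} [Fintype n] {s : ℝ} {M : Matrix n n ℝ}
    (h : ∀ u, ‖u‖₂ = 1 → s ≤ ‖u ᵥ* M‖₂) : BoundedBelow s M := by
  have hT : BoundedBelow s Mᵀ := fun u => by
    rw [mulVec_transpose]
    rcases eq_or_ne u 0 with rfl | hu
    · simp
    have hpos : 0 < ‖u‖₂ := norm_pos_iff.2 ((WithLp.toLp_eq_zero 2).not.2 hu)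
    have hunit := h (‖u‖₂⁻¹ • u) (by
      rw [WithLp.toLp_smul, norm_smul, norm_inv, norm_norm, inv_mul_cancel₀ hpos.ne'])
    rwa [smul_vecMul, WithLp.toLp_smul, norm_smul, norm_inv, norm_norm, le_inv_mul_iff₀ hpos,
      mul_comm] at hunit
  simpa using hT.transpose

theorem gaussianMat_prod_not_boundedBelow_le (hd : 0 < d) {t : ℝ} (ht : 0 ≤ t) :
    (gaussianMat (Fin d) (Fin d)).prod (gaussianMat (Fin d) (Fin d))
      {w | ¬ BoundedBelow t (of w.1 + of w.2)} ≤ ENNReal.ofReal (36 * t * √d) := by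
  have hsum : Continuous fun w : (Fin d → Fin d → ℝ) × (Fin d → Fin d → ℝ) =>
      of w.1 + of w.2 := continuous_fst.add continuous_snd
  have hmeas := (isOpen_exists_norm_vecMul_lt hsum t (p := fun u _ => ‖u‖₂ = 1)
    fun _ => isOpen_const).measurableSet
  calc _ ≤ (gaussianMat (Fin d) (Fin d)).prod (gaussianMat (Fin d) (Fin d))
        {w | ∃ u, ‖u ᵥ* (of w.1 + of w.2)‖₂ < t ∧ ‖u‖₂ = 1} := by
        refine measure_mono fun w hw => ?_
        by_contra hcon
        exact hw (boundedBelow_of_le_norm_vecMul fun u hu => not_lt.1 fun hlt =>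
          hcon ⟨u, hlt, hu⟩)
    _ ≤ ∫⁻ _, ENNReal.ofReal (36 * t * √d) ∂(gaussianMat (Fin d) (Fin d)) := by
        rw [Measure.prod_apply_symm hmeas]
        exact lintegral_mono fun w => gaussianMat_exists_norm_vecMul_lt_le hd (of w) ht
    _ = ENNReal.ofReal (36 * t * √d) := by simp

theorem exists_gaussianMat_lt_norm_le {δ : ℝ} (hδ : 0 < δ) : ∃ c₀ : ℝ, ∀ c ≥ c₀, ∀ k l : ℕ,
    0 < l → gaussianMat (Fin k) (Fin l) {w | c * √(max (k : ℝ) l) < ‖of w‖} ≤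
      ENNReal.ofReal δ := by
  refine ⟨2 * √(4 * Real.log (10 / min δ 1)), fun c hc k l hl => ?_⟩
  have : Nonempty (Fin l) := ⟨⟨0, hl⟩⟩
  have htail := gaussianMat_sqrt_max_card_lt_norm_le (m := Fin k) (n := Fin l)
    (lt_min hδ one_pos) (min_le_right δ 1)
  simp only [Fintype.card_fin, ← mul_assoc] at htail
  refine (measure_mono fun (w : Fin k → Fin l → ℝ) (hw : c * √(max (k : ℝ) l) < ‖of w‖) => ?_).trans
    (htail.trans (ENNReal.ofReal_le_ofReal (min_le_left _ _)))
  exact (mul_le_mul_of_nonneg_right hc (Real.sqrt_nonneg _)).trans_lt hw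

theorem measurePreserving_upper (d k : ℕ) :
    MeasurePreserving (fun w : Fin (d + k) → Fin d → ℝ => of.symm (upper (of w)))
      (gaussianMat (Fin (d + k)) (Fin d)) (gaussianMat (Fin d) (Fin d)) :=
  measurePreserving_gaussianMat_comp (Fin.castAdd_injective d k)

theorem measurePreserving_lower (d k : ℕ) :
    MeasurePreserving (fun w : Fin (d + k) → Fin d → ℝ => of.symm (lower (of w)))
      (gaussianMat (Fin (d + k)) (Fin d)) (gaussianMat (Fin k) (Fin d)) :=
  measurePreserving_gaussianMat_comp (Fin.natAdd_injective k d)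

theorem initBound_smul {c ε : ℝ} (hd : 0 < d) (hε : 0 ≤ ε)
    {X : Matrix (Fin (d + m')) (Fin d) ℝ} {Y : Matrix (Fin (d + n')) (Fin d) ℝ}
    (hU : ‖upper X‖ ≤ c * √d) (hV : ‖upper Y‖ ≤ c * √d)
    (hJ : ‖lower X‖ ≤ c * √(max (m' : ℝ) d)) (hK : ‖lower Y‖ ≤ c * √(max (n' : ℝ) d))
    (hA : BoundedBelow (2 / (c * √d)) (upper X + upper Y)) :
    InitBound c ε (ε • X) (ε • Y) := by
  have hsymA : symA (ε • X) (ε • Y) = (ε / 2) • (upper X + upper Y) := by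
    change (1 / 2 : ℝ) • (ε • upper X + ε • upper Y) = _
    module
  have hasymB : asymB (ε • X) (ε • Y) = (ε / 2) • (upper X - upper Y) := by
    change (1 / 2 : ℝ) • (ε • upper X - ε • upper Y) = _
    module
  have hlower : ∀ {k : ℕ} {Z : Matrix (Fin (d + k)) (Fin d) ℝ},
      ‖lower Z‖ ≤ c * √(max (k : ℝ) d) → ‖ε • lower Z‖ ≤ c * ε * √(max (k : ℝ) d) :=
    fun hZ => (norm_smul_le_of_norm_le hε hZ).trans_eq (by ring)
  refine ⟨?_, ?_, ?_, hlower hJ, hlower hK⟩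
  · rw [le_singVal_iff hd, hsymA]
    exact (hA.smul (by positivity)).mono (by ring_nf; rfl)
  · rw [singVal_one_eq_norm, hsymA]
    exact (norm_smul_le_of_norm_le (by positivity) (norm_add_le_of_le hU hV)).trans_eq (by ring)
  · calc frobNorm (asymB (ε • X) (ε • Y)) ≤ √d * ‖asymB (ε • X) (ε • Y)‖ :=
          frobNorm_le_sqrt_mul_norm _
      _ ≤ √d * (ε / 2 * (c * √d + c * √d)) := by
          rw [hasymB]
          gcongr
          exact norm_smul_le_of_norm_le (by positivity) (norm_sub_le_of_le hU hV)
      _ = c * (√d * √d) * ε := by ring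
      _ = c * d * ε := by rw [Real.mul_self_sqrt d.cast_nonneg]

theorem gaussianMat_prod_not_initBound_le {c ε δ : ℝ} (hd : 0 < d) (hc : 0 < c) (hε : 0 ≤ ε)
    (hδ : 0 ≤ δ) (hδc : 72 / c ≤ δ)
    (htail : ∀ k : ℕ, gaussianMat (Fin k) (Fin d) {w | c * √(max (k : ℝ) d) < ‖of w‖} ≤
      ENNReal.ofReal δ) :
    (gaussianMat (Fin (d + m')) (Fin d)).prod (gaussianMat (Fin (d + n')) (Fin d))
      {w | ¬ InitBound c ε (ε • of w.1) (ε • of w.2)} ≤ ENNReal.ofReal (5 * δ) := by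
  set P := (gaussianMat (Fin (d + m')) (Fin d)).prod (gaussianMat (Fin (d + n')) (Fin d))
  have htail_square := max_self (d : ℝ) ▸ htail d
  have hcond : ENNReal.ofReal (36 * (2 / (c * √d)) * √d) ≤ ENNReal.ofReal δ := by
    refine ENNReal.ofReal_le_ofReal (le_of_eq_of_le ?_ hδc)
    have : (0 : ℝ) < d := Nat.cast_pos.2 hd
    field_simp
    norm_num
  let E : Fin 5 → Set ((Fin (d + m') → Fin d → ℝ) × (Fin (d + n') → Fin d → ℝ)) := ![
    {w | c * √d < ‖upper (of w.1)‖}, {w | c * √d < ‖upper (of w.2)‖},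
    {w | c * √(max (m' : ℝ) d) < ‖lower (of w.1)‖},
    {w | c * √(max (n' : ℝ) d) < ‖lower (of w.2)‖},
    {w | ¬ BoundedBelow (2 / (c * √d)) (upper (of w.1) + upper (of w.2))}]
  have hE : ∀ i, P (E i) ≤ ENNReal.ofReal δ := fun
    | 0 => (measure_preimage_le_of_measurePreserving
        ((measurePreserving_upper d m').comp measurePreserving_fst) _).trans htail_square
    | 1 => (measure_preimage_le_of_measurePreserving
        ((measurePreserving_upper d n').comp measurePreserving_snd) _).trans htail_square
    | 2 => (measure_preimage_le_of_measurePreserving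
        ((measurePreserving_lower d m').comp measurePreserving_fst) _).trans (htail m')
    | 3 => (measure_preimage_le_of_measurePreserving
        ((measurePreserving_lower d n').comp measurePreserving_snd) _).trans (htail n')
    | 4 => (measure_preimage_le_of_measurePreserving
        ((measurePreserving_upper d m').prod (measurePreserving_upper d n')) _).trans
          ((gaussianMat_prod_not_boundedBelow_le hd (by positivity)).trans hcond)
  have hsub : {w | ¬ InitBound c ε (ε • of w.1) (ε • of w.2)} ⊆ ⋃ i, E i := fun w hw => by
    by_contra hcon
    rw [Set.mem_iUnion, not_exists] at hcon
    exact hw (initBound_smul hd hε (not_lt.1 (hcon 0)) (not_lt.1 (hcon 1)) (not_lt.1 (hcon 2))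
      (not_lt.1 (hcon 3)) (not_not.1 (hcon 4)))
  calc _ ≤ ∑ i, P (E i) := (measure_mono hsub).trans (measure_iUnion_fintype_le P E)
    _ ≤ ∑ _i : Fin 5, ENNReal.ofReal δ := Finset.sum_le_sum fun i _ => hE i
    _ = ENNReal.ofReal (5 * δ) := by
        rw [← ENNReal.ofReal_sum_of_nonneg fun _ _ => hδ]
        simp

theorem measurePreserving_gaussianInit {m n d : ℕ} {ε : ℝ} (hε : ε ≠ 0)
    {O : Matrix (Fin m) (Fin m) ℝ} {Q : Matrix (Fin n) (Fin n) ℝ}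
    (hO : O ∈ orthogonalGroup (Fin m) ℝ) (hQ : Q ∈ orthogonalGroup (Fin n) ℝ) :
    MeasurePreserving (fun w : (Fin m → Fin d → ℝ) × (Fin n → Fin d → ℝ) =>
        (of.symm (O * of (ε⁻¹ • w.1)), of.symm (Q * of (ε⁻¹ • w.2))))
      (gaussianInit m n d ε) ((gaussianMat (Fin m) (Fin d)).prod (gaussianMat (Fin n) (Fin d))) :=
  ((measurePreserving_orthogonal_mul hO).comp (measurePreserving_inv_smul hε)).prod
    ((measurePreserving_orthogonal_mul hQ).comp (measurePreserving_inv_smul hε))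

theorem exists_gaussianInit_not_initBound_le {δ : ℝ} (hδ : 0 < δ) : ∃ c : ℝ, 0 < c ∧
    ∀ (d m' n' : ℕ) (_ : 0 < d) (Φ : Matrix (Fin (d + m')) (Fin (d + m')) ℝ)
      (Ψ : Matrix (Fin (d + n')) (Fin (d + n')) ℝ) (_ : Φ ∈ orthogonalGroup (Fin (d + m')) ℝ)
      (_ : Ψ ∈ orthogonalGroup (Fin (d + n')) ℝ) (ε : ℝ) (_ : 0 < ε),
      gaussianInit (d + m') (d + n') d ε {w | ¬ InitBound c ε (Φᵀ * of w.1) (Ψᵀ * of w.2)} ≤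
        ENNReal.ofReal δ := by
  obtain ⟨c₀, htail⟩ := exists_gaussianMat_lt_norm_le (show 0 < δ / 5 by positivity)
  have hc : 0 < max c₀ (360 / δ) := lt_max_of_lt_right (by positivity)
  have hδc : 72 / max c₀ (360 / δ) ≤ δ / 5 := by
    have hle := le_max_right c₀ (360 / δ)
    rw [div_le_iff₀ hδ] at hle
    rw [div_le_iff₀ hc]
    linarith
  refine ⟨max c₀ (360 / δ), hc, fun d m' n' hd Φ Ψ hΦ hΨ ε hε => ?_⟩
  have hrescale : ∀ {k : ℕ} (O : Matrix (Fin k) (Fin k) ℝ) (x : Fin k → Fin d → ℝ),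
      ε • (O * of (ε⁻¹ • x)) = O * of x := fun O x => by
    have hsmul : of (ε⁻¹ • x) = ε⁻¹ • of x := rfl
    rw [hsmul, Matrix.mul_smul, smul_inv_smul₀ hε.ne']
  have hbound := gaussianMat_prod_not_initBound_le (m' := m') (n' := n') hd hc hε.le
    (by positivity) hδc fun k => htail _ (le_max_left _ _) k d hd
  rw [mul_div_cancel₀ δ (by norm_num)] at hbound
  refine le_trans ?_ ((measure_preimage_le_of_measurePreserving (measurePreserving_gaussianInit
    hε.ne' (Unitary.star_mem hΦ) (Unitary.star_mem hΨ)) _).trans hbound)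
  refine measure_mono fun w hw => ?_
  change ¬ InitBound (max c₀ (360 / δ)) ε (ε • (Φᵀ * of (ε⁻¹ • w.1))) (ε • (Ψᵀ * of (ε⁻¹ • w.2)))
  rwa [hrescale, hrescale]

end GaussianInitialization

end LowRankGD

end

open LowRankGD in
theorem theorem2 :
    -- Stage one of gradient descent, from every initialization that obeys the bounds with `c`.
    (∃ p : ℕ, ∀ c : ℝ, 0 < c → ∃ k₁ k₂ C : ℝ, 0 < k₁ ∧ 0 < k₂ ∧ 0 < C ∧
      ∀ (d m' n' : ℕ) (hd : 0 < d)
        (S : Matrix (Fin (d + m')) (Fin (d + n')) ℝ) (σ : Fin d → ℝ)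
        (Φ : Matrix (Fin (d + m')) (Fin (d + m')) ℝ)
        (Ψ : Matrix (Fin (d + n')) (Fin (d + n')) ℝ) (_ : IsSVD S σ Φ Ψ)
        (m n σ₁ σd ε η : ℝ)
        (_ : m = d + m') (_ : n = d + n')
        (_ : σ₁ = σ ⟨0, hd⟩) (_ : σd = σ ⟨d - 1, Nat.sub_lt hd one_pos⟩)
        (_ : 0 < ε)
        (_ : ε ≤ k₁ * (σd / (√((d : ℝ) ^ 3 * σ₁) * (m + n)))
          / (1 + Real.log ((m + n) * (σ₁ / σd))) ^ p)
        (_ : 0 < η) (_ : η ≤ k₂ * (σd * ε ^ 2 / (d * σ₁ ^ 3))),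
        ∃ T₀ : ℕ, (T₀ : ℝ) ≤ C * (1 / (η * σd) * Real.log (d * σd / ε ^ 2)) ∧
          ∀ (U₀ : Matrix (Fin (d + m')) (Fin d) ℝ) (V₀ : Matrix (Fin (d + n')) (Fin d) ℝ)
            (X : ℕ → Matrix (Fin (d + m')) (Fin d) ℝ)
            (Y : ℕ → Matrix (Fin (d + n')) (Fin d) ℝ),
            (∀ t, X t = Φ.transpose * (gd S η U₀ V₀ t).1) →
            (∀ t, Y t = Ψ.transpose * (gd S η U₀ V₀ t).2) →
            InitBound c ε (X 0) (Y 0) →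
            (∀ t ≤ T₀,
              Loewner ((ε ^ 2 / (c ^ 2 * d)) • (1 : Matrix (Fin d) (Fin d) ℝ))
                (symA (X t) (Y t) * (symA (X t) (Y t)).transpose) ∧
              Loewner (symA (X t) (Y t) * (symA (X t) (Y t)).transpose)
                ((2 : ℝ) • Matrix.diagonal σ) ∧
              frobNorm (asymB (X t) (Y t)) ≤ 2 * c * d * ε ∧
              opNorm (lower (X t)) ≤ c * ε * √(max (m' : ℝ) d) ∧
              opNorm (lower (Y t)) ≤ c * ε * √(max (n' : ℝ) d)) ∧
            √(σd / 2) ≤ singVal d (symA (X T₀) (Y T₀)) ∧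
            singVal 1 (errP σ (X T₀) (Y T₀)) ≤ σd / 4) ∧
    -- A Gaussian initialization obeys these bounds with high probability.
    (∀ δ : ℝ, 0 < δ → ∃ c : ℝ, 0 < c ∧
      ∀ (d m' n' : ℕ) (_ : 0 < d)
        (Φ : Matrix (Fin (d + m')) (Fin (d + m')) ℝ)
        (Ψ : Matrix (Fin (d + n')) (Fin (d + n')) ℝ)
        (_ : Φ ∈ Matrix.orthogonalGroup (Fin (d + m')) ℝ)
        (_ : Ψ ∈ Matrix.orthogonalGroup (Fin (d + n')) ℝ)
        (ε : ℝ) (_ : 0 < ε),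
        gaussianInit (d + m') (d + n') d ε
          {w | ¬ InitBound c ε (Φ.transpose * Matrix.of w.1) (Ψ.transpose * Matrix.of w.2)}
          ≤ ENNReal.ofReal δ) := by
  exact ⟨⟨1, fun c hc => by simp only [pow_one]; exact exists_warmUp_constants hc⟩,
    fun δ hδ => exists_gaussianInit_not_initBound_le hδ⟩
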